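/- **Setting.** Let $0\le n<N$, let $U\subset\mathbb R^N$ be open, and let $S\subset\mathbb R^N$ be a smooth embedded hypersurface that is a closed subset, oriented by a unit normal $\nu_S$. The $C^k$ regularity scale $r_k(S,x)\in(0,\infty]$ of $S$ at $x\in S$ is the supremum of the $r>0$ for which there are a unit vector $\omega$ and a function $u:D\to\mathbb R$, $D\subset\omega^\perp$ a relatively open subset of the ball $\{|z|<r\}$, such that $S\cap\{x+z+s\omega: z\perp\omega,\ |z|<r,\ |s|<r\}=\{x+z+u(z)\omega: z\in D\}$ and $\sum_{i=0}^{k} r^{i-1}\sup_D|D^iu|\le 1$; put $r_k(S)=\inf_{x\in S} r_k(S,x)$. Assume $r_2(S)>0$. For $x\in S$ the reflection regularity scale $r_S(x)$ is the supremum of the $0<r\le r_3(S,x)$ with the following property. Near $x$ write $S$ as a graph $\{x+z+u(z)\nu_S(x)\}$, $z\in T_xS$, $|z|<\rho$, $u(0)=0$, for some $\rho\in[r,r_3(S,x)]$, identify $\mathbb R^N$ with $T_xS\times\mathbb R$ through $x+z+s\nu_S(x)$, and set $\Phi(z,s)=y+s\nu_S(y)$ with $y=x+z+u(z)\nu_S(x)$.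 Then $\Phi$ on $\{|z|<r,\,|s|\le r\}$, and an inverse of $\Phi$ centred at $x$, which exists on $B_r(x)$, both satisfy $|F-\mathrm{Id}|(p)\le c_0|p-x|^2/r$, $|DF-\mathrm{Id}|(p)\le c_0|p-x|/r$, $|D^2F|(p)\le c_0/r$, where $c_0$ is a fixed constant (its choice plays no role below). Put $r_S=\inf_{x\in S}r_S(x)\in[0,\infty]$; then $r_S\le r_2(S)$, so every $S$ with $r_S>0$ is allowed. We use $1/\infty=0$, $1/0=\infty$, $\infty\cdot 0=0$. Let $V$ be an integral $n$-varifold in $U$ (a Radon measure on $U\times Gr(n,N)$ of the form $V(\phi)=\sum_i\int_{A_i}\phi(x,T_xM_i)\,d\mathcal H^n$ with $M_i$ $n$-dimensional $C^1$ submanifolds and $A_i\subset M_i$), with mass measure $\mu_V$, and let $\delta V(X)=\int \mathrm{div}_V X\,d\mu_V$ for $X\in C^1_c(U,\mathbb R^N)$. For open $W\subset U$ put $\|\delta V\|(W)=\sup\{\delta V(Y): Y\in C^1_c(W,\mathbb R^N),\ |Y|\le1\}$. $\delta V$ is *locally finite* if for every open $W\subset\subset U$ there is $C_W$ with $|\delta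 V(X)|\le C_W\sup|X|$ for all $X\in C^1_c(W,\mathbb R^N)$. In that case there are a vector field $H_V\in L^1_{loc}(U;\mu_V)$, a Radon measure $\sigma_V$ on $U$ singular to $\mu_V$ (the generalized boundary measure) and a Borel field $\nu_V$ with $|\nu_V|=1$ $\sigma_V$-a.e. (the generalized outward conormal), unique up to null sets, with $\delta V(X)=-\int H_V\cdot X\,d\mu_V+\int X\cdot\nu_V\,d\sigma_V$ for all $X\in C^1_c(U,\mathbb R^N)$. For a vector field $H$ put $S^T(H)=H-1_S(H\cdot\nu_S)\nu_S$. $V$ has *free boundary in $S$* if there is $H$ with $S^T(H)\in L^1_{loc}(U,\mathbb R^N;\mu_V)$ and $\delta V(X)=-\int S^T(H)\cdot X\,d\mu_V$ for every $X\in C^1_c(U,\mathbb R^N)$ with $X\cdot\nu_S=0$ on $S$. **Statement.** There is a constant $c=c(n)$, depending only on $n$, such that for all $N,S,\nu_S,U,V$ as above: 1. If $V$ has free boundary in $S$, then $\delta V$ is locally finite in $U$, and for every $H$ as in the definition of free boundary and all open $W\subset\subset W'\subset\subset U$, $$\|\delta V\|(W)\le c\int_{W'}|S^T(H)|\,d\mu_V+c\Big(\frac1{r_S}+\frac1{d(W,\partial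 W')}\Big)\mu_V(W');$$ the same inequality holds with $r_2(S)$ in place of $r_S$. 2. $V$ has free boundary in $S$ if and only if $\delta V$ is locally finite, $\sigma_V(\mathbb R^N\setminus S)=0$, and $\nu_V=\pm\nu_S$ (the sign may depend on the point) $\sigma_V$-a.e. 3. If moreover $S=\partial\Omega$ for an open set $\Omega$, with $\nu_S$ pointing out of $\Omega$ (for each $x\in S$, $x+t\nu_S(x)\notin\overline\Omega$ for all small $t>0$), and $\mathrm{spt}\,\mu_V\subset\overline\Omega$, then $V$ has free boundary in $S$ if and only if $\delta V$ is locally finite, $\sigma_V(\mathbb R^N\setminus S)=0$, and $\nu_V=\nu_S$ $\sigma_V$-a.e. -/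

import Mathlib

open MeasureTheory Set Metric Filter Topology
open scoped ENNReal NNReal RealInnerProductSpace

noncomputable section

/-- Euclidean space `ℝ^N`. -/
abbrev Eucl (N : ℕ) : Type := EuclideanSpace ℝ (Fin N)

/-! ### Varifolds -/

/-- The Grassmannian of unoriented `n`-planes through the origin in `ℝ^N`. -/
def Gras (n N : ℕ) : Type := {L : Submodule ℝ (Eucl N) // Module.finrank ℝ L = n}

/-- The orthogonal projection of `ℝ^N` onto the plane `L`. -/
def Gras.proj {n N : ℕ} (L : Gras n N) : Eucl N →L[ℝ] Eucl N := L.1.starProjection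

/-- The usual topology of the Grassmannian: planes are close if their projections are. -/
instance (n N : ℕ) : TopologicalSpace (Gras n N) :=
  TopologicalSpace.induced Gras.proj inferInstance

instance (n N : ℕ) : MeasurableSpace (Gras n N) := borel _

instance (n N : ℕ) : BorelSpace (Gras n N) := ⟨rfl⟩

/-- An `n`-varifold in the open set `U ⊆ ℝ^N`: a Radon measure on `U × Gr(n, N)`, written as a
Borel measure on `ℝ^N × Gr(n, N)` that is carried by `U × Gr(n, N)` and is finite over compact
subsets of `U` (the Grassmannian is compact). -/
structure Varifold (n N : ℕ) (U : Set (Eucl N)) where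
  toMeasure : Measure (Eucl N × Gras n N)
  carried : toMeasure (Uᶜ ×ˢ univ) = 0
  locallyFinite : ∀ K : Set (Eucl N), IsCompact K → K ⊆ U → toMeasure (K ×ˢ univ) < ∞

/-- `M` is an embedded `C¹` submanifold of dimension `n` of `ℝ^N`, and `T y` is its tangent plane
at each `y ∈ M` (the values of `T` off `M` are irrelevant). Locally `M` is the zero set of a `C¹`
map into `ℝ^(N-n)` whose differential has kernel `T y`, of dimension `n`, and thus is onto. -/
def IsC1Submanifold {n N : ℕ} (M : Set (Eucl N)) (T : Eucl N → Gras n N) : Prop :=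
  ∀ x ∈ M, ∃ (O : Set (Eucl N)) (f : Eucl N → Eucl (N - n)),
    IsOpen O ∧ x ∈ O ∧ ContDiffOn ℝ 1 f O ∧ M ∩ O = {y ∈ O | f y = 0} ∧
    ∀ y ∈ M ∩ O, (T y).1 = (fderiv ℝ f y).ker

/-- `X ∈ C¹_c(W, ℝ^N)`. -/
def IsC1c {N : ℕ} (W : Set (Eucl N)) (X : Eucl N → Eucl N) : Prop :=
  ContDiff ℝ 1 X ∧ HasCompactSupport X ∧ tsupport X ⊆ W

/-- `div_L X (x) = tr_L (DX) = ∑ ⟨D_{e_i} X, e_i⟩` for an orthonormal basis `e_i` of `L`, written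
as the trace of `DX ∘ P_L` where `P_L` is the orthogonal projection onto `L`. -/
def divPlane {n N : ℕ} (L : Gras n N) (X : Eucl N → Eucl N) (x : Eucl N) : ℝ :=
  LinearMap.trace ℝ (Eucl N) ((fderiv ℝ X x ∘L L.proj : Eucl N →L[ℝ] Eucl N) : Eucl N →ₗ[ℝ] Eucl N)

namespace Varifold

variable {n N : ℕ} {U : Set (Eucl N)}

/-- The mass measure `μ_V`, the projection of `V` to `ℝ^N`. -/
def mass (V : Varifold n N U) : Measure (Eucl N) := V.toMeasure.map Prod.fst

/-- `V` is integral: `V(φ) = ∑ᵢ ∫_{Aᵢ} φ(x, T_x Mᵢ) dℋⁿ` for countably many (measurable) subsets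
`Aᵢ` of `C¹` submanifolds `Mᵢ` of dimension `n`. -/
def IsIntegral (V : Varifold n N U) : Prop :=
  ∃ (M : ℕ → Set (Eucl N)) (T : ℕ → Eucl N → Gras n N) (A : ℕ → Set (Eucl N)),
    (∀ i, IsC1Submanifold (M i) (T i)) ∧ (∀ i, A i ⊆ M i) ∧ (∀ i, MeasurableSet (A i)) ∧
    V.toMeasure = Measure.sum fun i =>
      ((Measure.euclideanHausdorffMeasure n).restrict (A i)).map fun x => (x, T i x)

/-- The first variation `δV(X) = ∫ div_V X`. -/
def firstVar (V : Varifold n N U) (X : Eucl N → Eucl N) : ℝ :=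
  ∫ p, divPlane p.2 X p.1 ∂V.toMeasure

/-- `‖δV‖(W) = sup {δV(Y) : Y ∈ C¹_c(W), |Y| ≤ 1}`, for `W` open. -/
def totalVar (V : Varifold n N U) (W : Set (Eucl N)) : ℝ≥0∞ :=
  ⨆ (Y : Eucl N → Eucl N) (_ : IsC1c W Y) (_ : ∀ x, ‖Y x‖ ≤ 1), ENNReal.ofReal (V.firstVar Y)

/-- `δV` is locally finite (locally bounded) in `U`: for each open `W ⊂⊂ U` there is a constant
`C` with `|δV(X)| ≤ C |X|_{C⁰}` for all `X ∈ C¹_c(W)`. -/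
def LocallyFiniteFirstVar (V : Varifold n N U) : Prop :=
  ∀ W : Set (Eucl N), IsOpen W → IsCompact (closure W) → closure W ⊆ U →
    ∃ C : ℝ, ∀ (X : Eucl N → Eucl N) (b : ℝ), IsC1c W X → (∀ x, ‖X x‖ ≤ b) →
      |V.firstVar X| ≤ C * b

/-- `H`, `σ`, `ν` are the generalized mean curvature vector, boundary measure and outward conormal
of `V`: `δV(X) = -∫ H · X dμ_V + ∫ X · ν dσ` with `H ∈ L¹_loc(μ_V)`, `σ` a Radon measure on `U`
singular to `μ_V`, and `|ν| = 1` `σ`-a.e. This is the Lebesgue decomposition of `δV` with respect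
to `μ_V` (so `σ` is the singular part of `‖δV‖`); it exists if and only if `δV` is locally finite,
and then `σ` is unique, and `H`, `ν` are unique up to null sets. -/
structure IsDecomposition (V : Varifold n N U) (H : Eucl N → Eucl N) (σ : Measure (Eucl N))
    (ν : Eucl N → Eucl N) : Prop where
  locallyIntegrable : LocallyIntegrableOn H U V.mass
  carried : σ Uᶜ = 0
  locallyFinite : ∀ K : Set (Eucl N), IsCompact K → K ⊆ U → σ K < ∞
  singular : σ.MutuallySingular V.mass
  measurable : Measurable ν
  unit : ∀ᵐ x ∂σ, ‖ν x‖ = 1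
  eq : ∀ X : Eucl N → Eucl N, IsC1c U X →
    V.firstVar X = -(∫ x, ⟪H x, X x⟫ ∂V.mass) + ∫ x, ⟪X x, ν x⟫ ∂σ

/-- The triple `(H_V, σ_V, ν_V)`. Meaningful when `δV` is locally finite. -/
def decomposition (V : Varifold n N U) :
    (Eucl N → Eucl N) × Measure (Eucl N) × (Eucl N → Eucl N) :=
  Classical.epsilon fun t => V.IsDecomposition t.1 t.2.1 t.2.2

/-- The generalized boundary measure `σ_V`. -/
def bdryMeasure (V : Varifold n N U) : Measure (Eucl N) := V.decomposition.2.1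

/-- The generalized outward conormal `ν_V`. -/
def conormal (V : Varifold n N U) : Eucl N → Eucl N := V.decomposition.2.2

end Varifold

/-! ### The barrier hypersurface -/

/-- `S` is a closed (as a set), smooth, embedded hypersurface of `ℝ^N`, oriented by the unit normal
`νS`: locally `S = {f = 0}` with `f` smooth, `∇f ≠ 0`, and `νS = ∇f / |∇f|` on `S`. The values of
`νS` off `S` are irrelevant. -/
def IsOrientedHypersurface {N : ℕ} (S : Set (Eucl N)) (νS : Eucl N → Eucl N) : Prop :=
  IsClosed S ∧ ∀ x ∈ S, ∃ (O : Set (Eucl N)) (f : Eucl N → ℝ),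
    IsOpen O ∧ x ∈ O ∧ ContDiffOn ℝ (⊤ : ℕ∞) f O ∧ S ∩ O = {y ∈ O | f y = 0} ∧
    ∀ y ∈ S ∩ O, gradient f y ≠ 0 ∧ νS y = ‖gradient f y‖⁻¹ • gradient f y

/-- `S^⊥(X) = 1_S (X · ν_S) ν_S`. -/
def normalPart {N : ℕ} (S : Set (Eucl N)) (νS X : Eucl N → Eucl N) : Eucl N → Eucl N :=
  S.indicator fun x => ⟪X x, νS x⟫ • νS x

/-- `S^T(X) = X - S^⊥(X)`. -/
def tangentialPart {N : ℕ} (S : Set (Eucl N)) (νS X : Eucl N → Eucl N) : Eucl N → Eucl N :=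
  fun x => X x - normalPart S νS X x

/-- The open cylinder `{x + z + s ω : z ⊥ ω, |z| < r, |s| < r}`, for a unit vector `ω`. -/
def graphCylinder {N : ℕ} (x ω : Eucl N) (r : ℝ) : Set (Eucl N) :=
  {y | ‖(y - x) - ⟪ω, y - x⟫ • ω‖ < r ∧ |⟪ω, y - x⟫| < r}

/-- In the cylinder of radius `r` about `x` with axis `ω`, the set `S` coincides with the graph of
a function `u`, defined on an open subset `D` of the ball of radius `r` in the hyperplane `ω^⊥`,
with `∑_{i ≤ k} r^(i-1) |D^i u|_{0, D} ≤ 1`. -/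
def IsGraphAtScale {N : ℕ} (k : ℕ) (S : Set (Eucl N)) (x ω : Eucl N) (r : ℝ) : Prop :=
  ∃ (D : Set (ℝ ∙ ω)ᗮ) (u : (ℝ ∙ ω)ᗮ → ℝ),
    IsOpen D ∧ D ⊆ ball 0 r ∧ ContDiffOn ℝ k u D ∧
    S ∩ graphCylinder x ω r = (fun z : (ℝ ∙ ω)ᗮ => x + (z : Eucl N) + u z • ω) '' D ∧
    ∑ i ∈ Finset.range (k + 1),
      ⨆ z ∈ D, ENNReal.ofReal (r ^ ((i : ℤ) - 1) * ‖iteratedFDeriv ℝ i u z‖) ≤ 1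

/-- The `C^k` regularity scale `r_k(S, x)` of the hypersurface `S` at `x ∈ S`. -/
def regScaleAt {N : ℕ} (k : ℕ) (S : Set (Eucl N)) (x : Eucl N) : ℝ≥0∞ :=
  ⨆ (r : ℝ) (_ : 0 < r) (_ : ∃ ω : Eucl N, ‖ω‖ = 1 ∧ IsGraphAtScale k S x ω r), ENNReal.ofReal r

/-- The global `C^k` regularity scale `r_k(S)`. -/
def regScale {N : ℕ} (k : ℕ) (S : Set (Eucl N)) : ℝ≥0∞ := ⨅ x ∈ S, regScaleAt k S x

/-- The inverse projection map `Φ` at `x ∈ S`, for a function `u` on `T_x S = (ν_S x)^⊥`: with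
`ℝ^N` identified with `T_x S × ℝ`,
`Φ(x + z + s ν_S(x)) = y + s ν_S(y)` where `y = x + z + u(z) ν_S(x)`. -/
def invProj {N : ℕ} (νS : Eucl N → Eucl N) (x : Eucl N) (u : (ℝ ∙ νS x)ᗮ → ℝ) (p : Eucl N) :
    Eucl N :=
  let z : (ℝ ∙ νS x)ᗮ := (ℝ ∙ νS x)ᗮ.orthogonalProjectionOnto (p - x)
  let y : Eucl N := x + (z : Eucl N) + u z • νS x
  y + ⟪νS x, p - x⟫ • νS y

/-- `|F - Id|(z) ≤ c₀ |z - x|² / r`, `|DF - Id|(z) ≤ c₀ |z - x| / r`, `|D²F|(z) ≤ c₀ / r` for all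
`z ∈ B`. -/
def NearId {N : ℕ} (c₀ r : ℝ) (x : Eucl N) (F : Eucl N → Eucl N) (B : Set (Eucl N)) : Prop :=
  ∀ z ∈ B, ‖F z - z‖ ≤ c₀ * ‖z - x‖ ^ 2 / r ∧
    ‖fderiv ℝ F z - ContinuousLinearMap.id ℝ (Eucl N)‖ ≤ c₀ * ‖z - x‖ / r ∧
    ‖iteratedFDeriv ℝ 2 F z‖ ≤ c₀ / r

/-- The radius `r ≤ r_3(S, x)` satisfies the two conditions in the definition of the reflection
regularity scale at `x ∈ S`. Here `u`, defined on the ball of radius `ρ ∈ [r, r_3(S, x)]` in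
`T_x S`, is the function whose graph is `S` near `x`, and `Ψ` is the inverse of `Φ` centred at `x`. -/
def IsReflectionRadius {N : ℕ} (c₀ : ℝ) (S : Set (Eucl N)) (νS : Eucl N → Eucl N) (x : Eucl N)
    (r : ℝ) : Prop :=
  0 < r ∧ ∃ (ρ : ℝ) (u : (ℝ ∙ νS x)ᗮ → ℝ) (Ψ : Eucl N → Eucl N),
    r ≤ ρ ∧ ENNReal.ofReal ρ ≤ regScaleAt 3 S x ∧
    ContDiffOn ℝ (⊤ : ℕ∞) u (ball 0 ρ) ∧ u 0 = 0 ∧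
    (∀ z ∈ ball (0 : (ℝ ∙ νS x)ᗮ) ρ, x + (z : Eucl N) + u z • νS x ∈ S) ∧
    ContDiffOn ℝ 2 Ψ (ball x r) ∧
    (∀ p ∈ ball x r, ‖(ℝ ∙ νS x)ᗮ.orthogonalProjectionOnto (Ψ p - x)‖ < ρ ∧
      invProj νS x u (Ψ p) = p) ∧
    NearId c₀ r x Ψ (ball x r) ∧
    NearId c₀ r x (invProj νS x u)
      {p | ‖(ℝ ∙ νS x)ᗮ.orthogonalProjectionOnto (p - x)‖ < r ∧ |⟪νS x, p - x⟫| ≤ r}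

/-- The global reflection regularity scale `r_S = inf_{x ∈ S} r_S(x)`; `c₀` is the dimensional
constant that enters its definition. -/
def reflScale {N : ℕ} (c₀ : ℝ) (S : Set (Eucl N)) (νS : Eucl N → Eucl N) : ℝ≥0∞ :=
  ⨅ x ∈ S, ⨆ (r : ℝ) (_ : IsReflectionRadius c₀ S νS x r), ENNReal.ofReal r

/-! ### Free boundary -/

namespace Varifold

variable {n N : ℕ} {U : Set (Eucl N)}

/-- The field `S^T(H)` is in `L¹_loc(U; μ_V)` and `δV(X) = -∫ S^T(H) · X dμ_V` for all
`X ∈ C¹_c(U)` tangent to `S`. -/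
def IsFreeBdryCurvature (V : Varifold n N U) (S : Set (Eucl N)) (νS H : Eucl N → Eucl N) : Prop :=
  LocallyIntegrableOn (tangentialPart S νS H) U V.mass ∧
  ∀ X : Eucl N → Eucl N, IsC1c U X → (∀ x ∈ S, ⟪X x, νS x⟫ = 0) →
    V.firstVar X = -∫ x, ⟪tangentialPart S νS H x, X x⟫ ∂V.mass

/-- `V` has free boundary in `S`. -/
def HasFreeBdry (V : Varifold n N U) (S : Set (Eucl N)) (νS : Eucl N → Eucl N) : Prop :=
  ∃ H : Eucl N → Eucl N, V.IsFreeBdryCurvature S νS H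

end Varifold

/-- The distance between two sets (infinite if one of them is empty). -/
def setDist {N : ℕ} (A B : Set (Eucl N)) : ℝ≥0∞ := ⨅ x ∈ A, infEDist x B

end

/-! The free boundary identity only controls fields tangent to `S`, so everything rests on
estimating `δV` on a field `Y` with a normal component along `S`.

Geometry. If `r < r_2(S)`, then `S` is near each of its points a full graph with second derivatives
at most of order `1 / r`, which gives the two-sided reach inequality `|(y - x) · ν_S(x)| ≤ |y - x|²
/ r` on `S`. This one inequality bounds the second fundamental form by `2 / r` and makes normal
segments of length `r / 4` disjoint. Hence `S` has a tube of width `r / 4` with signed distance `d`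
and unit field `ν = ∇d`, `|Dν| ≤ 4 / r` (`exists_isTube`).

Estimate (`abs_firstVar_le_of_cutoff`). Subtracting from `Y` its normal part `X`, cut off to the
tube, leaves a tangential field, so only `X` matters. Multiply `X` by `1 - softZero ε d`: the result
vanishes on `S` and is again admissible. What remains is `softZero ε d • X`, which concentrates on
`S` as `ε → 0`. The derivative of the profile produces in its divergence a term of size
`|softZero'(d)| |Pν|²`, where `P` projects to the tangent plane of `V`. This term is dominated by
twice the derivative of `softSign ε`, and `softSign ε d • φν` vanishes on `S`, so its first
variation is controlled by the free boundary identity. The other term tends to an integral of `|div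
X|` over `S`. There `Pν = 0` almost everywhere, because transversal intersections of an
`n`-dimensional submanifold with `S` are null for `ℋⁿ` (`ae_proj_normal_eq_zero`); so the unknown
derivative of `Y` drops out and only the curvature of `S` survives. The bound in terms of `r_S`
follows from `r_S ≤ r_2(S)`.

Representation. A functional on `C¹_c` that is bounded on compact sets is a difference of two Radon
measures. Applied to the components of `δV` and combined with the Lebesgue decomposition relative to
`μ_V`, this gives `H_V`, `σ_V`, `ν_V` (`exists_isDecomposition`).

Characterization. For fields tangent to `S`, the decomposition and the free boundary identity differ
by an integral against `μ_V`. As `σ_V` is singular to `μ_V`, the conormal is orthogonal to all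
tangential fields: all fields off `S`, all tangent vectors on `S`. Conversely, with a normal
conormal carried by `S` the boundary term vanishes on tangential fields. In the one-sided case `d ≤
0` on the support, so testing with `softZero ε d • φν` gives a profile derivative of favourable
sign; after `ε → 0` the same singularity argument yields `ν_V · ν_S ≥ 0` and excludes the minus
sign. -/

noncomputable section

/-! ### Hypersurfaces as graphs -/

section Graph

variable {N : ℕ} {S : Set (Eucl N)} {x ω : Eucl N} {r : ℝ}

lemma inner_coe_orthogonal_span (ω : Eucl N) (z : (ℝ ∙ ω)ᗮ) : ⟪ω, (z : Eucl N)⟫ = 0 :=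
  (Submodule.mem_orthogonal_singleton_iff_inner_right.1 z.2)

lemma inner_graph_sub (hω : ‖ω‖ = 1) (z : (ℝ ∙ ω)ᗮ) (s : ℝ) :
    ⟪ω, x + (z : Eucl N) + s • ω - x⟫ = s := by
  rw [show x + (z : Eucl N) + s • ω - x = z + s • ω by abel, inner_add_right,
    inner_coe_orthogonal_span, inner_smul_right, real_inner_self_eq_norm_sq, hω]
  simp

lemma mem_graphCylinder_iff (hω : ‖ω‖ = 1) (z : (ℝ ∙ ω)ᗮ) (s : ℝ) :
    x + (z : Eucl N) + s • ω ∈ graphCylinder x ω r ↔ ‖z‖ < r ∧ |s| < r := by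
  simp only [graphCylinder, mem_ofPred_eq, inner_graph_sub hω]
  rw [show x + (z : Eucl N) + s • ω - x - s • ω = z by abel]
  rfl

lemma graph_injective (hω : ‖ω‖ = 1) {z z' : (ℝ ∙ ω)ᗮ} {s s' : ℝ}
    (h : x + (z : Eucl N) + s • ω = x + (z' : Eucl N) + s' • ω) : z = z' ∧ s = s' := by
  have hs : s = s' := by
    rw [← inner_graph_sub (x := x) hω z s, h, inner_graph_sub hω]
  subst hs
  exact ⟨Subtype.ext (by simpa using h), rfl⟩

lemma abs_sub_fderiv_le_of_ball {F : Type*} [NormedAddCommGroup F] [NormedSpace ℝ F] {u : F → ℝ}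
    {C : ℝ} (hC : 0 ≤ C) (hu : ContDiffOn ℝ 2 u (ball 0 r))
    (h2 : ∀ z ∈ ball (0 : F) r, ‖iteratedFDeriv ℝ 2 u z‖ ≤ C) {z : F} (hz : z ∈ ball 0 r) :
    |u z - u 0 - fderiv ℝ u 0 z| ≤ C * ‖z‖ ^ 2 := by
  have hu1 : ∀ w ∈ ball (0 : F) r, ContDiffAt ℝ 2 u w := fun w hw =>
    hu.contDiffAt (isOpen_ball.mem_nhds hw)
  have h0 : (0 : F) ∈ ball (0 : F) r := by
    simpa using (norm_nonneg z).trans_lt (by simpa using hz)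
  have hD : ∀ w ∈ ball (0 : F) r, ‖fderiv ℝ u w - fderiv ℝ u 0‖ ≤ C * ‖w‖ := by
    intro w hw
    have := (convex_ball (0 : F) r).norm_image_sub_le_of_norm_hasFDerivWithin_le
      (f := fderiv ℝ u) (f' := fderiv ℝ (fderiv ℝ u)) (C := C)
      (fun w hw => (((hu1 w hw).fderiv_right (m := 1) (by norm_num)).differentiableAt
        (by norm_num)).hasFDerivAt.hasFDerivWithinAt)
      (fun w hw => by
        rw [← norm_iteratedFDeriv_one, norm_iteratedFDeriv_fderiv]; exact h2 w hw) h0 hw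
    simpa using this
  have hsub : ball (0 : F) r ∩ closedBall 0 ‖z‖ ⊆ ball 0 r := inter_subset_left
  have := ((convex_ball (0 : F) r).inter
    (convex_closedBall 0 ‖z‖)).norm_image_sub_le_of_norm_hasFDerivWithin_le'
      (f := u) (f' := fderiv ℝ u) (φ := fderiv ℝ u 0) (C := C * ‖z‖)
      (fun w hw => ((hu1 w hw.1).differentiableAt (by norm_num)).hasFDerivAt.hasFDerivWithinAt)
      (fun w hw => (hD w hw.1).trans
        (mul_le_mul_of_nonneg_left (by simpa using hw.2) hC))
      (x := 0) ⟨h0, by simp⟩ (y := z) ⟨hz, by simp⟩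
  rw [sub_zero, Real.norm_eq_abs] at this
  linarith [this]

/-- The domain `D` in the definition may a priori be a small open set. Since `S` is closed and `|Du|
≤ 1`, the graph cannot stop inside the cylinder nor leave it through its top or bottom, so `D` is
the whole ball. Convexity of the ball then permits a second-order Taylor estimate. -/
lemma IsGraphAtScale.exists_full (hS : IsClosed S) (hx : x ∈ S) (hω : ‖ω‖ = 1) (hr : 0 < r)
    (h : IsGraphAtScale 2 S x ω r) :
    ∃ u : (ℝ ∙ ω)ᗮ → ℝ, u 0 = 0 ∧ ContDiffOn ℝ 2 u (ball 0 r) ∧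
      (∀ z ∈ ball (0 : (ℝ ∙ ω)ᗮ) r, x + (z : Eucl N) + u z • ω ∈ S) ∧
      (∀ y ∈ S, dist y x < r → ∃ z ∈ ball (0 : (ℝ ∙ ω)ᗮ) r, y = x + (z : Eucl N) + u z • ω) ∧
      ∀ z ∈ ball (0 : (ℝ ∙ ω)ᗮ) r, |u z - fderiv ℝ u 0 z| ≤ ‖z‖ ^ 2 / r := by
  obtain ⟨D, u, hDo, hDr, hu, hSD, hsum⟩ := h
  have term : ∀ i ∈ Finset.range 3, ∀ z ∈ D, r ^ ((i : ℤ) - 1) * ‖iteratedFDeriv ℝ i u z‖ ≤ 1 := by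
    intro i hi z hz
    have h1 := (Finset.single_le_sum (f := fun i : ℕ =>
      ⨆ z ∈ D, ENNReal.ofReal (r ^ ((i : ℤ) - 1) * ‖iteratedFDeriv ℝ i u z‖))
      (fun _ _ => zero_le) hi).trans hsum
    have h2 := (le_iSup₂ (f := fun z (_ : z ∈ D) =>
      ENNReal.ofReal (r ^ ((i : ℤ) - 1) * ‖iteratedFDeriv ℝ i u z‖)) z hz).trans h1
    exact ENNReal.ofReal_le_one.1 h2
  have hD1 : ∀ z ∈ D, ‖fderiv ℝ u z‖ ≤ 1 := fun z hz => by
    have := term 1 (by simp) z hz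
    rw [norm_iteratedFDeriv_one] at this
    simpa using this
  have hD2 : ∀ z ∈ D, ‖iteratedFDeriv ℝ 2 u z‖ ≤ 1 / r := fun z hz => by
    have := term 2 (by simp) z hz
    rw [le_div_iff₀ hr, mul_comm]
    simpa using this
  have mem_iff : ∀ (z : (ℝ ∙ ω)ᗮ) (s : ℝ), ‖z‖ < r → |s| < r →
      (x + (z : Eucl N) + s • ω ∈ S ↔ z ∈ D ∧ u z = s) := by
    intro z s hz hs
    constructor
    · intro h
      have h1 : x + (z : Eucl N) + s • ω ∈ S ∩ graphCylinder x ω r :=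
        ⟨h, (mem_graphCylinder_iff hω z s).2 ⟨hz, hs⟩⟩
      rw [hSD] at h1
      obtain ⟨z', hz', he⟩ := h1
      obtain ⟨rfl, rfl⟩ := graph_injective hω he
      exact ⟨hz', rfl⟩
    · rintro ⟨hzD, rfl⟩
      have : x + (z : Eucl N) + u z • ω ∈ S ∩ graphCylinder x ω r := by
        rw [hSD]; exact ⟨z, hzD, rfl⟩
      exact this.1
  have h0 : (0 : (ℝ ∙ ω)ᗮ) ∈ D ∧ u 0 = 0 :=
    (mem_iff 0 0 (by simpa using hr) (by simpa using hr)).1 (by simpa using hx)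
  -- along each ray the graph reaches the boundary of the ball
  have ray : ∀ z ∈ ball (0 : (ℝ ∙ ω)ᗮ) r, z ∈ D := by
    intro z hz
    have hzr : ‖z‖ < r := by simpa using hz
    -- Continuity method on the ray. The cone condition `|q| ≤ t ‖z‖` keeps the point strictly
    -- inside the cylinder, where points of `S` are graph points; it propagates because the slope is
    -- at most `1`.
    let s : Set ℝ := {t | ∃ q : ℝ, |q| ≤ t * ‖z‖ ∧ x + ((t • z : (ℝ ∙ ω)ᗮ) : Eucl N) + q • ω ∈ S}
    have hsmall : ∀ t ∈ Icc (0 : ℝ) 1, ‖t • z‖ < r ∧ t * ‖z‖ < r := by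
      intro t ht
      have : t * ‖z‖ < r := lt_of_le_of_lt (mul_le_of_le_one_left (norm_nonneg _) ht.2) hzr
      exact ⟨by rwa [norm_smul, Real.norm_of_nonneg ht.1], this⟩
    have key : ∀ t ∈ s, t ∈ Icc (0 : ℝ) 1 → t • z ∈ D ∧ |u (t • z)| ≤ t * ‖z‖ := by
      rintro t ⟨q, hq, hqS⟩ ht
      obtain ⟨h1, h2⟩ := (mem_iff _ q (hsmall t ht).1 (hq.trans_lt (hsmall t ht).2)).1 hqS
      exact ⟨h1, h2 ▸ hq⟩
    -- The heights stay in a compact interval, so the set is the projection of a compact set.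
    have hclosed : IsClosed (s ∩ Icc 0 1) := by
      have hK : IsCompact ({p : ℝ × ℝ | |p.2| ≤ p.1 * ‖z‖ ∧
          x + ((p.1 • z : (ℝ ∙ ω)ᗮ) : Eucl N) + p.2 • ω ∈ S} ∩ (Icc 0 1 ×ˢ Icc (-r) r)) := by
        refine (isCompact_Icc.prod isCompact_Icc).inter_left ?_
        exact (isClosed_le (f := fun p : ℝ × ℝ => |p.2|) (g := fun p : ℝ × ℝ => p.1 * ‖z‖)
          (by fun_prop) (by fun_prop)).inter (hS.preimage
          (f := fun p : ℝ × ℝ => x + ((p.1 • z : (ℝ ∙ ω)ᗮ) : Eucl N) + p.2 • ω) (by fun_prop))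
      have : s ∩ Icc 0 1 = Prod.fst '' ({p : ℝ × ℝ | |p.2| ≤ p.1 * ‖z‖ ∧
          x + ((p.1 • z : (ℝ ∙ ω)ᗮ) : Eucl N) + p.2 • ω ∈ S} ∩ (Icc 0 1 ×ˢ Icc (-r) r)) := by
        ext t
        constructor
        · rintro ⟨⟨q, hq, hqS⟩, ht⟩
          exact ⟨(t, q), ⟨⟨hq, hqS⟩, ht, abs_le.1 (hq.trans (hsmall t ht).2.le)⟩, rfl⟩
        · rintro ⟨⟨t, q⟩, ⟨⟨hq, hqS⟩, ht, -⟩, rfl⟩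
          exact ⟨⟨q, hq, hqS⟩, ht⟩
      rw [this]
      exact (hK.image continuous_fst).isClosed
    have hall : Icc (0 : ℝ) 1 ⊆ s := by
      refine hclosed.Icc_subset_of_forall_exists_gt ⟨0, by simp, by simpa using hx⟩ ?_
      rintro t ⟨hts, ht⟩ y hy
      obtain ⟨htD, htu⟩ := key t hts ⟨ht.1, ht.2.le⟩
      obtain ⟨ε, hε, hball⟩ := Metric.isOpen_iff.1 hDo _ htD
      have hev : ∀ᶠ t' in 𝓝 t, t' • z ∈ ball (t • z) ε :=
        (continuous_id.smul continuous_const).continuousAt.preimage_mem_nhds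
          (ball_mem_nhds _ hε)
      obtain ⟨t', ⟨ht'b, ht'⟩⟩ :=
        ((hev.filter_mono nhdsWithin_le_nhds).and (Ioc_mem_nhdsGT hy)).exists
      refine ⟨t', ⟨u (t' • z), ?_, ?_⟩, ht'⟩
      · have hmv := (convex_ball (t • z) ε).norm_image_sub_le_of_norm_hasFDerivWithin_le
          (f := u) (f' := fderiv ℝ u) (C := 1)
          (fun w hw => ((hu.contDiffAt (hDo.mem_nhds (hball hw))).differentiableAt
            (by norm_num)).hasFDerivAt.hasFDerivWithinAt)
          (fun w hw => hD1 w (hball hw)) (mem_ball_self hε) ht'b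
        rw [← sub_smul, norm_smul, Real.norm_of_nonneg (sub_nonneg.2 ht'.1.le), one_mul,
          Real.norm_eq_abs] at hmv
        have := abs_sub_abs_le_abs_sub (u (t' • z)) (u (t • z))
        nlinarith
      · have : x + ((t' • z : (ℝ ∙ ω)ᗮ) : Eucl N) + u (t' • z) • ω ∈ S ∩ graphCylinder x ω r := by
          rw [hSD]; exact ⟨_, hball ht'b, rfl⟩
        exact this.1
    have := (key 1 (hall (by simp)) (by simp)).1
    rwa [one_smul] at this
  have hDball : D = ball 0 r := Subset.antisymm hDr ray
  subst hDball
  refine ⟨u, h0.2, hu, ?_, ?_, fun z hz => ?_⟩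
  · intro z hz
    have : x + (z : Eucl N) + u z • ω ∈ S ∩ graphCylinder x ω r := by
      rw [hSD]; exact ⟨z, hz, rfl⟩
    exact this.1
  · intro y hy hyx
    have hcyl : y ∈ graphCylinder x ω r := by
      rw [dist_eq_norm] at hyx
      have hsq : ‖(y - x) - ⟪ω, y - x⟫ • ω‖ ^ 2 = ‖y - x‖ ^ 2 - ⟪ω, y - x⟫ ^ 2 := by
        rw [norm_sub_sq_real, inner_smul_right, norm_smul, hω, real_inner_comm, Real.norm_eq_abs,
          mul_one, sq_abs]
        ring
      constructor
      · refine lt_of_le_of_lt (abs_le_of_sq_le_sq' ?_ (norm_nonneg _) |>.2) hyx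
        rw [hsq]; nlinarith [sq_nonneg ⟪ω, y - x⟫]
      · refine lt_of_le_of_lt ((abs_real_inner_le_norm _ _).trans ?_) hyx
        rw [hω, one_mul]
    have : y ∈ S ∩ graphCylinder x ω r := ⟨hy, hcyl⟩
    rw [hSD] at this
    obtain ⟨z, hz, rfl⟩ := this
    exact ⟨z, hz, rfl⟩
  · have := abs_sub_fderiv_le_of_ball (by positivity) hu hD2 hz
    rw [h0.2, sub_zero] at this
    convert this using 1
    ring

end Graph

/-! ### The second fundamental form of the hypersurface -/

section Curvature

variable {N : ℕ} {S O : Set (Eucl N)} {νS n : Eucl N → Eucl N} {f : Eucl N → ℝ}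
  {x y : Eucl N} {r : ℝ}

/-- `f` is a defining function of `S` in the open set `O`, and `n` the normalized gradient of `f`,
which extends `νS` to `O`. -/
structure IsLocalNormal (S : Set (Eucl N)) (νS : Eucl N → Eucl N) (O : Set (Eucl N))
    (f : Eucl N → ℝ) (n : Eucl N → Eucl N) : Prop where
  isOpen : IsOpen O
  contDiffOn : ContDiffOn ℝ 2 f O
  contDiffOn_normal : ContDiffOn ℝ 1 n O
  mem_iff : ∀ y ∈ O, (y ∈ S ↔ f y = 0)
  norm_normal : ∀ y ∈ O, ‖n y‖ = 1
  fderiv_eq : ∀ y ∈ O, ∃ c : ℝ, 0 < c ∧ ∀ v, fderiv ℝ f y v = c * ⟪n y, v⟫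
  eq_normal : ∀ y ∈ O, y ∈ S → νS y = n y
  symm : ∀ y ∈ O, ∀ v w, ⟪n y, v⟫ = 0 → ⟪n y, w⟫ = 0 →
    ⟪fderiv ℝ n y v, w⟫ = ⟪fderiv ℝ n y w, v⟫

lemma IsOrientedHypersurface.exists_isLocalNormal (hS : IsOrientedHypersurface S νS)
    (hx : x ∈ S) : ∃ O f n, x ∈ O ∧ IsLocalNormal S νS O f n := by
  obtain ⟨O, f, hO, hxO, hf, hSO, hν⟩ := hS.2 x hx
  have hgrad : gradient f = fun y => (InnerProductSpace.toDual ℝ (Eucl N)).symm (fderiv ℝ f y) :=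
    rfl
  have hf' : ∀ y ∈ O, ContDiffAt ℝ (⊤ : ℕ∞) f y := fun y hy => hf.contDiffAt (hO.mem_nhds hy)
  have hfd : ∀ y ∈ O, ContDiffAt ℝ 1 (fderiv ℝ f) y := fun y hy =>
    (hf' y hy).fderiv_right (m := 1) (by norm_cast)
  have hg : ∀ y ∈ O, ContDiffAt ℝ 1 (gradient f) y := fun y hy => by
    rw [hgrad]
    exact (LinearIsometryEquiv.contDiff _).contDiffAt.comp y (hfd y hy)
  have hcont : ContinuousOn (gradient f) O := fun y hy =>
    (hg y hy).continuousAt.continuousWithinAt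
  have hO'open : IsOpen (O ∩ gradient f ⁻¹' {0}ᶜ) :=
    hcont.isOpen_inter_preimage hO isOpen_compl_singleton
  have hxS : x ∈ S ∩ O := ⟨hx, hxO⟩
  have hnorm : ∀ y ∈ O ∩ gradient f ⁻¹' {0}ᶜ, ContDiffAt ℝ 1 (fun y => ‖gradient f y‖) y :=
    fun y hy => (hg y hy.1).norm ℝ hy.2
  have hn : ∀ y ∈ O ∩ gradient f ⁻¹' {0}ᶜ,
      ContDiffAt ℝ 1 (fun y => ‖gradient f y‖⁻¹ • gradient f y) y := fun y hy =>
    ((hnorm y hy).inv (norm_ne_zero_iff.2 hy.2)).smul (hg y hy.1)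
  have hinner : ∀ y v, fderiv ℝ f y v = ⟪gradient f y, v⟫ := fun y v => by
    rw [hgrad]; simp
  refine ⟨O ∩ gradient f ⁻¹' {0}ᶜ, f, fun y => ‖gradient f y‖⁻¹ • gradient f y,
    ⟨hxO, (hν x hxS).1⟩, hO'open, ?_, fun y hy => (hn y hy).contDiffWithinAt, ?_, ?_, ?_, ?_, ?_⟩
  · exact fun y hy => ((hf' y hy.1).of_le (by norm_cast)).contDiffWithinAt
  · intro y hy
    have : y ∈ S ∩ O ↔ y ∈ {y ∈ O | f y = 0} := by rw [hSO]
    simpa [hy.1] using this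
  · intro y hy
    have : ‖gradient f y‖ ≠ 0 := norm_ne_zero_iff.2 hy.2
    rw [norm_smul, norm_inv, norm_norm, inv_mul_cancel₀ this]
  · intro y hy
    have : ‖gradient f y‖ ≠ 0 := norm_ne_zero_iff.2 hy.2
    refine ⟨‖gradient f y‖, (norm_nonneg _).lt_of_ne' this, fun v => ?_⟩
    rw [hinner, real_inner_smul_left, mul_inv_cancel_left₀ this]
  · exact fun y hy hyS => (hν y ⟨hyS, hy.1⟩).2
  · intro y hy v w hv hw
    have hne : ‖gradient f y‖ ≠ 0 := norm_ne_zero_iff.2 hy.2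
    -- On tangent vectors `w` the derivative of the normalizing factor drops out, and the derivative
    -- of the normal becomes a multiple of the symmetric Hessian of `f`.
    have key : ∀ v w : Eucl N, ⟪‖gradient f y‖⁻¹ • gradient f y, w⟫ = 0 →
        ⟪fderiv ℝ (fun y => ‖gradient f y‖⁻¹ • gradient f y) y v, w⟫ =
          ‖gradient f y‖⁻¹ * fderiv ℝ (fderiv ℝ f) y v w := by
      intro v w hw
      have hd := (((hnorm y hy).inv hne).differentiableAt (by norm_num)).hasFDerivAt.smul
        ((hg y hy.1).differentiableAt (by norm_num)).hasFDerivAt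
      have hd' := hd.fderiv
      have hw' : ⟪gradient f y, w⟫ = 0 := by
        rw [real_inner_smul_left] at hw
        exact (mul_eq_zero.1 hw).resolve_left (inv_ne_zero hne)
      have h2 : fderiv ℝ (gradient f) y v =
          (InnerProductSpace.toDual ℝ (Eucl N)).symm (fderiv ℝ (fderiv ℝ f) y v) := by
        rw [hgrad]
        have := ((InnerProductSpace.toDual ℝ (Eucl N)).symm.toContinuousLinearEquiv :
          StrongDual ℝ (Eucl N) ≃L[ℝ] Eucl N).toContinuousLinearMap.hasFDerivAt.comp y
          ((hfd y hy.1).differentiableAt (by norm_num)).hasFDerivAt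
        exact congrArg (fun A => A v) this.fderiv
      have h3 : fderiv ℝ (fun y => ‖gradient f y‖⁻¹ • gradient f y) y = _ := hd'
      rw [h3]
      simp only [add_apply, smul_apply, ContinuousLinearMap.smulRight_apply, inner_add_left, real_inner_smul_left, hw', mul_zero,
        add_zero, h2, InnerProductSpace.toDual_symm_apply, Pi.inv_apply]
    rw [key v w hw, key w v hv]
    have hsym : IsSymmSndFDerivAt ℝ f y :=
      ((hf' y hy.1).of_le (m := 2) (by norm_cast)).isSymmSndFDerivAt (by simp)
    rw [hsym.eq v w]

/-- The deviation of the graph from its tangent plane is quadratic with constant `1 / r`. The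
inequality is global on `S`, which is what later excludes that distant sheets come close. The curves
are lifts of straight lines to the graph. -/
lemma exists_reach_of_lt_regScaleAt (hS : IsOrientedHypersurface S νS) (hx : x ∈ S) (hr : 0 < r)
    (h : ENNReal.ofReal r < regScaleAt 2 S x) :
    (∀ y ∈ S, |⟪y - x, νS x⟫| ≤ ‖y - x‖ ^ 2 / r) ∧
      ∀ v, ⟪νS x, v⟫ = 0 → ∃ γ : ℝ → Eucl N, γ 0 = x ∧ HasDerivAt γ v 0 ∧ ∀ᶠ s in 𝓝 0, γ s ∈ S := by
  simp only [regScaleAt, lt_iSup_iff] at h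
  obtain ⟨r', hr', ⟨ω, hω, hgraph⟩, hlt⟩ := h
  have hrr' : r < r' := (ENNReal.ofReal_lt_ofReal_iff hr').1 hlt
  obtain ⟨u, hu0, hu, huS, hSu, huT⟩ := hgraph.exists_full hS.1 hx hω hr'
  obtain ⟨O, f, n, hxO, hn⟩ := hS.exists_isLocalNormal hx
  set u' := fderiv ℝ u 0 with hu'
  let G : (ℝ ∙ ω)ᗮ → Eucl N := fun z => x + (z : Eucl N) + u z • ω
  have h0r : (0 : (ℝ ∙ ω)ᗮ) ∈ ball (0 : (ℝ ∙ ω)ᗮ) r' := mem_ball_self hr'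
  have hG0 : G 0 = x := by simp [G, hu0]
  have hud : HasFDerivAt u u' 0 :=
    ((hu.contDiffAt (isOpen_ball.mem_nhds h0r)).differentiableAt (by norm_num)).hasFDerivAt
  have hG : HasFDerivAt G ((ℝ ∙ ω)ᗮ.subtypeL + u'.smulRight ω) 0 := by
    have h1 : HasFDerivAt (fun z : (ℝ ∙ ω)ᗮ => x + (z : Eucl N)) ((ℝ ∙ ω)ᗮ.subtypeL) 0 :=
      (ℝ ∙ ω)ᗮ.subtypeL.hasFDerivAt.const_add x
    exact h1.add (hud.smul_const ω)
  have hGS : ∀ᶠ z in 𝓝 (0 : (ℝ ∙ ω)ᗮ), G z ∈ S := by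
    filter_upwards [isOpen_ball.mem_nhds h0r] with z hz using huS z hz
  have hνx : νS x = n x := hn.eq_normal x hxO hx
  have htan : ∀ z : (ℝ ∙ ω)ᗮ, ⟪νS x, (z : Eucl N) + u' z • ω⟫ = 0 := by
    intro z
    have hfx : HasFDerivAt f (fderiv ℝ f x) (G 0) := by
      rw [hG0]
      exact ((hn.contDiffOn.contDiffAt (hn.isOpen.mem_nhds hxO)).differentiableAt
        (by norm_num)).hasFDerivAt
    have hcomp := hfx.comp 0 hG
    have hzero : f ∘ G =ᶠ[𝓝 0] fun _ => (0 : ℝ) := by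
      have hO : ∀ᶠ z in 𝓝 (0 : (ℝ ∙ ω)ᗮ), G z ∈ O :=
        hG.continuousAt.preimage_mem_nhds (by rw [hG0]; exact hn.isOpen.mem_nhds hxO)
      filter_upwards [hO, hGS] with z hzO hzS using (hn.mem_iff _ hzO).1 hzS
    have h0 := (hcomp.congr_of_eventuallyEq hzero.symm).unique (hasFDerivAt_const (0 : ℝ) 0)
    obtain ⟨c, hc, hfc⟩ := hn.fderiv_eq x hxO
    have := congrArg (fun A => A z) h0
    simp only [ContinuousLinearMap.comp_apply, add_apply, Submodule.subtypeL_apply,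
      ContinuousLinearMap.smulRight_apply, zero_apply, hfc] at this
    rw [hνx]
    exact (mul_eq_zero.1 this).resolve_left hc.ne'
  have hunit : ‖νS x‖ = 1 := by rw [hνx]; exact hn.norm_normal x hxO
  refine ⟨fun y hy => ?_, fun v hv => ?_⟩
  · by_cases hyx : dist y x < r'
    · obtain ⟨z, hz, rfl⟩ := hSu y hy hyx
      have e : x + (z : Eucl N) + u z • ω - x = ((z : Eucl N) + u' z • ω) + (u z - u' z) • ω := by
        module
      have hzn : ‖z‖ ^ 2 ≤ ‖x + (z : Eucl N) + u z • ω - x‖ ^ 2 := by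
        rw [show x + (z : Eucl N) + u z • ω - x = z + u z • ω by abel, norm_add_sq_real,
          inner_smul_right, real_inner_comm, inner_coe_orthogonal_span]
        simp only [mul_zero, add_zero, Submodule.coe_norm]
        nlinarith [sq_nonneg ‖u z • ω‖]
      have hων : |⟪ω, νS x⟫| ≤ 1 := by
        simpa [hω, hunit] using abs_real_inner_le_norm ω (νS x)
      have h1 : |⟪x + (z : Eucl N) + u z • ω - x, νS x⟫| ≤ ‖z‖ ^ 2 / r' := by
        rw [e, inner_add_left, real_inner_comm, htan, zero_add, real_inner_smul_left, abs_mul]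
        exact (mul_le_of_le_one_right (abs_nonneg _) hων).trans (huT z hz)
      refine h1.trans ?_
      gcongr
    -- Distant points need no geometry: `|y - x| ≤ |y - x|² / r` once `|y - x| ≥ r`.
    · rw [not_lt, dist_eq_norm] at hyx
      have h1 := abs_real_inner_le_norm (y - x) (νS x)
      rw [hunit, mul_one] at h1
      refine h1.trans ?_
      rw [le_div_iff₀ hr]
      nlinarith [norm_nonneg (y - x)]
  · let z : (ℝ ∙ ω)ᗮ := (ℝ ∙ ω)ᗮ.orthogonalProjectionOnto v
    have hvz : v = z + ⟪ω, v⟫ • ω := by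
      have h1 := (ℝ ∙ ω).starProjection_add_starProjection_orthogonal v
      rw [Submodule.starProjection_unit_singleton ℝ hω] at h1
      rw [← h1]
      nth_rw 1 [← h1]
      simp [z, add_comm]
    -- The tangent plane is a graph over `ω^⊥`. Were `ν_S(x)` in `ω^⊥`, it could be inserted into
    -- `htan` and would be orthogonal to itself.
    have hων : ⟪νS x, ω⟫ ≠ 0 := by
      intro h0
      have hmem : νS x ∈ (ℝ ∙ ω)ᗮ :=
        Submodule.mem_orthogonal_singleton_iff_inner_left.2 h0
      have := htan ⟨νS x, hmem⟩
      rw [inner_add_right, inner_smul_right, h0, mul_zero, add_zero, real_inner_self_eq_norm_sq,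
        hunit] at this
      norm_num at this
    have hs : ⟪ω, v⟫ = u' z := by
      have h1 := htan z
      have h2 := hv
      rw [hvz, inner_add_right, inner_smul_right] at h2
      rw [inner_add_right, inner_smul_right] at h1
      have h3 : (⟪ω, v⟫ - u' z) * ⟪νS x, ω⟫ = 0 := by linarith
      exact sub_eq_zero.1 ((mul_eq_zero.1 h3).resolve_right hων)
    have hline : HasDerivAt (fun s : ℝ => s • z) z 0 := by
      simpa using (hasDerivAt_id (0 : ℝ)).smul_const z
    refine ⟨fun s => G (s • z), by simp [hG0], ?_, ?_⟩
    · have hG' : HasFDerivAt G ((ℝ ∙ ω)ᗮ.subtypeL + u'.smulRight ω) ((0 : ℝ) • z) := by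
        rw [zero_smul]; exact hG
      have := hG'.comp_hasDerivAt (0 : ℝ) hline
      have e : v = ((ℝ ∙ ω)ᗮ.subtypeL + u'.smulRight ω) z := by
        simp only [add_apply, Submodule.subtypeL_apply, ContinuousLinearMap.smulRight_apply]
        rw [← hs]; exact hvz
      rw [e]
      exact this
    · have : Tendsto (fun s : ℝ => s • z) (𝓝 0) (𝓝 0) := by
        simpa using hline.continuousAt.tendsto
      exact this.eventually hGS

/-- The normal varies at rate at most `2 / r` along the hypersurface. -/
lemma IsLocalNormal.norm_fderiv_le (hn : IsLocalNormal S νS O f n) (hyO : y ∈ O) (hyS : y ∈ S)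
    (hr : 0 < r)
    (hreach : ∀ x ∈ S, ∀ y ∈ S, |⟪y - x, νS x⟫| ≤ ‖y - x‖ ^ 2 / r)
    (hcurve : ∀ v, ⟪νS y, v⟫ = 0 →
      ∃ γ : ℝ → Eucl N, γ 0 = y ∧ HasDerivAt γ v 0 ∧ ∀ᶠ s in 𝓝 0, γ s ∈ S)
    {v : Eucl N} (hv : ⟪n y, v⟫ = 0) :
    ⟪n y, fderiv ℝ n y v⟫ = 0 ∧ ‖fderiv ℝ n y v‖ ≤ 2 / r * ‖v‖ := by
  have hnd : HasFDerivAt n (fderiv ℝ n y) y :=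
    ((hn.contDiffOn_normal.contDiffAt (hn.isOpen.mem_nhds hyO)).differentiableAt
      (by norm_num)).hasFDerivAt
  have horth : ∀ v, ⟪n y, fderiv ℝ n y v⟫ = 0 := by
    intro v
    have h1 := hnd.inner ℝ hnd
    have h2 : (fun z => ⟪n z, n z⟫) =ᶠ[𝓝 y] fun _ => (1 : ℝ) := by
      filter_upwards [hn.isOpen.mem_nhds hyO] with z hz
      rw [real_inner_self_eq_norm_sq, hn.norm_normal z hz, one_pow]
    have h3 := (h1.congr_of_eventuallyEq h2.symm).unique (hasFDerivAt_const (1 : ℝ) y)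
    have := congrArg (fun A => A v) h3
    simp [fderivInnerCLM_apply, real_inner_comm] at this
    linarith [this, real_inner_comm (n y) (fderiv ℝ n y v)]
  -- Adding the reach inequalities based at `y` and at `γ s` bounds `(ν(γ s) - ν(y)) · (γ s - y)` by
  -- `2 |γ s - y|² / r`; dividing by `s²` and letting `s → 0` gives the quadratic form.
  have hquad : ∀ v, ⟪n y, v⟫ = 0 → |⟪fderiv ℝ n y v, v⟫| ≤ 2 / r * ‖v‖ ^ 2 := by
    intro v hv
    obtain ⟨γ, hγ0, hγ, hγS⟩ := hcurve v (by rw [hn.eq_normal y hyO hyS]; exact hv)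
    have hnγ : HasDerivAt (fun s => n (γ s)) (fderiv ℝ n y v) 0 := by
      have : HasFDerivAt n (fderiv ℝ n y) (γ 0) := by rw [hγ0]; exact hnd
      exact this.comp_hasDerivAt (0 : ℝ) hγ
    have t1 := hγ.tendsto_slope
    have t2 := hnγ.tendsto_slope
    have t3 := (Filter.Tendsto.inner (𝕜 := ℝ) t2 t1).abs
    have t4 := (t1.norm.pow 2).const_mul (2 / r)
    refine le_of_tendsto_of_tendsto t3 t4 ?_
    have hO : ∀ᶠ s in 𝓝 (0 : ℝ), γ s ∈ O :=
      hγ.continuousAt.preimage_mem_nhds (by rw [hγ0]; exact hn.isOpen.mem_nhds hyO)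
    filter_upwards [hO.filter_mono nhdsWithin_le_nhds, hγS.filter_mono nhdsWithin_le_nhds,
      self_mem_nhdsWithin] with s hsO hsS hs0
    have hs : s ≠ 0 := hs0
    simp only [slope, vsub_eq_sub, sub_zero, hγ0]
    rw [real_inner_smul_left, real_inner_smul_right, norm_smul, abs_mul, abs_mul, mul_pow,
      Real.norm_eq_abs, ← hn.eq_normal _ hsO hsS, ← hn.eq_normal _ hyO hyS]
    have h1 := hreach y hyS (γ s) hsS
    have h2 := hreach (γ s) hsS y hyS
    have h3 : |⟪νS (γ s) - νS y, γ s - y⟫| ≤ 2 * (‖γ s - y‖ ^ 2 / r) := by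
      rw [inner_sub_left, real_inner_comm _ (νS (γ s)), real_inner_comm _ (νS y)]
      have e : ⟪γ s - y, νS (γ s)⟫ = - ⟪y - γ s, νS (γ s)⟫ := by
        rw [← inner_neg_left, neg_sub]
      rw [norm_sub_rev] at h2
      rw [e]
      rw [abs_le] at h1 h2 ⊢
      constructor <;> linarith
    calc |s⁻¹| * (|s⁻¹| * |⟪νS (γ s) - νS y, γ s - y⟫|)
        ≤ |s⁻¹| * (|s⁻¹| * (2 * (‖γ s - y‖ ^ 2 / r))) := by gcongr
      _ = 2 / r * (|s⁻¹| ^ 2 * ‖γ s - y‖ ^ 2) := by ring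
  refine ⟨horth v, ?_⟩
  -- Polarization of a symmetric form. It is used with `w` parallel to `Dn(v)` and of length `|v|`,
  -- which turns the bound on the form into an operator bound.
  have hpolar : ∀ w, ⟪n y, w⟫ = 0 → ∀ v, ⟪n y, v⟫ = 0 → 
      2 * |⟪fderiv ℝ n y v, w⟫| ≤ 2 / r * (‖v‖ ^ 2 + ‖w‖ ^ 2) := by
    intro w hw v hv
    have h1 := hquad (v + w) (by rw [inner_add_right, hv, hw, add_zero])
    have h2 := hquad (v - w) (by rw [inner_sub_right, hv, hw, sub_zero])
    have hs := hn.symm y hyO v w hv hw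
    have hpl := parallelogram_law_with_norm ℝ v w
    simp only [map_add, map_sub, inner_add_left, inner_add_right, inner_sub_left,
      inner_sub_right] at h1 h2
    rw [← hs] at h1 h2
    have e : 2 / r * ‖v + w‖ ^ 2 + 2 / r * ‖v - w‖ ^ 2 = 2 / r * (2 * (‖v‖ ^ 2 + ‖w‖ ^ 2)) := by
      rw [← mul_add, hpl]
    rw [abs_le] at h1 h2
    have : |⟪fderiv ℝ n y v, w⟫| ≤ (2 / r * (‖v‖ ^ 2 + ‖w‖ ^ 2)) / 2 := by
      rw [abs_le]; constructor <;> linarith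
    linarith
  by_cases hv0 : v = 0
  · simp [hv0]
  by_cases hB : fderiv ℝ n y v = 0
  · rw [hB, norm_zero]; positivity
  have hvp : 0 < ‖v‖ := norm_pos_iff.2 hv0
  have hBp : 0 < ‖fderiv ℝ n y v‖ := norm_pos_iff.2 hB
  have := hpolar ((‖v‖ / ‖fderiv ℝ n y v‖) • fderiv ℝ n y v)
    (by rw [inner_smul_right, horth, mul_zero]) v hv
  rw [inner_smul_right, real_inner_self_eq_norm_sq, norm_smul, Real.norm_of_nonneg (by positivity),
    abs_of_nonneg (by positivity), div_mul_cancel₀ _ hBp.ne'] at this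
  have e : ‖v‖ / ‖fderiv ℝ n y v‖ * ‖fderiv ℝ n y v‖ ^ 2 = ‖v‖ * ‖fderiv ℝ n y v‖ := by
    field_simp
  rw [e] at this
  have : ‖v‖ * ‖fderiv ℝ n y v‖ ≤ ‖v‖ * (2 / r * ‖v‖) := by nlinarith
  exact le_of_mul_le_mul_left this hvp

end Curvature

/-! ### Tubular neighbourhoods -/

section Tube

variable {N : ℕ} {S : Set (Eucl N)} {νS : Eucl N → Eucl N} {r ρ : ℝ}

/-- `T` is the tubular neighbourhood of width `ρ` of `S`, with signed distance `d` and unit normal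
field `ν = ∇d` extending `νS`, whose derivative is bounded by `1 / ρ`. -/
structure IsTube (S : Set (Eucl N)) (νS : Eucl N → Eucl N) (ρ : ℝ) (T : Set (Eucl N))
    (d : Eucl N → ℝ) (ν : Eucl N → Eucl N) : Prop where
  pos : 0 < ρ
  isOpen : IsOpen T
  subset : S ⊆ T
  hasFDerivAt : ∀ p ∈ T, HasFDerivAt d (innerSL ℝ (ν p)) p
  contDiffOn_dist : ContDiffOn ℝ 1 d T
  contDiffOn : ContDiffOn ℝ 1 ν T
  norm_normal : ∀ p ∈ T, ‖ν p‖ = 1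
  norm_fderiv_le : ∀ p ∈ T, ‖fderiv ℝ ν p‖ ≤ 1 / ρ
  mem_iff : ∀ p ∈ T, (p ∈ S ↔ d p = 0)
  eq_normal : ∀ p ∈ S, ν p = νS p
  isClosed : ∀ ρ' < ρ, IsClosed {p ∈ T | |d p| ≤ ρ'}
  fiber : ∀ p ∈ T, ∃ a ∈ S, p = a + d p • νS a ∧
    ∀ s : ℝ, |s| ≤ |d p| → a + s • νS a ∈ T ∧ d (a + s • νS a) = s

/-- If two normal segments met, pairing `b - a = t ν(a) - s ν(b)` with `b - a` and using the reach
inequality twice would give `|b - a|² ≤ |b - a|² / 2`. -/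
lemma normal_fiber_injective (hr : 0 < r) (hunit : ∀ x ∈ S, ‖νS x‖ = 1)
    (hreach : ∀ x ∈ S, ∀ y ∈ S, |⟪y - x, νS x⟫| ≤ ‖y - x‖ ^ 2 / r)
    {a b : Eucl N} (ha : a ∈ S) (hb : b ∈ S) {t s : ℝ} (ht : |t| < r / 4) (hs : |s| < r / 4)
    (h : a + t • νS a = b + s • νS b) : a = b ∧ t = s := by
  have hab : a = b := by
    by_contra hne
    have hpos : 0 < ‖b - a‖ := norm_pos_iff.2 (sub_ne_zero.2 (Ne.symm hne))
    have h1 := hreach a ha b hb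
    have h2 := hreach b hb a ha
    have e : b - a = t • νS a - s • νS b := by
      have e0 : b - a - (t • νS a - s • νS b) = b + s • νS b - (a + t • νS a) := by abel
      rw [← h, sub_self] at e0
      exact sub_eq_zero.1 e0
    have h3 : ‖b - a‖ ^ 2 = t * ⟪b - a, νS a⟫ + s * ⟪a - b, νS b⟫ := by
      have : ⟪b - a, b - a⟫ = ⟪b - a, t • νS a - s • νS b⟫ := by rw [← e]
      rw [real_inner_self_eq_norm_sq, inner_sub_right, inner_smul_right, inner_smul_right] at this
      rw [this, ← neg_sub b a, inner_neg_left]; ring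
    have h4 : t * ⟪b - a, νS a⟫ ≤ r / 4 * (‖b - a‖ ^ 2 / r) :=
      (le_abs_self _).trans (by rw [abs_mul]; gcongr)
    have h5 : s * ⟪a - b, νS b⟫ ≤ r / 4 * (‖b - a‖ ^ 2 / r) := by
      rw [norm_sub_rev] at h2
      exact (le_abs_self _).trans (by rw [abs_mul]; gcongr)
    have h6 : r / 4 * (‖b - a‖ ^ 2 / r) = ‖b - a‖ ^ 2 / 4 := by field_simp
    nlinarith [sq_pos_of_pos hpos]
  subst hab
  refine ⟨rfl, ?_⟩
  have h1 : t • νS a = s • νS a := add_left_cancel h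
  exact smul_left_injective ℝ (norm_ne_zero_iff.1 (by rw [hunit a ha]; norm_num)) h1

variable {O : Set (Eucl N)} {f : Eucl N → ℝ} {n : Eucl N → Eucl N}

/-- Local inverse of `(a, t) ↦ a + t n(a)` on the hypersurface. -/
lemma IsLocalNormal.exists_local_inverse (hn : IsLocalNormal S νS O f n) {a₀ : Eucl N}
    (haO : a₀ ∈ O) {t₀ : ℝ}
    (hB : ∀ v, ⟪n a₀, v⟫ = 0 → ⟪n a₀, fderiv ℝ n a₀ v⟫ = 0 ∧ |t₀| * ‖fderiv ℝ n a₀ v‖ ≤ ‖v‖ / 2)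
    (haS : a₀ ∈ S) :
    ∃ (α : Eucl N → Eucl N) (τ : Eucl N → ℝ),
      ContDiffAt ℝ 1 α (a₀ + t₀ • n a₀) ∧ ContDiffAt ℝ 1 τ (a₀ + t₀ • n a₀) ∧
      α (a₀ + t₀ • n a₀) = a₀ ∧ τ (a₀ + t₀ • n a₀) = t₀ ∧
      ∀ᶠ p in 𝓝 (a₀ + t₀ • n a₀), α p ∈ O ∧ α p ∈ S ∧ p = α p + τ p • n (α p) := by
  -- Carrying the defining function as an extra coordinate lets the inverse function theorem act on
  -- open sets of the ambient space, without charts of `S`; the slice where this coordinate is `0`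
  -- is the wanted inverse.
  let Θ : Eucl N × ℝ → Eucl N × ℝ := fun q => (q.1 + q.2 • n q.1, f q.1)
  have hnC : ContDiffAt ℝ 1 n a₀ := hn.contDiffOn_normal.contDiffAt (hn.isOpen.mem_nhds haO)
  have hfC : ContDiffAt ℝ 1 f a₀ :=
    (hn.contDiffOn.contDiffAt (hn.isOpen.mem_nhds haO)).of_le (by norm_num)
  have hΘC : ContDiffAt ℝ 1 Θ (a₀, t₀) := by
    have h1 : ContDiffAt ℝ 1 (fun q : Eucl N × ℝ => n q.1) (a₀, t₀) :=
      ContDiffAt.comp (a₀, t₀) (g := n) hnC contDiffAt_fst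
    have h2 : ContDiffAt ℝ 1 (fun q : Eucl N × ℝ => f q.1) (a₀, t₀) :=
      ContDiffAt.comp (a₀, t₀) (g := f) hfC contDiffAt_fst
    exact (contDiffAt_fst.add (contDiffAt_snd.smul h1)).prodMk h2
  have hnd : HasFDerivAt n (fderiv ℝ n a₀) a₀ := (hnC.differentiableAt (by norm_num)).hasFDerivAt
  have hfd : HasFDerivAt f (fderiv ℝ f a₀) a₀ := (hfC.differentiableAt (by norm_num)).hasFDerivAt
  let Θ' : Eucl N × ℝ →L[ℝ] Eucl N × ℝ :=
    (ContinuousLinearMap.fst ℝ (Eucl N) ℝ +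
      (t₀ • (fderiv ℝ n a₀ ∘L ContinuousLinearMap.fst ℝ (Eucl N) ℝ) +
        (ContinuousLinearMap.snd ℝ (Eucl N) ℝ).smulRight (n a₀))).prod
      (fderiv ℝ f a₀ ∘L ContinuousLinearMap.fst ℝ (Eucl N) ℝ)
  have hΘd : HasFDerivAt Θ Θ' (a₀, t₀) := by
    have h1 : HasFDerivAt (fun q : Eucl N × ℝ => n q.1)
        (fderiv ℝ n a₀ ∘L ContinuousLinearMap.fst ℝ (Eucl N) ℝ) (a₀, t₀) :=
      HasFDerivAt.comp (a₀, t₀) (g := n) hnd hasFDerivAt_fst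
    have h2 : HasFDerivAt (fun q : Eucl N × ℝ => f q.1)
        (fderiv ℝ f a₀ ∘L ContinuousLinearMap.fst ℝ (Eucl N) ℝ) (a₀, t₀) :=
      HasFDerivAt.comp (a₀, t₀) (g := f) hfd hasFDerivAt_fst
    exact (hasFDerivAt_fst.add (hasFDerivAt_snd.smul h1)).prodMk h2
  obtain ⟨c, hc, hfc⟩ := hn.fderiv_eq a₀ haO
  have hinj : Function.Injective Θ'.toLinearMap := by
    rw [← LinearMap.ker_eq_bot, LinearMap.ker_eq_bot']
    rintro ⟨v, τ⟩ h
    have h1 : v + (t₀ • fderiv ℝ n a₀ v + τ • n a₀) = 0 := congrArg Prod.fst h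
    have h2 : fderiv ℝ f a₀ v = 0 := congrArg Prod.snd h
    rw [hfc] at h2
    have hv : ⟪n a₀, v⟫ = 0 := (mul_eq_zero.1 h2).resolve_left hc.ne'
    obtain ⟨h3, h4⟩ := hB v hv
    have hτ : τ = 0 := by
      have := congrArg (fun w => ⟪n a₀, w⟫) h1
      simpa [inner_add_right, inner_smul_right, hv, h3, real_inner_self_eq_norm_sq,
        hn.norm_normal a₀ haO] using this
    rw [hτ, zero_smul, add_zero] at h1
    have h5 : ‖v‖ = |t₀| * ‖fderiv ℝ n a₀ v‖ := by
      have h6 := congrArg norm (eq_neg_of_add_eq_zero_left h1)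
      rwa [norm_neg, norm_smul, Real.norm_eq_abs] at h6
    have hv0 : v = 0 := norm_le_zero_iff.1 (by linarith)
    rw [hv0, hτ]; rfl
  let e : (Eucl N × ℝ) ≃L[ℝ] (Eucl N × ℝ) :=
    (LinearEquiv.ofInjectiveEndo Θ'.toLinearMap hinj).toContinuousLinearEquiv
  have he : HasFDerivAt Θ (e : Eucl N × ℝ →L[ℝ] Eucl N × ℝ) (a₀, t₀) := by
    have hee : (e : Eucl N × ℝ →L[ℝ] Eucl N × ℝ) = Θ' := ContinuousLinearMap.ext fun q => rfl
    rw [hee]; exact hΘd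
  have hΘ0 : Θ (a₀, t₀) = (a₀ + t₀ • n a₀, 0) := by
    simp [Θ, (hn.mem_iff a₀ haO).1 haS]
  have hstrict := hΘC.hasStrictFDerivAt' he (by norm_num)
  set g := hΘC.localInverse he (by norm_num) with hg
  have hgC : ContDiffAt ℝ 1 g (a₀ + t₀ • n a₀, 0) := by
    rw [← hΘ0]; exact hΘC.to_localInverse he (by norm_num)
  have hg0 : g (a₀ + t₀ • n a₀, 0) = (a₀, t₀) := by
    rw [← hΘ0]; exact hΘC.localInverse_apply_image he (by norm_num)
  have hright : ∀ᶠ q in 𝓝 (a₀ + t₀ • n a₀, (0 : ℝ)), Θ (g q) = q := by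
    rw [← hΘ0]; exact hstrict.eventually_right_inverse
  have hι : ContDiffAt ℝ 1 (fun p : Eucl N => (p, (0 : ℝ))) (a₀ + t₀ • n a₀) :=
    contDiffAt_id.prodMk contDiffAt_const
  have hgι : ContDiffAt ℝ 1 (fun p : Eucl N => g (p, 0)) (a₀ + t₀ • n a₀) :=
    ContDiffAt.comp (a₀ + t₀ • n a₀) (g := g) hgC hι
  refine ⟨fun p => (g (p, 0)).1, fun p => (g (p, 0)).2, hgι.fst, hgι.snd,
    congrArg Prod.fst hg0, congrArg Prod.snd hg0, ?_⟩
  have hO : ∀ᶠ p in 𝓝 (a₀ + t₀ • n a₀), (g (p, 0)).1 ∈ O :=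
    hgι.fst.continuousAt.preimage_mem_nhds (by rw [hg0]; exact hn.isOpen.mem_nhds haO)
  filter_upwards [hO, hι.continuousAt.tendsto.eventually hright] with p hpO hp
  have h1 := congrArg Prod.fst hp
  have h2 := congrArg Prod.snd hp
  exact ⟨hpO, (hn.mem_iff _ hpO).2 h2, h1.symm⟩

/-- Injectivity on normal segments makes foot point `π` and height `d` well defined; the local
inverses make them `C¹`. The width `r / 4` balances the curvature bound `2 / r`: the relevant
perturbation of the identity has norm at most `1 / 2`. -/
lemma exists_isTube (hS : IsOrientedHypersurface S νS) (hr : 0 < r)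
    (h : ENNReal.ofReal r < regScale 2 S) : ∃ T d ν, IsTube S νS (r / 4) T d ν := by
  have hloc : ∀ x ∈ S, _ := fun x hx => exists_reach_of_lt_regScaleAt hS hx hr
    (h.trans_le (iInf₂_le x hx))
  have hreach : ∀ x ∈ S, ∀ y ∈ S, |⟪y - x, νS x⟫| ≤ ‖y - x‖ ^ 2 / r := fun x hx => (hloc x hx).1
  have hunit : ∀ x ∈ S, ‖νS x‖ = 1 := fun x hx => by
    obtain ⟨O, f, n, hxO, hn⟩ := hS.exists_isLocalNormal hx
    rw [hn.eq_normal x hxO hx, hn.norm_normal x hxO]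
  have hνcont : ContinuousOn νS S := fun x hx => by
    obtain ⟨O, f, n, hxO, hn⟩ := hS.exists_isLocalNormal hx
    have h1 : ContinuousWithinAt n S x := (hn.contDiffOn_normal.contDiffAt
      (hn.isOpen.mem_nhds hxO)).continuousAt.continuousWithinAt
    refine h1.congr_of_eventuallyEq ?_ (hn.eq_normal x hxO hx)
    filter_upwards [self_mem_nhdsWithin, mem_nhdsWithin_of_mem_nhds (hn.isOpen.mem_nhds hxO)]
      with y hyS hyO using hn.eq_normal y hyO hyS
  let T : Set (Eucl N) := {p | ∃ a ∈ S, ∃ t : ℝ, |t| < r / 4 ∧ p = a + t • νS a}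
  have hT : ∀ p, p ∈ T → ∃ a, ∃ t : ℝ, a ∈ S ∧ |t| < r / 4 ∧ p = a + t • νS a := by
    rintro p ⟨a, ha, t, ht, rfl⟩; exact ⟨a, t, ha, ht, rfl⟩
  choose! π d hπS hd hπd using hT
  have huniq : ∀ p ∈ T, ∀ a ∈ S, ∀ t : ℝ, |t| < r / 4 → p = a + t • νS a → π p = a ∧ d p = t :=
    fun p hp a ha t ht hpa => normal_fiber_injective hr hunit hreach (hπS p hp) ha (hd p hp) ht
      ((hπd p hp).symm.trans hpa)
  have hfib : ∀ a ∈ S, ∀ t : ℝ, |t| < r / 4 → a + t • νS a ∈ T ∧ π (a + t • νS a) = a ∧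
      d (a + t • νS a) = t := fun a ha t ht => by
    have hm : a + t • νS a ∈ T := ⟨a, ha, t, ht, rfl⟩
    exact ⟨hm, huniq _ hm a ha t ht rfl⟩
  have hr4 : 0 < r / 4 := by positivity
  have hST : ∀ a ∈ S, a ∈ T ∧ π a = a ∧ d a = 0 := fun a ha => by
    simpa using hfib a ha 0 (by simpa using hr4)
  -- local structure of `π` and `d`
  have hlocal : ∀ p ∈ T, ∃ O f n, IsLocalNormal S νS O f n ∧ π p ∈ O ∧ T ∈ 𝓝 p ∧
      ContDiffAt ℝ 1 π p ∧ ContDiffAt ℝ 1 d p ∧ (∀ᶠ q in 𝓝 p, νS (π q) = n (π q)) ∧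
      ∀ v, ⟪n (π p), v⟫ = 0 → ⟪n (π p), fderiv ℝ n (π p) v⟫ = 0 ∧
        ‖fderiv ℝ n (π p) v‖ ≤ 2 / r * ‖v‖ := by
    intro p hp
    obtain ⟨O, f, n, hpO, hn⟩ := hS.exists_isLocalNormal (hπS p hp)
    have hnorm := fun v (hv : ⟪n (π p), v⟫ = 0) =>
      hn.norm_fderiv_le hpO (hπS p hp) hr hreach (hloc _ (hπS p hp)).2 hv
    obtain ⟨α, τ, hα, hτ, hα0, hτ0, hev⟩ := hn.exists_local_inverse hpO (t₀ := d p) (by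
      intro v hv
      refine ⟨(hnorm v hv).1, ?_⟩
      calc |d p| * ‖fderiv ℝ n (π p) v‖ ≤ r / 4 * (2 / r * ‖v‖) := by
            gcongr
            · exact (hd p hp).le
            · exact (hnorm v hv).2
        _ = ‖v‖ / 2 := by field_simp; norm_num) (hπS p hp)
    rw [← hn.eq_normal _ hpO (hπS p hp), ← hπd p hp] at hα hτ hα0 hτ0 hev
    have hτr : ∀ᶠ q in 𝓝 p, |τ q| < r / 4 :=
      hτ.continuousAt.abs.eventually_lt continuousAt_const (by rw [hτ0]; exact hd p hp)
    have hall : ∀ᶠ q in 𝓝 p, q ∈ T ∧ π q = α q ∧ d q = τ q ∧ νS (π q) = n (π q) := by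
      filter_upwards [hev, hτr] with q hq hqτ
      obtain ⟨hqO, hqS, hqe⟩ := hq
      rw [← hn.eq_normal _ hqO hqS] at hqe
      have hm : q ∈ T := ⟨α q, hqS, τ q, hqτ, hqe⟩
      obtain ⟨h1, h2⟩ := huniq q hm _ hqS _ hqτ hqe
      refine ⟨hm, h1, h2, ?_⟩
      rw [h1]; exact hn.eq_normal _ hqO hqS
    refine ⟨O, f, n, hn, hpO, hall.mono fun q hq => hq.1,
      hα.congr_of_eventuallyEq (hall.mono fun q hq => hq.2.1),
      hτ.congr_of_eventuallyEq (hall.mono fun q hq => hq.2.2.1),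
      hall.mono fun q hq => hq.2.2.2, hnorm⟩
  have hνC : ∀ p ∈ T, ContDiffAt ℝ 1 (fun q => νS (π q)) p := by
    intro p hp
    obtain ⟨O, f, n, hn, hpO, hTp, hπC, hdC, hνn, hB⟩ := hlocal p hp
    have hnC : ContDiffAt ℝ 1 n (π p) := hn.contDiffOn_normal.contDiffAt (hn.isOpen.mem_nhds hpO)
    exact (ContDiffAt.comp p hnC hπC).congr_of_eventuallyEq hνn
  have hder : ∀ p ∈ T, HasFDerivAt d (innerSL ℝ (νS (π p))) p ∧
      ‖fderiv ℝ (fun q => νS (π q)) p‖ ≤ 1 / (r / 4) := by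
    intro p hp
    obtain ⟨O, f, n, hn, hpO, hTp, hπC, hdC, hνn, hB⟩ := hlocal p hp
    have hπd' := (hπC.differentiableAt (by norm_num)).hasFDerivAt
    have hdd := (hdC.differentiableAt (by norm_num)).hasFDerivAt
    have hnC : ContDiffAt ℝ 1 n (π p) := hn.contDiffOn_normal.contDiffAt (hn.isOpen.mem_nhds hpO)
    have hnd := (hnC.differentiableAt (by norm_num)).hasFDerivAt
    have hνd : HasFDerivAt (fun q => νS (π q)) (fderiv ℝ n (π p) ∘L fderiv ℝ π p) p :=
      (hnd.comp p hπd').congr_of_eventuallyEq hνn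
    have hνp : νS (π p) = n (π p) := hn.eq_normal _ hpO (hπS p hp)
    have hn1 : ‖n (π p)‖ = 1 := hn.norm_normal _ hpO
    have htan : ∀ h, ⟪n (π p), fderiv ℝ π p h⟫ = 0 := by
      intro h
      obtain ⟨c, hc, hfc⟩ := hn.fderiv_eq _ hpO
      have hfd := ((hn.contDiffOn.contDiffAt (hn.isOpen.mem_nhds hpO)).differentiableAt
        (by norm_num)).hasFDerivAt
      have hcomp := hfd.comp p hπd'
      have hzero : f ∘ π =ᶠ[𝓝 p] fun _ => (0 : ℝ) := by
        filter_upwards [hTp, hπC.continuousAt.preimage_mem_nhds (hn.isOpen.mem_nhds hpO)]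
          with q hq hqO using (hn.mem_iff _ hqO).1 (hπS q hq)
      have h0 := (hcomp.congr_of_eventuallyEq hzero.symm).unique (hasFDerivAt_const (0 : ℝ) p)
      have := congrArg (fun A => A h) h0
      simp only [ContinuousLinearMap.comp_apply, zero_apply, hfc] at this
      exact (mul_eq_zero.1 this).resolve_left hc.ne'
    -- This is `q = π(q) + d(q) ν(π(q))` differentiated. Its normal component identifies `∇d`, its
    -- tangential component bounds `Dπ`.
    have hsum : ∀ h, h = fderiv ℝ π p h + (d p • fderiv ℝ n (π p) (fderiv ℝ π p h) +
        fderiv ℝ d p h • n (π p)) := by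
      intro h
      have h1 := hπd'.add (hdd.smul hνd)
      have h2 : (fun q => q) =ᶠ[𝓝 p] π + (d • fun q => νS (π q)) := by
        filter_upwards [hTp] with q hq using hπd q hq
      have h3 := (h1.congr_of_eventuallyEq h2).unique (hasFDerivAt_id p)
      have := congrArg (fun A => A h) h3
      simp only [add_apply, smul_apply, ContinuousLinearMap.comp_apply,
        ContinuousLinearMap.smulRight_apply, hνp] at this
      exact this.symm
    have hdeq : ∀ h, fderiv ℝ d p h = ⟪n (π p), h⟫ := by
      intro h
      conv_rhs => rw [hsum h]
      rw [inner_add_right, inner_add_right, inner_smul_right, inner_smul_right, htan,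
        (hB _ (htan h)).1, real_inner_self_eq_norm_sq, hn1]
      ring
    constructor
    · have : fderiv ℝ d p = innerSL ℝ (νS (π p)) := by
        ext h; rw [hdeq, hνp]; rfl
      rw [← this]; exact hdd
    · rw [hνd.fderiv]
      refine ContinuousLinearMap.opNorm_le_bound _ (by positivity) fun h => ?_
      set w := fderiv ℝ π p h with hw
      have hBw := hB w (htan h)
      have h1 : ‖h - ⟪n (π p), h⟫ • n (π p)‖ ≤ ‖h‖ := by
        refine (abs_le_of_sq_le_sq' ?_ (norm_nonneg _)).2
        rw [norm_sub_sq_real, inner_smul_right, norm_smul, hn1, Real.norm_eq_abs, mul_one, sq_abs,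
          real_inner_comm]
        nlinarith [sq_nonneg ⟪n (π p), h⟫]
      have h2 : w = (h - ⟪n (π p), h⟫ • n (π p)) - d p • fderiv ℝ n (π p) w := by
        have := hsum h
        rw [hdeq, ← hw] at this
        rw [eq_sub_iff_add_eq, eq_sub_iff_add_eq, add_assoc]
        exact this.symm
      -- Absorbing the last term gives `|Dπ| ≤ 2`, hence `|Dν| ≤ (2 / r) · 2 = 1 / (r / 4)`.
      have h3 : ‖w‖ ≤ ‖h‖ + ‖w‖ / 2 := by
        have h4 : ‖d p • fderiv ℝ n (π p) w‖ ≤ ‖w‖ / 2 := by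
          rw [norm_smul, Real.norm_eq_abs]
          calc |d p| * ‖fderiv ℝ n (π p) w‖ ≤ r / 4 * (2 / r * ‖w‖) := by
                gcongr
                · exact (hd p hp).le
                · exact hBw.2
            _ = ‖w‖ / 2 := by field_simp; norm_num
        calc ‖w‖ = ‖(h - ⟪n (π p), h⟫ • n (π p)) - d p • fderiv ℝ n (π p) w‖ := by rw [← h2]
          _ ≤ _ := (norm_sub_le _ _).trans (add_le_add h1 h4)
      calc ‖fderiv ℝ n (π p) w‖ ≤ 2 / r * ‖w‖ := hBw.2
        _ ≤ 2 / r * (2 * ‖h‖) := by gcongr; linarith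
        _ = 1 / (r / 4) * ‖h‖ := by field_simp; ring
  refine ⟨T, d, fun q => νS (π q), hr4, ?_, fun a ha => (hST a ha).1, fun p hp => (hder p hp).1,
    ?_, fun p hp => (hνC p hp).contDiffWithinAt, fun p hp => hunit _ (hπS p hp),
    fun p hp => (hder p hp).2, ?_, fun p hp => by rw [(hST p hp).2.1], ?_, ?_⟩
  · refine isOpen_iff_mem_nhds.2 fun p hp => ?_
    obtain ⟨O, f, n, hn, hpO, hTp, -⟩ := hlocal p hp
    exact hTp
  · intro p hp
    obtain ⟨O, f, n, hn, hpO, hTp, hπC, hdC, -⟩ := hlocal p hp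
    exact hdC.contDiffWithinAt
  · refine fun p hp => ⟨fun h => (hST p h).2.2, fun h => ?_⟩
    have := hπd p hp
    rw [h, zero_smul, add_zero] at this
    rw [this]; exact hπS p hp
  -- Foot points and heights of a convergent sequence stay bounded. Along a subsequence they
  -- converge, and `ρ' < r / 4` keeps the limit height inside the tube.
  · intro ρ' hρ'
    refine IsSeqClosed.isClosed fun p q hp hpq => ?_
    obtain ⟨R, hR⟩ := (Metric.isBounded_range_of_tendsto p hpq).subset_closedBall 0
    have hmem : ∀ k, (π (p k), d (p k)) ∈ closedBall (0 : Eucl N) (R + ρ') ×ˢ Icc (-ρ') ρ' := by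
      intro k
      refine ⟨?_, abs_le.1 (hp k).2⟩
      have h1 : π (p k) = p k - d (p k) • νS (π (p k)) := eq_sub_of_add_eq (hπd _ (hp k).1).symm
      have h2 : ‖p k‖ ≤ R := by simpa using hR (mem_range_self k)
      rw [mem_closedBall_zero_iff, h1]
      refine (norm_sub_le _ _).trans (add_le_add h2 ?_)
      rw [norm_smul, hunit _ (hπS _ (hp k).1), mul_one]
      exact (hp k).2
    obtain ⟨⟨a, t⟩, hat, φ, hφ, hlim⟩ :=
      ((isCompact_closedBall (0 : Eucl N) (R + ρ')).prod isCompact_Icc).tendsto_subseq hmem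
    have hlim1 : Tendsto (fun k => π (p (φ k))) atTop (𝓝 a) :=
      (continuous_fst.tendsto _).comp hlim
    have hlim2 : Tendsto (fun k => d (p (φ k))) atTop (𝓝 t) :=
      (continuous_snd.tendsto _).comp hlim
    have haS : a ∈ S := hS.1.mem_of_tendsto hlim1 (Eventually.of_forall fun k => hπS _ (hp _).1)
    have hν : Tendsto (fun k => νS (π (p (φ k)))) atTop (𝓝 (νS a)) :=
      (hνcont a haS).tendsto.comp (tendsto_nhdsWithin_iff.2
        ⟨hlim1, Eventually.of_forall fun k => hπS _ (hp _).1⟩)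
    have hq : q = a + t • νS a := by
      refine tendsto_nhds_unique (hpq.comp hφ.tendsto_atTop) ?_
      refine (hlim1.add (hlim2.smul hν)).congr fun k => ?_
      exact (hπd _ (hp _).1).symm
    have ht : |t| ≤ ρ' := abs_le.2 hat.2
    obtain ⟨h1, -, h3⟩ := hfib a haS t (ht.trans_lt hρ')
    rw [hq]
    exact ⟨h1, by rw [h3]; exact ht⟩
  · intro p hp
    refine ⟨π p, hπS p hp, hπd p hp, fun s hs => ?_⟩
    obtain ⟨h1, -, h3⟩ := hfib _ (hπS p hp) s (hs.trans_lt (hd p hp))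
    exact ⟨h1, h3⟩

end Tube

/-! ### Tubes with globally defined, measurable data -/

section NormalizedTube

variable {N : ℕ} {S T : Set (Eucl N)} {νS ν : Eucl N → Eucl N} {d : Eucl N → ℝ} {r ρ : ℝ}

/-- A tubular neighbourhood whose signed distance and normal field are extended by `1` and `0`. -/
structure IsExtendedTube (S : Set (Eucl N)) (νS : Eucl N → Eucl N) (ρ : ℝ) (T : Set (Eucl N))
    (d : Eucl N → ℝ) (ν : Eucl N → Eucl N) : Prop extends IsTube S νS ρ T d ν where
  dist_eq : ∀ p ∉ T, d p = 1
  normal_eq : ∀ p ∉ T, ν p = 0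

open Classical in
lemma IsTube.isExtendedTube (h : IsTube S νS ρ T d ν) :
    IsExtendedTube S νS ρ T (T.piecewise d 1) (T.piecewise ν 0) := by
  have hd : EqOn (T.piecewise d 1) d T := piecewise_eqOn T d 1
  have hν : EqOn (T.piecewise ν 0) ν T := piecewise_eqOn T ν 0
  have hdn : ∀ p ∈ T, T.piecewise d 1 =ᶠ[𝓝 p] d := fun p hp =>
    hd.eventuallyEq_of_mem (h.isOpen.mem_nhds hp)
  have hνn : ∀ p ∈ T, T.piecewise ν 0 =ᶠ[𝓝 p] ν := fun p hp =>
    hν.eventuallyEq_of_mem (h.isOpen.mem_nhds hp)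
  refine ⟨⟨h.pos, h.isOpen, h.subset, fun p hp => ?_, h.contDiffOn_dist.congr hd,
    h.contDiffOn.congr hν, fun p hp => ?_, fun p hp => ?_, fun p hp => ?_, fun p hp => ?_,
    fun ρ' hρ' => ?_, fun p hp => ?_⟩, fun p hp => ?_, fun p hp => ?_⟩
  · rw [hν hp]; exact (h.hasFDerivAt p hp).congr_of_eventuallyEq (hdn p hp)
  · rw [hν hp]; exact h.norm_normal p hp
  · rw [(hνn p hp).fderiv_eq]; exact h.norm_fderiv_le p hp
  · rw [hd hp]; exact h.mem_iff p hp
  · rw [hν (h.subset hp)]; exact h.eq_normal p hp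
  · convert h.isClosed ρ' hρ' using 1
    ext p
    constructor
    · rintro ⟨h1, h2⟩; exact ⟨h1, by rwa [hd h1] at h2⟩
    · rintro ⟨h1, h2⟩; exact ⟨h1, by rwa [← hd h1] at h2⟩
  · obtain ⟨a, ha, hpa, hs⟩ := h.fiber p hp
    rw [hd hp]
    exact ⟨a, ha, hpa, fun s h' => ⟨(hs s h').1, by rw [hd (hs s h').1]; exact (hs s h').2⟩⟩
  · simp [hp]
  · simp [hp]

namespace IsExtendedTube

variable (h : IsExtendedTube S νS ρ T d ν)
include h

lemma norm_normal_le (p : Eucl N) : ‖ν p‖ ≤ 1 := by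
  by_cases hp : p ∈ T
  · exact (h.norm_normal p hp).le
  · rw [h.normal_eq p hp]; simp

/-- The nonzero value of `d` off `T` ensures that the zero set of `d` is exactly `S` in all of
space, so limits of `softZero ε d` are indicators of `S` without reference to the tube. -/
lemma mem_hypersurface_iff (p : Eucl N) : p ∈ S ↔ d p = 0 := by
  by_cases hp : p ∈ T
  · exact h.mem_iff p hp
  · rw [h.dist_eq p hp]
    simpa using fun hS => hp (h.subset hS)

lemma measurable_dist : Measurable d := by
  classical
  have := h.contDiffOn_dist.continuousOn.measurable_piecewise
    (continuousOn_const (c := (1 : ℝ)) (s := Tᶜ)) h.isOpen.measurableSet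
  convert this using 1
  ext p
  by_cases hp : p ∈ T <;> simp [hp, h.dist_eq]

lemma measurable_normal : Measurable ν := by
  classical
  have := h.contDiffOn.continuousOn.measurable_piecewise
    (continuousOn_const (c := (0 : Eucl N)) (s := Tᶜ)) h.isOpen.measurableSet
  convert this using 1
  ext p
  by_cases hp : p ∈ T <;> simp [hp, h.normal_eq]

end IsExtendedTube

lemma exists_isExtendedTube (hS : IsOrientedHypersurface S νS) (hr : 0 < r)
    (h : ENNReal.ofReal r < regScale 2 S) : ∃ T d ν, IsExtendedTube S νS (r / 4) T d ν := by
  classical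
  obtain ⟨T, d, ν, hT⟩ := exists_isTube hS hr h
  exact ⟨T, _, _, hT.isExtendedTube⟩

end NormalizedTube

/-! ### Transversal intersections are null sets -/

section Transversal

/-- Near `x` the differences of zeros of `G` are almost in `ker G'`, so orthogonal projection to the
kernel is injective on them with Lipschitz inverse. The zero set therefore has no more
`n`-dimensional measure than a subset of a space of dimension below `n`. No surjectivity of `G'` is
required. -/
lemma exists_nhds_hausdorffMeasure_eq_zero {E F : Type*} [NormedAddCommGroup E]
    [InnerProductSpace ℝ E] [FiniteDimensional ℝ E] [MeasurableSpace E] [BorelSpace E]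
    [NormedAddCommGroup F] [NormedSpace ℝ F] {G : E → F}
    {G' : E →L[ℝ] F} {x : E} (hG : HasStrictFDerivAt G G' x) {n : ℕ}
    (hn : Module.finrank ℝ G'.ker < n) :
    ∃ O ∈ 𝓝 x, ∀ Z ⊆ O, (∀ y ∈ Z, G y = 0) → Measure.hausdorffMeasure (n : ℝ) Z = 0 := by
  set K : Submodule ℝ E := G'.ker with hK
  let A : Kᗮ →ₗ[ℝ] F := G'.toLinearMap ∘ₗ Kᗮ.subtype
  have hA : A.ker = ⊥ := by
    rw [LinearMap.ker_eq_bot']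
    intro v hv
    have h1 : (v : E) ∈ K := hv
    exact Subtype.ext (Submodule.disjoint_def.1 K.orthogonal_disjoint _ h1 v.2)
  obtain ⟨C, hC, hAC⟩ := A.exists_antilipschitzWith hA
  have hC' : (0 : ℝ) < C := hC
  have hlow : ∀ v : E, ‖Kᗮ.starProjection v‖ ≤ C * ‖G' v‖ := by
    intro v
    have h1 := hAC.le_mul_dist (Kᗮ.orthogonalProjectionOnto v) 0
    rw [map_zero, dist_zero_right, dist_zero_right] at h1
    have h2 : A (Kᗮ.orthogonalProjectionOnto v) = G' v := by
      have h3 := K.starProjection_add_starProjection_orthogonal v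
      have h4 : G' (K.starProjection v) = 0 := by
        have : K.starProjection v ∈ K := K.starProjection_apply_mem v
        exact this
      conv_rhs => rw [← h3, map_add, h4, zero_add]
      rfl
    rw [h2] at h1
    exact h1
  -- With this constant at least half the length of a difference of zeros survives the projection.
  have hlittle := (hasStrictFDerivAt_iff_isLittleO.1 hG).def (c := 1 / (2 * C)) (by positivity)
  rw [nhds_prod_eq, eventually_prod_self_iff'] at hlittle
  obtain ⟨O, hO, hOG⟩ := hlittle
  refine ⟨O, hO, fun Z hZ hGZ => ?_⟩
  have hanti : AntilipschitzWith 2 fun y : Z => K.orthogonalProjectionOnto (y : E) := by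
    refine AntilipschitzWith.of_le_mul_dist fun y y' => ?_
    have h1 := hOG y (hZ y.2) y' (hZ y'.2)
    simp only [hGZ y y.2, hGZ y' y'.2, sub_self, zero_sub, norm_neg] at h1
    have h2 := hlow ((y : E) - y')
    have h3 : ‖Kᗮ.starProjection ((y : E) - y')‖ ≤ ‖(y : E) - y'‖ / 2 := by
      calc _ ≤ C * (1 / (2 * C) * ‖(y : E) - y'‖) := h2.trans (by gcongr)
        _ = _ := by field_simp
    have h4 := norm_add_le (K.starProjection ((y : E) - y')) (Kᗮ.starProjection ((y : E) - y'))
    rw [K.starProjection_add_starProjection_orthogonal] at h4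
    rw [Subtype.dist_eq, dist_eq_norm, dist_eq_norm, ← map_sub]
    have h5 : ‖K.orthogonalProjectionOnto ((y : E) - y')‖ = ‖K.starProjection ((y : E) - y')‖ := rfl
    rw [h5]
    push_cast
    linarith
  have hnull : Measure.hausdorffMeasure (n : ℝ) (univ : Set Z) = 0 := by
    have := hanti.le_hausdorffMeasure_image (d := n) (by positivity) univ
    rw [Real.hausdorffMeasure_of_finrank_lt (E := K) (by exact_mod_cast hn)] at this
    simpa using this
  have := (isometry_subtype_coe (s := Z)).hausdorffMeasure_image (d := n)
    (Or.inl (by positivity)) univ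
  rw [hnull] at this
  simpa using this

end Transversal

/-! ### Basic properties of varifolds -/

section GrasBasics

variable {n N : ℕ}

instance : SecondCountableTopology (Gras n N) :=
  TopologicalSpace.secondCountableTopology_induced _ _ Gras.proj

lemma Gras.continuous_proj : Continuous (Gras.proj : Gras n N → _) := continuous_induced_dom

lemma Gras.inner_proj_self (L : Gras n N) (v : Eucl N) : ⟪v, L.proj v⟫ = ‖L.proj v‖ ^ 2 := by
  rw [← real_inner_self_eq_norm_sq]
  have h1 : L.proj (L.proj v) = L.proj v :=
    congrArg (fun A => A v) L.1.isIdempotentElem_starProjection.eq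
  have h2 : ⟪L.proj v, L.proj v⟫ = ⟪v, L.proj (L.proj v)⟫ :=
    L.1.inner_starProjection_left_eq_right v (L.proj v)
  rw [h2, h1]

lemma Gras.norm_proj_apply_le (L : Gras n N) (v : Eucl N) : ‖L.proj v‖ ≤ ‖v‖ :=
  L.1.norm_starProjection_apply_le v

/-- The trace of `A` over the plane `L`. -/
def planeTrace (L : Gras n N) (A : Eucl N →L[ℝ] Eucl N) : ℝ :=
  LinearMap.trace ℝ (Eucl N) ((A ∘L L.proj : Eucl N →L[ℝ] Eucl N) : Eucl N →ₗ[ℝ] Eucl N)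

/-- Cyclicity of the trace moves the computation to `L`, whose orthonormal basis has `n` vectors;
this keeps the final constant independent of `N`. -/
lemma abs_planeTrace_le (L : Gras n N) (A : Eucl N →L[ℝ] Eucl N) :
    |planeTrace L A| ≤ n * ‖A‖ := by
  have e1 : ((A ∘L L.proj : Eucl N →L[ℝ] Eucl N) : Eucl N →ₗ[ℝ] Eucl N) =
      (A.toLinearMap ∘ₗ L.1.subtype) ∘ₗ (L.1.orthogonalProjectionOnto).toLinearMap := rfl
  rw [planeTrace, e1, LinearMap.trace_comp_comm',
    LinearMap.trace_eq_sum_inner _ (stdOrthonormalBasis ℝ L.1)]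
  refine (Finset.abs_sum_le_sum_abs _ _).trans ?_
  have : ∀ i ∈ Finset.univ, |⟪stdOrthonormalBasis ℝ L.1 i,
      ((L.1.orthogonalProjectionOnto).toLinearMap ∘ₗ A.toLinearMap ∘ₗ L.1.subtype)
        (stdOrthonormalBasis ℝ L.1 i)⟫| ≤ ‖A‖ := by
    intro i _
    set b := stdOrthonormalBasis ℝ L.1 i with hb
    have hb1 : ‖b‖ = 1 := (stdOrthonormalBasis ℝ L.1).norm_eq_one i
    refine (abs_real_inner_le_norm _ _).trans ?_
    rw [hb1, one_mul]
    calc ‖L.1.orthogonalProjectionOnto (A (b : Eucl N))‖ ≤ ‖A (b : Eucl N)‖ :=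
          L.1.norm_orthogonalProjectionOnto_apply_le _
      _ ≤ ‖A‖ * ‖(b : Eucl N)‖ := A.le_opNorm _
      _ = ‖A‖ := by rw [show ‖(b : Eucl N)‖ = 1 from hb1, mul_one]
  refine (Finset.sum_le_card_nsmul _ _ _ this).trans ?_
  rw [Finset.card_univ, Fintype.card_fin, L.2, nsmul_eq_mul]

lemma planeTrace_smulRight (L : Gras n N) (g : Eucl N →L[ℝ] ℝ) (v : Eucl N) :
    planeTrace L (g.smulRight v) = g (L.proj v) := by
  have : ((g.smulRight v ∘L L.proj : Eucl N →L[ℝ] Eucl N) : Eucl N →ₗ[ℝ] Eucl N) =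
      (g.toLinearMap ∘ₗ L.proj.toLinearMap).smulRight v := rfl
  rw [planeTrace, this, LinearMap.trace_smulRight]
  rfl

lemma planeTrace_add (L : Gras n N) (A B : Eucl N →L[ℝ] Eucl N) :
    planeTrace L (A + B) = planeTrace L A + planeTrace L B := by
  simp [planeTrace, ContinuousLinearMap.add_comp]

lemma planeTrace_smul (L : Gras n N) (c : ℝ) (A : Eucl N →L[ℝ] Eucl N) :
    planeTrace L (c • A) = c * planeTrace L A := by
  simp [planeTrace, ContinuousLinearMap.smul_comp]

lemma continuous_planeTrace :
    Continuous fun q : (Eucl N →L[ℝ] Eucl N) × Gras n N => planeTrace q.2 q.1 := by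
  let t : (Eucl N →L[ℝ] Eucl N) →ₗ[ℝ] ℝ :=
    LinearMap.trace ℝ (Eucl N) ∘ₗ ContinuousLinearMap.coeLM ℝ
  have ht : Continuous t := t.continuous_of_finiteDimensional
  exact ht.comp (continuous_fst.clm_comp (Gras.continuous_proj.comp continuous_snd))

lemma divPlane_eq (L : Gras n N) (X : Eucl N → Eucl N) (x : Eucl N) :
    divPlane L X x = planeTrace L (fderiv ℝ X x) := rfl

lemma divPlane_smul {L : Gras n N} {g : Eucl N → ℝ} {ν : Eucl N → Eucl N} {x : Eucl N}
    (hg : DifferentiableAt ℝ g x) (hν : DifferentiableAt ℝ ν x) :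
    divPlane L (fun y => g y • ν y) x =
      fderiv ℝ g x (L.proj (ν x)) + g x * planeTrace L (fderiv ℝ ν x) := by
  have : fderiv ℝ (fun y => g y • ν y) x = g x • fderiv ℝ ν x + (fderiv ℝ g x).smulRight (ν x) :=
    (hg.hasFDerivAt.smul hν.hasFDerivAt).fderiv
  rw [divPlane_eq, this, planeTrace_add, planeTrace_smul, planeTrace_smulRight, add_comm]

lemma divPlane_eq_zero_of_notMem {L : Gras n N} {X : Eucl N → Eucl N} {x : Eucl N}
    (hx : x ∉ tsupport X) : divPlane L X x = 0 := by
  have h1 := image_eq_zero_of_notMem_tsupport (fun h => hx (tsupport_fderiv_subset ℝ h) :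
    x ∉ tsupport (fderiv ℝ X))
  rw [divPlane_eq, h1]
  simp [planeTrace]

end GrasBasics

/-! ### Compactly supported `C¹` fields -/

section C1c

variable {N : ℕ} {W W' : Set (Eucl N)} {X Y : Eucl N → Eucl N}

lemma IsC1c.mono (h : IsC1c W X) (hW : W ⊆ W') : IsC1c W' X := ⟨h.1, h.2.1, h.2.2.trans hW⟩

lemma IsC1c.of_tsupport_subset {K : Set (Eucl N)} (hX : ContDiff ℝ 1 X) (hK : IsCompact K)
    (hXK : ∀ x ∉ K, X x = 0) (hKW : K ⊆ W) : IsC1c W X := by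
  have h1 : tsupport X ⊆ K := closure_minimal
    (fun x hx => by_contra fun h => hx (hXK x h)) hK.isClosed
  exact ⟨hX, hK.of_isClosed_subset (isClosed_tsupport X) h1, h1.trans hKW⟩

lemma IsC1c.eq_zero (h : IsC1c W X) {x : Eucl N} (hx : x ∉ W) : X x = 0 :=
  image_eq_zero_of_notMem_tsupport fun h' => hx (h.2.2 h')

lemma IsC1c.add (h : IsC1c W X) (h' : IsC1c W Y) : IsC1c W fun x => X x + Y x :=
  IsC1c.of_tsupport_subset (h.1.add h'.1) (h.2.1.isCompact.union h'.2.1.isCompact)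
    (fun x hx => by
      rw [image_eq_zero_of_notMem_tsupport fun h' => hx (Or.inl h'),
        image_eq_zero_of_notMem_tsupport fun h' => hx (Or.inr h'), add_zero])
    (union_subset h.2.2 h'.2.2)

lemma IsC1c.smul {g : Eucl N → ℝ} (hg : ContDiff ℝ 1 g) (h : IsC1c W X) :
    IsC1c W fun x => g x • X x :=
  IsC1c.of_tsupport_subset (hg.smul h.1) h.2.1.isCompact
    (fun x hx => by rw [image_eq_zero_of_notMem_tsupport hx, smul_zero]) h.2.2

lemma IsC1c.const_smul (c : ℝ) (h : IsC1c W X) : IsC1c W fun x => c • X x :=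
  h.smul contDiff_const

lemma IsC1c.sub (h : IsC1c W X) (h' : IsC1c W Y) : IsC1c W fun x => X x - Y x := by
  simpa [sub_eq_add_neg] using h.add (h'.const_smul (-1))

end C1c

/-! ### Mass measure, first variation and tangency to the barrier -/

namespace Varifold

variable {n N : ℕ} {U W : Set (Eucl N)} {X Y : Eucl N → Eucl N} (V : Varifold n N U)

lemma mass_apply {A : Set (Eucl N)} (hA : MeasurableSet A) : V.mass A = V.toMeasure (A ×ˢ univ) := by
  rw [mass, Measure.map_apply measurable_fst hA]
  congr 1
  ext p; simp

lemma mass_compl (hU : IsOpen U) : V.mass Uᶜ = 0 := by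
  rw [mass_apply V hU.measurableSet.compl]; exact V.carried

lemma mass_lt_top {K : Set (Eucl N)} (hK : IsCompact K) (hKU : K ⊆ U) : V.mass K < ∞ := by
  rw [mass_apply V hK.measurableSet]; exact V.locallyFinite K hK hKU

lemma integral_fst {f : Eucl N → ℝ} (hf : AEStronglyMeasurable f V.mass) :
    ∫ p, f p.1 ∂V.toMeasure = ∫ x, f x ∂V.mass :=
  (integral_map measurable_fst.aemeasurable hf).symm

lemma integrable_fst {f : Eucl N → ℝ} (hf : Integrable f V.mass) :
    Integrable (fun p => f p.1) V.toMeasure :=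
  hf.comp_measurable measurable_fst

lemma continuous_divPlane (hX : ContDiff ℝ 1 X) :
    Continuous fun p : Eucl N × Gras n N => divPlane p.2 X p.1 :=
  continuous_planeTrace.comp
    (((hX.continuous_fderiv (by norm_num)).comp continuous_fst).prodMk continuous_snd)

lemma integrable_divPlane (hX : IsC1c U X) :
    Integrable (fun p => divPlane p.2 X p.1) V.toMeasure := by
  obtain ⟨C, hC⟩ := (hX.2.1.fderiv ℝ).exists_bound_of_continuous
    (hX.1.continuous_fderiv (by norm_num))
  have hK : V.toMeasure (tsupport X ×ˢ univ) < ∞ := V.locallyFinite _ hX.2.1.isCompact hX.2.2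
  have hbound : Integrable ((tsupport X ×ˢ univ).indicator fun _ : Eucl N × Gras n N => n * C)
      V.toMeasure :=
    (integrable_indicator_iff ((isClosed_tsupport X).measurableSet.prod .univ)).2
      (integrableOn_const hK.ne)
  refine hbound.mono' (continuous_divPlane hX.1).aestronglyMeasurable
    (Eventually.of_forall fun p => ?_)
  by_cases hp : p.1 ∈ tsupport X
  · rw [indicator_of_mem (by simpa using hp), Real.norm_eq_abs]
    exact (abs_planeTrace_le _ _).trans (by gcongr; exact hC _)
  · rw [divPlane_eq_zero_of_notMem hp, indicator_of_notMem (by simpa using hp), norm_zero]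

lemma firstVar_add (hX : IsC1c U X) (hY : IsC1c U Y) :
    V.firstVar (fun x => X x + Y x) = V.firstVar X + V.firstVar Y := by
  rw [firstVar, firstVar, firstVar, ← integral_add (V.integrable_divPlane hX)
    (V.integrable_divPlane hY)]
  congr 1
  ext p
  have : fderiv ℝ (fun x => X x + Y x) p.1 = fderiv ℝ X p.1 + fderiv ℝ Y p.1 :=
    fderiv_add (hX.1.differentiable (by norm_num) _) (hY.1.differentiable (by norm_num) _)
  rw [divPlane_eq, this, planeTrace_add]; rfl

lemma firstVar_const_smul (c : ℝ) (hX : IsC1c U X) :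
    V.firstVar (fun x => c • X x) = c * V.firstVar X := by
  rw [firstVar, firstVar, ← integral_const_mul]
  congr 1
  ext p
  have : fderiv ℝ (fun x => c • X x) p.1 = c • fderiv ℝ X p.1 :=
    fderiv_const_smul (hX.1.differentiable (by norm_num) _) c
  rw [divPlane_eq, this, planeTrace_smul]; rfl

lemma firstVar_sub (hX : IsC1c U X) (hY : IsC1c U Y) :
    V.firstVar (fun x => X x - Y x) = V.firstVar X - V.firstVar Y := by
  have h1 := V.firstVar_add hX (hY.const_smul (-1))
  rw [V.firstVar_const_smul (-1) hY] at h1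
  simp only [neg_smul, one_smul, ← sub_eq_add_neg] at h1
  rw [h1]; ring

/-- Tangent planes of an integral varifold are tangent to a hypersurface at almost all points that
lie in it. -/
lemma IsIntegral.ae_proj_normal_eq_zero {V : Varifold n N U} (hV : V.IsIntegral)
    {S T : Set (Eucl N)} {νS ν : Eucl N → Eucl N} {d : Eucl N → ℝ} {ρ : ℝ}
    (hS : IsClosed S) (h : IsExtendedTube S νS ρ T d ν) :
    ∀ᵐ p ∂V.toMeasure, p.1 ∈ S → p.2.proj (ν p.1) = 0 := by
  obtain ⟨M, P, A, hM, hAM, hA, hVeq⟩ := hV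
  let B : Set (Eucl N × Gras n N) := {p | p.1 ∈ S ∧ p.2.proj (ν p.1) ≠ 0}
  have hBmeas : MeasurableSet B := by
    have hc : ContinuousOn (fun p : Eucl N × Gras n N => p.2.proj (ν p.1)) (T ×ˢ univ) := by
      have h1 : ContinuousOn (fun p : Eucl N × Gras n N => ν p.1) (T ×ˢ univ) :=
        h.contDiffOn.continuousOn.comp continuousOn_fst fun p hp => hp.1
      exact (Gras.continuous_proj.comp continuous_snd).continuousOn.clm_apply h1
    have ho := hc.isOpen_inter_preimage (h.isOpen.prod isOpen_univ)
      (isOpen_compl_singleton (x := (0 : Eucl N)))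
    have : B = (Prod.fst ⁻¹' S) ∩ ((T ×ˢ univ) ∩ (fun p : Eucl N × Gras n N => p.2.proj (ν p.1))
        ⁻¹' {0}ᶜ) := by
      ext p
      constructor
      · rintro ⟨h1, h2⟩; exact ⟨h1, ⟨h.subset h1, mem_univ _⟩, h2⟩
      · rintro ⟨h1, -, h2⟩; exact ⟨h1, h2⟩
    rw [this]
    exact (hS.measurableSet.preimage measurable_fst).inter ho.measurableSet
  have hB0 : V.toMeasure B = 0 := by
    rw [hVeq, Measure.sum_apply_eq_zero]
    intro i
    -- A push-forward under a map that is not a.e. measurable is `0` by convention, so such a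
    -- summand charges nothing.
    by_cases hae : AEMeasurable (fun x => (x, P i x))
        ((Measure.euclideanHausdorffMeasure n).restrict (A i))
    swap
    · rw [Measure.map_of_not_aemeasurable hae]; rfl
    rw [Measure.map_apply_of_aemeasurable hae hBmeas, Measure.restrict_apply' (hA i)]
    refine measure_mono_null (t := {x ∈ M i | x ∈ S ∧ (P i x).proj (ν x) ≠ 0})
      (fun x hx => ⟨hAM i hx.2, hx.1.1, hx.1.2⟩) ?_
    refine measure_null_of_locally_null _ fun x hx => ?_
    obtain ⟨hxM, hxS, hx0⟩ := hx
    obtain ⟨O, f, hO, hxO, hf, hMO, hker⟩ := hM i x hxM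
    have hxT := h.subset hxS
    have hfs : HasStrictFDerivAt f (fderiv ℝ f x) x :=
      (hf.contDiffAt (hO.mem_nhds hxO)).hasStrictFDerivAt (by norm_num)
    have hds : HasStrictFDerivAt d (innerSL ℝ (ν x)) x :=
      (h.contDiffOn_dist.contDiffAt (h.isOpen.mem_nhds hxT)).hasStrictFDerivAt'
        (h.hasFDerivAt x hxT) (by norm_num)
    -- The map `(f, d)` vanishes on `M ∩ S` near `x`. Its kernel is the part of the tangent plane
    -- orthogonal to `ν`; equality with the whole plane would give `|Pν|² = ν · Pν = 0`.
    have hrank : Module.finrank ℝ ((fderiv ℝ f x).prod (innerSL ℝ (ν x))).ker < n := by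
      refine lt_of_lt_of_eq (Submodule.finrank_lt_finrank_of_lt (t := (P i x).1)
        (lt_of_le_of_ne ?_ ?_)) (P i x).2
      · intro v hv
        rw [hker x ⟨hxM, hxO⟩]
        exact congrArg Prod.fst hv
      · intro he
        have h1 : (P i x).proj (ν x) ∈ (P i x).1 := (P i x).1.starProjection_apply_mem _
        rw [← he] at h1
        have h2 : ⟪ν x, (P i x).proj (ν x)⟫ = 0 := congrArg Prod.snd h1
        rw [Gras.inner_proj_self] at h2
        exact hx0 (norm_eq_zero.1 (pow_eq_zero_iff (by norm_num) |>.1 h2))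
    obtain ⟨O', hO', hnull⟩ := exists_nhds_hausdorffMeasure_eq_zero (hfs.prodMk hds) hrank
    refine ⟨{x ∈ M i | x ∈ S ∧ (P i x).proj (ν x) ≠ 0} ∩ (O ∩ O'),
      inter_mem self_mem_nhdsWithin
        (mem_nhdsWithin_of_mem_nhds (inter_mem (hO.mem_nhds hxO) hO')), ?_⟩
    rw [Measure.euclideanHausdorffMeasure_def, Measure.smul_apply,
      hnull _ (fun y hy => hy.2.2) ?_, smul_zero]
    rintro y ⟨⟨hyM, hyS, -⟩, hyO, -⟩
    have h1 : y ∈ M i ∩ O := ⟨hyM, hyO⟩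
    rw [hMO] at h1
    exact Prod.ext h1.2 ((h.mem_iff y (h.subset hyS)).1 hyS)
  have := compl_mem_ae_iff.2 hB0
  filter_upwards [this] with p hp hpS
  by_contra h0
  exact hp ⟨hpS, h0⟩

end Varifold

/-! ### Normal fields in a tubular neighbourhood -/

section Profiles

/-- A smooth approximation of the sign function. -/
def softSign (ε t : ℝ) : ℝ := t / √(t ^ 2 + ε ^ 2)

/-- A smooth approximation of the indicator function of the origin. -/
def softZero (ε t : ℝ) : ℝ := ε ^ 2 / (t ^ 2 + ε ^ 2)

variable {ε : ℝ}

lemma softZero_zero (hε : 0 < ε) : softZero ε 0 = 1 := by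
  simp [softZero, hε.ne']

lemma softZero_nonneg (t : ℝ) : 0 ≤ softZero ε t := by
  unfold softZero; positivity

lemma softZero_le_one (hε : 0 < ε) (t : ℝ) : softZero ε t ≤ 1 := by
  rw [softZero, div_le_one (by positivity)]; nlinarith [sq_nonneg t]

lemma softSign_zero : softSign ε 0 = 0 := by simp [softSign]

lemma abs_softSign_le_one (hε : 0 < ε) (t : ℝ) : |softSign ε t| ≤ 1 := by
  rw [softSign, abs_div, abs_of_nonneg (Real.sqrt_nonneg _), div_le_one (by positivity)]
  exact Real.abs_le_sqrt (by nlinarith [sq_nonneg ε])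

lemma contDiff_softZero (hε : 0 < ε) : ContDiff ℝ 1 (softZero ε) := by
  unfold softZero
  exact contDiff_const.div (by fun_prop) fun t => by positivity

lemma contDiff_softSign (hε : 0 < ε) : ContDiff ℝ 1 (softSign ε) := by
  unfold softSign
  exact contDiff_id.div (ContDiff.sqrt (by fun_prop) fun t => by positivity)
    fun t => by positivity

lemma deriv_softZero (hε : 0 < ε) (t : ℝ) :
    deriv (softZero ε) t = -2 * ε ^ 2 * t / (t ^ 2 + ε ^ 2) ^ 2 := by
  have h1 : HasDerivAt (fun t : ℝ => t ^ 2 + ε ^ 2) (2 * t) t := by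
    simpa using (hasDerivAt_pow 2 t).add_const (ε ^ 2)
  have h2 := (hasDerivAt_const t (ε ^ 2)).div h1 (by positivity : t ^ 2 + ε ^ 2 ≠ 0)
  have h3 : HasDerivAt (softZero ε) _ t := h2
  rw [h3.deriv]
  ring

lemma deriv_softSign (hε : 0 < ε) (t : ℝ) :
    deriv (softSign ε) t = ε ^ 2 / √(t ^ 2 + ε ^ 2) ^ 3 := by
  have hp : 0 < t ^ 2 + ε ^ 2 := by positivity
  have hs : 0 < √(t ^ 2 + ε ^ 2) := Real.sqrt_pos.2 hp
  have h1 : HasDerivAt (fun t : ℝ => t ^ 2 + ε ^ 2) (2 * t) t := by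
    simpa using (hasDerivAt_pow 2 t).add_const (ε ^ 2)
  have h2 := (hasDerivAt_id t).div (h1.sqrt hp.ne') hs.ne'
  have h3 : HasDerivAt (softSign ε) _ t := h2
  rw [h3.deriv]
  have hsq := Real.sq_sqrt hp.le
  simp only [id]
  field_simp
  rw [hsq]; ring

/-- The crucial comparison of profiles: the singular term created by localizing to `S` is dominated
by one created by an increasing profile that vanishes at `0`, hence by an admissible test field. It
reduces to `|t| ≤ √(t² + ε²)`. -/
lemma abs_deriv_softZero_le (hε : 0 < ε) (t : ℝ) :
    |deriv (softZero ε) t| ≤ 2 * deriv (softSign ε) t := by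
  have hp : 0 < t ^ 2 + ε ^ 2 := by positivity
  have hs : 0 < √(t ^ 2 + ε ^ 2) := Real.sqrt_pos.2 hp
  have hsq := Real.sq_sqrt hp.le
  rw [deriv_softZero hε, deriv_softSign hε]
  rw [show (t ^ 2 + ε ^ 2) ^ 2 = √(t ^ 2 + ε ^ 2) ^ 4 by
    rw [show √(t ^ 2 + ε ^ 2) ^ 4 = (√(t ^ 2 + ε ^ 2) ^ 2) ^ 2 by ring, hsq]]
  set s := √(t ^ 2 + ε ^ 2) with hsdef
  have ht : |t| ≤ s := Real.abs_le_sqrt (by nlinarith [sq_nonneg ε])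
  rw [abs_div, abs_mul, abs_mul, abs_of_pos (pow_pos hs 4), abs_of_pos (pow_pos hε 2)]
  rw [show |(-2 : ℝ)| = 2 by norm_num, div_le_iff₀ (by positivity)]
  calc 2 * ε ^ 2 * |t| ≤ 2 * ε ^ 2 * s := by gcongr
    _ = 2 * (ε ^ 2 / s ^ 3) * s ^ 4 := by field_simp

lemma deriv_softSign_nonneg (hε : 0 < ε) (t : ℝ) : 0 ≤ deriv (softSign ε) t := by
  rw [deriv_softSign hε]; positivity

lemma tendsto_softZero (t : ℝ) {e : ℕ → ℝ} (he : ∀ k, 0 < e k) (he0 : Tendsto e atTop (𝓝 0)) :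
    Tendsto (fun k => softZero (e k) t) atTop (𝓝 (if t = 0 then 1 else 0)) := by
  split_ifs with h
  · subst h
    exact tendsto_const_nhds.congr fun k => (softZero_zero (he k)).symm
  · have h1 := (he0.pow 2).div (tendsto_const_nhds (x := t ^ 2) |>.add (he0.pow 2))
      (by simpa using h)
    have h2 : (0 : ℝ) ^ 2 / (t ^ 2 + 0 ^ 2) = 0 := by simp
    rw [h2] at h1
    exact h1

/-- A smooth cutoff function on the line. -/
lemma exists_lineCutoff : ∃ (κ : ℝ → ℝ) (K : ℝ≥0), ContDiff ℝ 1 κ ∧ κ 0 = 1 ∧ (∀ t, 0 ≤ κ t) ∧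
    (∀ t, κ t ≤ 1) ∧ (∀ t, 1 / 2 < |t| → κ t = 0) ∧ ∀ t, |deriv κ t| ≤ K := by
  let b : ContDiffBump (0 : ℝ) := ⟨1 / 4, 1 / 2, by norm_num, by norm_num⟩
  have hb : ContDiff ℝ 1 b := b.contDiff
  obtain ⟨C, hC⟩ := (b.hasCompactSupport.deriv).exists_bound_of_continuous
    (hb.continuous_deriv (by norm_num))
  refine ⟨b, C.toNNReal, hb, b.one_of_mem_closedBall (by simp [b]),
    fun t => b.nonneg, fun t => b.le_one, fun t ht => b.zero_of_le_dist ?_, fun t => ?_⟩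
  · simpa [b] using ht.le
  · exact (hC t).trans (Real.le_coe_toNNReal C)

end Profiles

namespace IsExtendedTube

variable {n N : ℕ} {S T U W : Set (Eucl N)} {νS ν : Eucl N → Eucl N} {d : Eucl N → ℝ} {ρ : ℝ}
  (h : IsExtendedTube S νS ρ T d ν)
include h

lemma contDiff_normalField {η : Eucl N → ℝ} {K : Set (Eucl N)} (hη : ContDiffOn ℝ 1 η T)
    (hK : IsClosed K) (hKT : K ⊆ T) (hη0 : ∀ p ∈ T, p ∉ K → η p = 0) :
    ContDiff ℝ 1 fun p => η p • ν p := by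
  rw [contDiff_iff_contDiffAt]
  intro p
  by_cases hp : p ∈ T
  · exact (hη.contDiffAt (h.isOpen.mem_nhds hp)).smul
      (h.contDiffOn.contDiffAt (h.isOpen.mem_nhds hp))
  · have : (fun p => η p • ν p) =ᶠ[𝓝 p] fun _ => 0 := by
      filter_upwards [hK.isOpen_compl.mem_nhds fun hpK => hp (hKT hpK)] with q hq
      by_cases hqT : q ∈ T
      · rw [hη0 q hqT hq, zero_smul]
      · rw [h.normal_eq q hqT, smul_zero]
    exact contDiffAt_const.congr_of_eventuallyEq this

lemma isC1c_normalField {η : Eucl N → ℝ} {K : Set (Eucl N)} (hη : ContDiffOn ℝ 1 η T)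
    (hK : IsCompact K) (hKT : K ⊆ T) (hη0 : ∀ p ∈ T, p ∉ K → η p = 0) (hKW : K ⊆ W) :
    IsC1c W fun p => η p • ν p :=
  IsC1c.of_tsupport_subset (h.contDiff_normalField hη hK.isClosed hKT hη0) hK (fun p hp => by
    by_cases hpT : p ∈ T
    · rw [hη0 p hpT hp, zero_smul]
    · rw [h.normal_eq p hpT, smul_zero]) hKW

lemma fderiv_comp_dist {ψ : ℝ → ℝ} (hψ : ContDiff ℝ 1 ψ) {p : Eucl N} (hp : p ∈ T) (v : Eucl N) :
    fderiv ℝ (fun p => ψ (d p)) p v = deriv ψ (d p) * ⟪ν p, v⟫ := by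
  have h1 : HasDerivAt ψ (deriv ψ (d p)) (d p) :=
    (hψ.differentiable (by norm_num) _).hasDerivAt
  have h2 : HasFDerivAt (fun p => ψ (d p)) _ p := h1.comp_hasFDerivAt p (h.hasFDerivAt p hp)
  rw [h2.fderiv]
  rfl

lemma contDiffOn_comp_dist {ψ : ℝ → ℝ} (hψ : ContDiff ℝ 1 ψ) :
    ContDiffOn ℝ 1 (fun p => ψ (d p)) T :=
  hψ.comp_contDiffOn h.contDiffOn_dist

lemma divPlane_normalField {η : Eucl N → ℝ} (hη : ContDiffOn ℝ 1 η T) {p : Eucl N} (hp : p ∈ T)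
    (L : Gras n N) : divPlane L (fun p => η p • ν p) p =
      fderiv ℝ η p (L.proj (ν p)) + η p * planeTrace L (fderiv ℝ ν p) :=
  divPlane_smul
    ((hη.contDiffAt (h.isOpen.mem_nhds hp)).differentiableAt (by norm_num))
    ((h.contDiffOn.contDiffAt (h.isOpen.mem_nhds hp)).differentiableAt (by norm_num))

/-- As `∇(ψ(d)) = ψ'(d) ν`, the profile contributes `ψ'(d) η (ν · Pν)`, whose sign is that of `ψ'
η`. -/
lemma divPlane_comp_dist_smul {η : Eucl N → ℝ} {ψ : ℝ → ℝ} (hψ : ContDiff ℝ 1 ψ)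
    (hη : ContDiffOn ℝ 1 η T) {p : Eucl N} (hp : p ∈ T) (L : Gras n N) :
    divPlane L (fun p => (ψ (d p) * η p) • ν p) p =
      deriv ψ (d p) * η p * ‖L.proj (ν p)‖ ^ 2 +
        ψ (d p) * divPlane L (fun p => η p • ν p) p := by
  have h1 : DifferentiableAt ℝ (fun p => ψ (d p)) p :=
    ((h.contDiffOn_comp_dist hψ).contDiffAt (h.isOpen.mem_nhds hp)).differentiableAt (by norm_num)
  have h2 : DifferentiableAt ℝ (fun p => η p • ν p) p :=
    ((hη.smul h.contDiffOn).contDiffAt (h.isOpen.mem_nhds hp)).differentiableAt (by norm_num)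
  have h3 := divPlane_smul (L := L) h1 h2
  simp only [smul_smul] at h3
  rw [h3, h.fderiv_comp_dist hψ hp, map_smul, inner_smul_right, Gras.inner_proj_self, divPlane_eq]
  ring

lemma divPlane_normalField_of_notMem {η : Eucl N → ℝ} {K : Set (Eucl N)} (hK : IsClosed K)
    (hη0 : ∀ p ∈ T, p ∉ K → η p = 0) {p : Eucl N} (hp : p ∉ K) (L : Gras n N) :
    divPlane L (fun p => η p • ν p) p = 0 := by
  have hsub : Function.support (fun p => η p • ν p) ⊆ K :=
    fun q hq => by_contra fun hqK => hq ?_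
  · exact divPlane_eq_zero_of_notMem fun hp' => hp (closure_minimal hsub hK hp')
  by_cases hqT : q ∈ T
  · simp only [hη0 q hqT hqK, zero_smul]
  · simp only [h.normal_eq q hqT, smul_zero]

lemma abs_planeTrace_normal_le {p : Eucl N} (hp : p ∈ T) (L : Gras n N) :
    |planeTrace L (fderiv ℝ ν p)| ≤ n / ρ := by
  refine (abs_planeTrace_le L _).trans ?_
  rw [div_eq_mul_one_div]
  gcongr
  exact h.norm_fderiv_le p hp

end IsExtendedTube

/-! ### The first variation of a varifold with free boundary -/

namespace Varifold

variable {n N : ℕ} {S T U W' : Set (Eucl N)} {νS ν H : Eucl N → Eucl N} {d : Eucl N → ℝ} {ρ : ℝ}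
  {V : Varifold n N U}

lemma IsFreeBdryCurvature.integrableOn (hH : V.IsFreeBdryCurvature S νS H)
    (hW' : IsCompact (closure W')) (hW'U : closure W' ⊆ U) :
    IntegrableOn (tangentialPart S νS H) W' V.mass :=
  (hH.1.integrableOn_compact_subset hW'U hW').mono_set subset_closure

lemma IsFreeBdryCurvature.abs_firstVar_le (hH : V.IsFreeBdryCurvature S νS H)
    (hW' : IsCompact (closure W')) (hW'U : closure W' ⊆ U) {X : Eucl N → Eucl N}
    (hX : IsC1c W' X) (hX1 : ∀ x, ‖X x‖ ≤ 1) (hXS : ∀ x ∈ S, ⟪X x, νS x⟫ = 0) :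
    |V.firstVar X| ≤ ∫ x in W', ‖tangentialPart S νS H x‖ ∂V.mass := by
  rw [hH.2 X (hX.mono (subset_closure.trans hW'U)) hXS, abs_neg]
  have h1 : ∫ x, ⟪tangentialPart S νS H x, X x⟫ ∂V.mass =
      ∫ x in W', ⟪tangentialPart S νS H x, X x⟫ ∂V.mass := by
    refine (setIntegral_eq_integral_of_forall_compl_eq_zero fun x hx => ?_).symm
    rw [hX.eq_zero hx, inner_zero_right]
  rw [h1, ← Real.norm_eq_abs]
  refine norm_integral_le_of_norm_le (hH.integrableOn hW' hW'U).norm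
    (Eventually.of_forall fun x => ?_)
  refine (norm_inner_le_norm _ _).trans (mul_le_of_le_one_right (norm_nonneg _) (hX1 x))

/-- The first variation of a varifold with free boundary, on fields dominated by a cutoff `φ`. -/
lemma IsFreeBdryCurvature.abs_firstVar_le_of_cutoff (hH : V.IsFreeBdryCurvature S νS H)
    (hV : V.IsIntegral) (hS : IsClosed S)
    (h : IsExtendedTube S νS ρ T d ν) (hWo : IsOpen W') (hW' : IsCompact (closure W'))
    (hW'U : closure W' ⊆ U)
    {κ : ℝ → ℝ} {K M : ℝ} (hκ : ContDiff ℝ 1 κ) (hκ0 : κ 0 = 1) (hκn : ∀ t, 0 ≤ κ t)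
    (hκ1 : ∀ t, κ t ≤ 1) (hκs : ∀ t, 1 / 2 < |t| → κ t = 0) (hκd : ∀ t, |deriv κ t| ≤ K)
    {φ : Eucl N → ℝ} (hφ : ContDiff ℝ 1 φ) (hφc : HasCompactSupport φ) (hφW : tsupport φ ⊆ W')
    (hφ0 : ∀ x, 0 ≤ φ x) (hφ1 : ∀ x, φ x ≤ 1) (hφM : ∀ x, ‖fderiv ℝ φ x‖ ≤ M)
    {Y : Eucl N → Eucl N} (hY : IsC1c W' Y) (hYφ : ∀ x, ‖Y x‖ ≤ φ x) :
    |V.firstVar Y| ≤ 4 * ∫ x in W', ‖tangentialPart S νS H x‖ ∂V.mass +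
      (2 * (K / ρ + M + n / ρ) + n / ρ) * V.mass.real W' := by
  have hρ := h.pos
  have hWU : W' ⊆ U := subset_closure.trans hW'U
  set I := ∫ x in W', ‖tangentialPart S νS H x‖ ∂V.mass with hI
  set C := K / ρ + M + n / ρ with hC
  have hK0 : 0 ≤ K := (abs_nonneg _).trans (hκd 0)
  have hM0 : 0 ≤ M := (norm_nonneg _).trans (hφM 0)
  have hC0 : 0 ≤ C := by positivity
  have hμW : V.mass W' ≠ ∞ := ((measure_mono subset_closure).trans_lt
    (V.mass_lt_top hW' hW'U)).ne
  -- the cutoff `κ (d / ρ)` near `S`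
  set k : ℝ → ℝ := fun t => κ (t / ρ) with hk
  have hkC : ContDiff ℝ 1 k := hκ.comp (contDiff_id.div_const ρ)
  have hkd : ∀ t, |deriv k t| ≤ K / ρ := by
    intro t
    have h1 : HasDerivAt (fun t : ℝ => t / ρ) (1 / ρ) t := (hasDerivAt_id t).div_const ρ
    have h2 := ((hκ.differentiable (by norm_num) (t / ρ)).hasDerivAt.comp t h1).deriv
    have h3 : deriv k t = deriv κ (t / ρ) * (1 / ρ) := h2
    rw [h3, abs_mul, abs_of_pos (by positivity : 0 < 1 / ρ), ← div_eq_mul_one_div]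
    gcongr
    exact hκd _
  let K₁ : Set (Eucl N) := {p ∈ T | |d p| ≤ ρ / 2}
  have hK₁ : IsClosed K₁ := h.isClosed _ (by linarith)
  have hK₁T : K₁ ⊆ T := fun p hp => hp.1
  have hkd0 : ∀ p ∈ T, p ∉ K₁ → k (d p) = 0 := by
    intro p hp hpK
    refine hκs _ ?_
    have : ρ / 2 < |d p| := not_le.1 fun h' => hpK ⟨hp, h'⟩
    rw [abs_div, abs_of_pos hρ, lt_div_iff₀ hρ]
    linarith
  -- A common compact support, inside `T ∩ W'`, for all normal fields used below.
  let K₂ : Set (Eucl N) := K₁ ∩ tsupport φ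
  have hK₂ : IsCompact K₂ := hφc.isCompact.inter_left hK₁
  have hK₂T : K₂ ⊆ T := inter_subset_left.trans hK₁T
  have hK₂W : K₂ ⊆ W' := inter_subset_right.trans hφW
  have hzero : ∀ η : Eucl N → ℝ, (∀ x, φ x = 0 → η x = 0) →
      ∀ p ∈ T, p ∉ K₂ → k (d p) * η p = 0 := by
    intro η hη p hp hpK
    by_cases hp1 : p ∈ K₁
    · rw [hη p (image_eq_zero_of_notMem_tsupport fun h' => hpK ⟨hp1, h'⟩), mul_zero]
    · rw [hkd0 p hp hp1, zero_mul]
  have hzero' : ∀ (ψ : ℝ → ℝ) (η : Eucl N → ℝ), (∀ x, φ x = 0 → η x = 0) →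
      ∀ p ∈ T, p ∉ K₂ → ψ (d p) * (k (d p) * η p) = 0 := fun ψ η hη p hp hpK => by
    rw [hzero η hη p hp hpK, mul_zero]
  have hkdT : ContDiffOn ℝ 1 (fun p => k (d p)) T := h.contDiffOn_comp_dist hkC
  have hkφ : ContDiffOn ℝ 1 (fun p => k (d p) * φ p) T := hkdT.mul hφ.contDiffOn
  have hYν : ContDiffOn ℝ 1 (fun p => ⟪Y p, ν p⟫) T := hY.1.contDiffOn.inner ℝ h.contDiffOn
  have hg : ContDiffOn ℝ 1 (fun p => k (d p) * ⟪Y p, ν p⟫) T := hkdT.mul hYν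
  have hY0 : ∀ x, φ x = 0 → ⟪Y x, ν x⟫ = 0 := by
    intro x hx
    have : ‖Y x‖ ≤ 0 := hx ▸ hYφ x
    rw [norm_le_zero_iff.1 this, inner_zero_left]
  have hYνle : ∀ x, |⟪Y x, ν x⟫| ≤ φ x := fun x =>
    (abs_real_inner_le_norm _ _).trans
      ((mul_le_of_le_one_right (norm_nonneg _) (h.norm_normal_le x)).trans (hYφ x))
  -- the normal part of `Y`
  set X : Eucl N → Eucl N := fun p => (k (d p) * ⟪Y p, ν p⟫) • ν p with hX
  have hXc : IsC1c W' X := h.isC1c_normalField hg hK₂ hK₂T (hzero _ hY0) hK₂W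
  have hX1 : ∀ p, ‖X p‖ ≤ 1 := by
    intro p
    rw [hX, norm_smul, Real.norm_eq_abs, abs_mul, abs_of_nonneg (hκn _)]
    have h1 := h.norm_normal_le p
    have h2 := (hYνle p).trans (hφ1 p)
    have h3 : κ (d p / ρ) * |⟪Y p, ν p⟫| ≤ 1 :=
      mul_le_one₀ (hκ1 _) (abs_nonneg _) h2
    exact mul_le_one₀ h3 (norm_nonneg _) h1
  have hνS : ∀ x ∈ S, ⟪ν x, νS x⟫ = 1 := by
    intro x hx
    rw [← h.eq_normal x hx, real_inner_self_eq_norm_sq, h.norm_normal x (h.subset hx), one_pow]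
  have hdS : ∀ x ∈ S, d x = 0 := fun x hx => (h.mem_hypersurface_iff x).1 hx
  -- tangential part
  have htan : |V.firstVar fun x => Y x - X x| ≤ I := by
    refine hH.abs_firstVar_le hW' hW'U (hY.sub hXc) (fun x => ?_) fun x hx => ?_
    · refine le_trans ?_ ((hYφ x).trans (hφ1 x))
      refine (abs_le_of_sq_le_sq' ?_ (norm_nonneg _)).2
      rw [hX, norm_sub_sq_real, inner_smul_right, norm_smul, Real.norm_eq_abs, mul_pow, sq_abs]
      have h1 : ‖ν x‖ ^ 2 ≤ 1 := pow_le_one₀ (norm_nonneg _) (h.norm_normal_le x)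
      have h2 : (k (d x) * ⟪Y x, ν x⟫) ^ 2 * ‖ν x‖ ^ 2 ≤ (k (d x) * ⟪Y x, ν x⟫) ^ 2 :=
        mul_le_of_le_one_right (sq_nonneg _) h1
      have h3 : (k (d x) * ⟪Y x, ν x⟫) ^ 2 ≤ k (d x) * ⟪Y x, ν x⟫ ^ 2 := by
        rw [mul_pow, sq]
        have : k (d x) * k (d x) ≤ k (d x) := mul_le_of_le_one_right (hκn _) (hκ1 _)
        exact mul_le_mul_of_nonneg_right this (sq_nonneg _)
      have h4 : 0 ≤ k (d x) * ⟪Y x, ν x⟫ ^ 2 := mul_nonneg (hκn _) (sq_nonneg _)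
      nlinarith
    · have hk0 : k (d x) = 1 := by rw [hdS x hx, hk]; simp [hκ0]
      rw [hX, inner_sub_left, real_inner_smul_left, hνS x hx, hk0, h.eq_normal x hx]
      ring
  -- pointwise bound for the divergence of the cut off normal field
  have hdivφ : ∀ p : Eucl N × Gras n N,
      |divPlane p.2 (fun p => (k (d p) * φ p) • ν p) p.1| ≤ W'.indicator (fun _ => C) p.1 := by
    intro p
    by_cases hpK : p.1 ∈ K₂
    · have hpT := hK₂T hpK
      rw [indicator_of_mem (hK₂W hpK), h.divPlane_comp_dist_smul hkC hφ.contDiffOn hpT,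
        h.divPlane_normalField hφ.contDiffOn hpT]
      have hP : ‖p.2.proj (ν p.1)‖ ≤ 1 :=
        (Gras.norm_proj_apply_le _ _).trans (h.norm_normal_le _)
      have h1 : |deriv k (d p.1) * φ p.1 * ‖p.2.proj (ν p.1)‖ ^ 2| ≤ K / ρ := by
        rw [abs_mul, abs_mul, abs_of_nonneg (hφ0 _), abs_of_nonneg (sq_nonneg ‖_‖), mul_assoc]
        exact (mul_le_of_le_one_right (abs_nonneg _) (mul_le_one₀ (hφ1 _) (sq_nonneg _)
          (pow_le_one₀ (norm_nonneg _) hP))).trans (hkd _)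
      have h2 : |fderiv ℝ φ p.1 (p.2.proj (ν p.1))| ≤ M :=
        ((fderiv ℝ φ p.1).le_opNorm _).trans
          ((mul_le_of_le_one_right (norm_nonneg _) hP).trans (hφM _))
      have h3 : |φ p.1 * planeTrace p.2 (fderiv ℝ ν p.1)| ≤ n / ρ := by
        rw [abs_mul, abs_of_nonneg (hφ0 _)]
        exact (mul_le_of_le_one_left (abs_nonneg _) (hφ1 _)).trans
          (h.abs_planeTrace_normal_le hpT _)
      have h4 : |k (d p.1) * (fderiv ℝ φ p.1 (p.2.proj (ν p.1)) +
          φ p.1 * planeTrace p.2 (fderiv ℝ ν p.1))| ≤ M + n / ρ := by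
        rw [abs_mul, abs_of_nonneg (hκn _)]
        exact (mul_le_of_le_one_left (abs_nonneg _) (hκ1 _)).trans
          ((abs_add_le _ _).trans (add_le_add h2 h3))
      refine (abs_add_le _ _).trans ((add_le_add h1 h4).trans_eq ?_)
      rw [hC]; ring
    · rw [h.divPlane_normalField_of_notMem hK₂.isClosed (hzero φ fun _ h => h) hpK, abs_zero]
      exact indicator_nonneg (fun _ _ => hC0) _
  have hCint : Integrable (fun p : Eucl N × Gras n N => W'.indicator (fun _ => C) p.1)
      V.toMeasure := V.integrable_fst
    ((integrable_indicator_iff hWo.measurableSet).2 (integrableOn_const hμW))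
  have hCval : ∫ p : Eucl N × Gras n N, W'.indicator (fun _ => C) p.1 ∂V.toMeasure =
      C * V.mass.real W' := by
    rw [V.integral_fst (aestronglyMeasurable_const.indicator hWo.measurableSet),
      integral_indicator hWo.measurableSet, setIntegral_const, smul_eq_mul, mul_comm]
  have hXint := V.integrable_divPlane (hXc.mono hWU)
  -- the estimate at scale `ε`
  have hscale : ∀ ε : ℝ, 0 < ε → |V.firstVar X| ≤ 3 * I + 2 * C * V.mass.real W' +
      ∫ p, softZero ε (d p.1) * |divPlane p.2 X p.1| ∂V.toMeasure := by
    intro ε hε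
    -- `F` vanishes on `S`, so it is admissible. It uses the cutoff `φ` in place of `Y · ν`, so the
    -- bounds for its divergence do not see `DY`.
    set F : Eucl N → Eucl N := fun p => (softSign ε (d p) * (k (d p) * φ p)) • ν p with hF
    have hFc : IsC1c W' F := h.isC1c_normalField
      ((h.contDiffOn_comp_dist (contDiff_softSign hε)).mul hkφ) hK₂ hK₂T
      (hzero' _ φ fun _ h => h) hK₂W
    have hFv : |V.firstVar F| ≤ I := by
      refine hH.abs_firstVar_le hW' hW'U hFc (fun x => ?_) fun x hx => ?_
      · rw [hF, norm_smul, Real.norm_eq_abs, abs_mul, abs_mul, abs_of_nonneg (hκn _),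
          abs_of_nonneg (hφ0 _)]
        exact mul_le_one₀ (mul_le_one₀ (abs_softSign_le_one hε _)
          (mul_nonneg (hκn _) (hφ0 _)) (mul_le_one₀ (hκ1 _) (hφ0 _) (hφ1 _))) (norm_nonneg _)
          (h.norm_normal_le _)
      · rw [hF]; simp [hdS x hx, softSign_zero]
    -- `X₂` agrees with `X` on `S`, so `X - X₂` is admissible and costs one `I`.
    set X₂ : Eucl N → Eucl N := fun p => (softZero ε (d p) * (k (d p) * ⟪Y p, ν p⟫)) • ν p with hX₂
    have hX₂c : IsC1c W' X₂ := h.isC1c_normalField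
      ((h.contDiffOn_comp_dist (contDiff_softZero hε)).mul hg) hK₂ hK₂T
      (hzero' _ _ hY0) hK₂W
    have hX₁v : |V.firstVar fun x => X x - X₂ x| ≤ I := by
      refine hH.abs_firstVar_le hW' hW'U (hXc.sub hX₂c) (fun x => ?_) fun x hx => ?_
      · have e : X x - X₂ x = (1 - softZero ε (d x)) • X x := by
          rw [hX, hX₂]; module
        rw [e, norm_smul, Real.norm_of_nonneg (sub_nonneg.2 (softZero_le_one hε _))]
        exact mul_le_one₀ (by linarith [softZero_nonneg (ε := ε) (d x)]) (norm_nonneg _) (hX1 x)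
      · rw [hX, hX₂]; simp [hdS x hx, softZero_zero hε]
    -- The term with `softZero'` is at most twice the term with `softSign'`, since `|Y · ν| ≤ φ`;
    -- the latter is `div F` up to an error `C`. The factor `softZero ε d` on `|div X|` is kept for
    -- the limit.
    have hpt : ∀ p : Eucl N × Gras n N, |divPlane p.2 X₂ p.1| ≤
        2 * (divPlane p.2 F p.1 + W'.indicator (fun _ => C) p.1) +
          softZero ε (d p.1) * |divPlane p.2 X p.1| := by
      intro p
      by_cases hpT : p.1 ∈ T
      · have e1 := h.divPlane_comp_dist_smul (contDiff_softZero hε) hg hpT p.2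
        have e2 := h.divPlane_comp_dist_smul (contDiff_softSign hε) hkφ hpT p.2
        rw [← hX₂, ← hX] at e1
        rw [← hF] at e2
        have h1 : |softSign ε (d p.1) * divPlane p.2 (fun p => (k (d p) * φ p) • ν p) p.1| ≤
            W'.indicator (fun _ => C) p.1 := by
          rw [abs_mul]
          exact (mul_le_of_le_one_left (abs_nonneg _) (abs_softSign_le_one hε _)).trans (hdivφ p)
        have h2 : deriv (softSign ε) (d p.1) * (k (d p.1) * φ p.1) * ‖p.2.proj (ν p.1)‖ ^ 2 ≤
            divPlane p.2 F p.1 + W'.indicator (fun _ => C) p.1 := by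
          linarith [neg_abs_le
            (softSign ε (d p.1) * divPlane p.2 (fun p => (k (d p) * φ p) • ν p) p.1)]
        have h3 : |deriv (softZero ε) (d p.1) * (k (d p.1) * ⟪Y p.1, ν p.1⟫) *
            ‖p.2.proj (ν p.1)‖ ^ 2| ≤
            2 * (deriv (softSign ε) (d p.1) * (k (d p.1) * φ p.1) * ‖p.2.proj (ν p.1)‖ ^ 2) := by
          rw [abs_mul, abs_mul, abs_mul, abs_of_nonneg (hκn _), abs_of_nonneg (sq_nonneg ‖_‖),
            ← mul_assoc 2, ← mul_assoc 2]
          have := abs_deriv_softZero_le hε (d p.1)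
          have hs := deriv_softSign_nonneg hε (d p.1)
          have hkn : 0 ≤ κ (d p.1 / ρ) := hκn _
          have hy := hYνle p.1
          gcongr
        rw [e1]
        refine (abs_add_le _ _).trans (add_le_add (h3.trans ?_) ?_)
        · linarith
        · rw [abs_mul, abs_of_nonneg (softZero_nonneg _)]
      · have hpK : p.1 ∉ K₂ := fun h' => hpT (hK₂T h')
        rw [h.divPlane_normalField_of_notMem hK₂.isClosed (hzero' _ _ hY0) hpK,
          h.divPlane_normalField_of_notMem hK₂.isClosed (hzero' _ φ fun _ h => h) hpK,
          h.divPlane_normalField_of_notMem hK₂.isClosed (hzero _ hY0) hpK]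
        have : 0 ≤ W'.indicator (fun _ => C) p.1 := indicator_nonneg (fun _ _ => hC0) _
        simp only [abs_zero, mul_zero, zero_add, add_zero]
        linarith
    have hFint := V.integrable_divPlane (hFc.mono hWU)
    have hsX : Integrable (fun p => softZero ε (d p.1) * |divPlane p.2 X p.1|) V.toMeasure := by
      refine hXint.abs.mono' ?_ (Eventually.of_forall fun p => ?_)
      · exact (((contDiff_softZero hε).continuous.measurable.comp
          (h.measurable_dist.comp measurable_fst)).aestronglyMeasurable).mul
          hXint.abs.aestronglyMeasurable
      · rw [Real.norm_eq_abs, abs_mul, abs_abs, abs_of_nonneg (softZero_nonneg _)]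
        exact mul_le_of_le_one_left (abs_nonneg _) (softZero_le_one hε _)
    have hX₂v : |V.firstVar X₂| ≤ 2 * (I + C * V.mass.real W') +
        ∫ p, softZero ε (d p.1) * |divPlane p.2 X p.1| ∂V.toMeasure := by
      have hFC : Integrable (fun p : Eucl N × Gras n N =>
          divPlane p.2 F p.1 + W'.indicator (fun _ => C) p.1) V.toMeasure := hFint.add hCint
      have hint : Integrable (fun p : Eucl N × Gras n N =>
          2 * (divPlane p.2 F p.1 + W'.indicator (fun _ => C) p.1) +
            softZero ε (d p.1) * |divPlane p.2 X p.1|) V.toMeasure := (hFC.const_mul 2).add hsX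
      have hle := norm_integral_le_of_norm_le (f := fun p => divPlane p.2 X₂ p.1) hint
        (Eventually.of_forall hpt)
      have hval : ∫ p, (2 * (divPlane p.2 F p.1 + W'.indicator (fun _ => C) p.1) +
          softZero ε (d p.1) * |divPlane p.2 X p.1|) ∂V.toMeasure =
          2 * (V.firstVar F + C * V.mass.real W') +
          ∫ p, softZero ε (d p.1) * |divPlane p.2 X p.1| ∂V.toMeasure := by
        rw [integral_add (hFC.const_mul 2) hsX, integral_const_mul]
        congr 2
        exact (integral_add hFint hCint).trans (by rw [hCval]; rfl)
      have hle' : |V.firstVar X₂| ≤ _ := hle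
      refine hle'.trans ((le_of_eq hval).trans ?_)
      linarith [le_abs_self (V.firstVar F)]
    have hsub := V.firstVar_sub (hXc.mono hWU) (hX₂c.mono hWU)
    have : V.firstVar X = V.firstVar (fun x => X x - X₂ x) + V.firstVar X₂ := by rw [hsub]; ring
    rw [this]
    refine (abs_add_le _ _).trans ?_
    linarith
  -- the limit `ε → 0`
  have hlim : Tendsto (fun j : ℕ => ∫ p, softZero (1 / ((j : ℝ) + 1)) (d p.1) *
      |divPlane p.2 X p.1| ∂V.toMeasure) atTop
      (𝓝 (∫ p, (if d p.1 = 0 then 1 else 0) * |divPlane p.2 X p.1| ∂V.toMeasure)) := by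
    refine tendsto_integral_of_dominated_convergence (fun p => |divPlane p.2 X p.1|) (fun j => ?_)
      hXint.abs (fun j => Eventually.of_forall fun p => ?_) (Eventually.of_forall fun p => ?_)
    · exact (((contDiff_softZero (by positivity)).continuous.measurable.comp
          (h.measurable_dist.comp measurable_fst)).aestronglyMeasurable).mul
          hXint.abs.aestronglyMeasurable
    · rw [Real.norm_eq_abs, abs_mul, abs_abs, abs_of_nonneg (softZero_nonneg _)]
      exact mul_le_of_le_one_left (abs_nonneg _) (softZero_le_one (by positivity) _)
    · exact (tendsto_softZero _ (fun j => by positivity)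
        tendsto_one_div_add_atTop_nhds_zero_nat).mul_const _
  -- On `S` the tangent planes satisfy `Pν = 0` almost everywhere, which removes the derivative of
  -- the coefficient, the only place where `DY` could enter.
  have hlast : ∫ p, (if d p.1 = 0 then 1 else 0) * |divPlane p.2 X p.1| ∂V.toMeasure ≤
      n / ρ * V.mass.real W' := by
    have hb : Integrable (fun p : Eucl N × Gras n N => W'.indicator (fun _ => (n : ℝ) / ρ) p.1)
        V.toMeasure := V.integrable_fst
      ((integrable_indicator_iff hWo.measurableSet).2 (integrableOn_const hμW))
    have hbval : ∫ p : Eucl N × Gras n N, W'.indicator (fun _ => (n : ℝ) / ρ) p.1 ∂V.toMeasure =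
        n / ρ * V.mass.real W' := by
      rw [V.integral_fst (aestronglyMeasurable_const.indicator hWo.measurableSet),
        integral_indicator hWo.measurableSet, setIntegral_const, smul_eq_mul, mul_comm]
    rw [← hbval]
    refine integral_mono_of_nonneg (Eventually.of_forall fun p => ?_) hb ?_
    · dsimp only [Pi.zero_apply]
      split_ifs <;> simp
    · filter_upwards [hV.ae_proj_normal_eq_zero hS h] with p hp
      have hnn : 0 ≤ W'.indicator (fun _ => (n : ℝ) / ρ) p.1 :=
        indicator_nonneg (fun _ _ => by positivity) _
      split_ifs with hd0
      · rw [one_mul]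
        by_cases hpK : p.1 ∈ K₂
        · have hpT := hK₂T hpK
          rw [indicator_of_mem (hK₂W hpK), h.divPlane_normalField hg hpT,
            hp ((h.mem_hypersurface_iff _).2 hd0), map_zero, zero_add, abs_mul]
          refine (mul_le_of_le_one_left (abs_nonneg _) ?_).trans (h.abs_planeTrace_normal_le hpT _)
          rw [abs_mul, abs_of_nonneg (hκn _)]
          exact mul_le_one₀ (hκ1 _) (abs_nonneg _) ((hYνle _).trans (hφ1 _))
        · rw [h.divPlane_normalField_of_notMem hK₂.isClosed (hzero _ hY0) hpK, abs_zero]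
          exact hnn
      · rw [zero_mul]; exact hnn
  -- One `I` comes from `X - X₂` and two from `F`; the tangential field `Y - X` adds the fourth.
  have hXv : |V.firstVar X| ≤ 3 * I + 2 * C * V.mass.real W' + n / ρ * V.mass.real W' := by
    have := ge_of_tendsto' (hlim.const_add (3 * I + 2 * C * V.mass.real W'))
      fun j => hscale _ (by positivity)
    linarith
  have hsub := V.firstVar_sub (hY.mono hWU) (hXc.mono hWU)
  have : V.firstVar Y = V.firstVar (fun x => Y x - X x) + V.firstVar X := by rw [hsub]; ring
  rw [this]
  refine (abs_add_le _ _).trans ?_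
  linarith

end Varifold

/-! ### Cutoff functions -/

section Cutoff

variable {N : ℕ}

/-- Averaging translates of a `1`-Lipschitz function against a probability density preserves the
Lipschitz constant, with no dependence on the dimension. -/
lemma exists_contDiff_approx_of_lipschitz {g : Eucl N → ℝ} (hg : LipschitzWith 1 g) {τ : ℝ}
    (hτ : 0 < τ) : ∃ g' : Eucl N → ℝ, ContDiff ℝ 1 g' ∧ (∀ x, |g' x - g x| ≤ τ) ∧
      ∀ x, ‖fderiv ℝ g' x‖ ≤ 1 := by
  let φ : ContDiffBump (0 : Eucl N) := ⟨τ / 2, τ, half_pos hτ, half_lt_self hτ⟩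
  let b := φ.normed volume
  have hbc : HasCompactSupport b := φ.hasCompactSupport_normed
  have hbC : ContDiff ℝ 1 b := φ.contDiff_normed
  have hgl : LocallyIntegrable g volume := hg.continuous.locallyIntegrable
  let L := ContinuousLinearMap.lsmul ℝ ℝ (E := ℝ)
  have hint : ∀ x, Integrable (fun t => b t * g (x - t)) volume := fun x => by
    refine Continuous.integrable_of_hasCompactSupport ?_ hbc.mul_right
    exact hbC.continuous.mul (hg.continuous.comp (by fun_prop))
  have hdef : ∀ x, convolution b g L volume x = ∫ t, b t * g (x - t) := fun x => rfl
  refine ⟨convolution b g L volume, hbc.contDiff_convolution_left _ hbC hgl, fun x => ?_,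
    fun x => ?_⟩
  · have := φ.dist_normed_convolution_le (μ := volume) (g := g) (x₀ := x) (ε := τ)
      hgl.aestronglyMeasurable (fun y hy => by
        have h1 := hg.dist_le_mul y x
        rw [NNReal.coe_one, one_mul] at h1
        exact h1.trans (mem_ball.1 hy).le)
    rwa [Real.dist_eq] at this
  · refine (norm_fderiv_le_of_lipschitz ℝ (C := 1)
      (LipschitzWith.of_dist_le_mul fun y z => ?_)).trans (by simp)
    rw [hdef, hdef, Real.dist_eq, ← integral_sub (hint y) (hint z), NNReal.coe_one, one_mul,
      ← Real.norm_eq_abs]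
    have hbI : Integrable b volume := hbC.continuous.integrable_of_hasCompactSupport hbc
    refine (norm_integral_le_of_norm_le (hbI.mul_const (dist y z))
      (Eventually.of_forall fun t => ?_)).trans ?_
    · rw [← mul_sub, norm_mul, Real.norm_of_nonneg (φ.nonneg_normed t)]
      refine mul_le_mul_of_nonneg_left ?_ (φ.nonneg_normed t)
      have h1 := hg.dist_le_mul (y - t) (z - t)
      rwa [NNReal.coe_one, one_mul, dist_sub_right, Real.dist_eq] at h1
    · rw [integral_mul_const, φ.integral_normed, one_mul]

/-- A fixed one-dimensional profile is composed with a smoothed distance to the complement of `W'`;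
thus `K` is chosen before `N`. -/
lemma exists_cutoff_constant : ∃ K : ℝ≥0, ∀ (N : ℕ) (W W' : Set (Eucl N)) (δ : ℝ), 0 < δ →
    IsCompact (closure W') → W'ᶜ.Nonempty → (∀ w ∈ W, ∀ x ∉ W', δ ≤ dist w x) →
    ∃ φ : Eucl N → ℝ, ContDiff ℝ 1 φ ∧ HasCompactSupport φ ∧ tsupport φ ⊆ W' ∧ (∀ x, 0 ≤ φ x) ∧
      (∀ x, φ x ≤ 1) ∧ (∀ x ∈ W, φ x = 1) ∧ ∀ x, ‖fderiv ℝ φ x‖ ≤ K / δ := by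
  obtain ⟨K, hK⟩ : ∃ K : ℝ, ∀ t, |deriv Real.smoothTransition t| ≤ K := by
    have hC : ContDiff ℝ 1 Real.smoothTransition := Real.smoothTransition.contDiff
    obtain ⟨C, hC'⟩ := isCompact_Icc.exists_bound_of_continuousOn (s := Icc (-1 : ℝ) 2)
      (hC.continuous_deriv (by norm_num)).continuousOn
    refine ⟨max C 0, fun t => ?_⟩
    by_cases ht : t ∈ Icc (-1 : ℝ) 2
    · exact (hC' t ht).trans (le_max_left _ _)
    · refine le_trans (le_of_eq ?_) (le_max_right _ _)
      rw [abs_eq_zero]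
      rw [mem_Icc, not_and_or, not_le, not_le] at ht
      rcases ht with ht | ht
      · have : Real.smoothTransition =ᶠ[𝓝 t] fun _ => 0 := by
          filter_upwards [Iio_mem_nhds ht] with s hs
          exact Real.smoothTransition.zero_of_nonpos (by linarith [mem_Iio.1 hs])
        rw [this.deriv_eq, deriv_const]
      · have : Real.smoothTransition =ᶠ[𝓝 t] fun _ => 1 := by
          filter_upwards [Ioi_mem_nhds ht] with s hs
          exact Real.smoothTransition.one_of_one_le (by linarith [mem_Ioi.1 hs])
        rw [this.deriv_eq, deriv_const]
  have hK0 : 0 ≤ K := (abs_nonneg _).trans (hK 0)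
  refine ⟨⟨4 * K, by positivity⟩, fun N W W' δ hδ hW' hne hdist => ?_⟩
  obtain ⟨g, hgC, hg, hgd⟩ := exists_contDiff_approx_of_lipschitz
    (lipschitz_infDist_pt W'ᶜ) (show 0 < δ / 4 by positivity)
  -- As `g` is within `δ / 4` of the distance, `a ≥ 1` where the distance is at least `δ`, and `a >
  -- 0` forces it to be at least `δ / 4`.
  let a : Eucl N → ℝ := fun x => 4 / δ * g x - 2
  have haC : ContDiff ℝ 1 a := (contDiff_const.mul hgC).sub contDiff_const
  have hsC : ContDiff ℝ 1 Real.smoothTransition := Real.smoothTransition.contDiff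
  have hpos : ∀ x, Real.smoothTransition (a x) ≠ 0 → δ / 4 ≤ infDist x W'ᶜ := by
    intro x hx
    have h1 : 0 < a x := by
      by_contra h
      exact hx (Real.smoothTransition.zero_of_nonpos (not_lt.1 h))
    have h2 : δ / 2 < g x := by
      have : 0 < 4 / δ * g x - 2 := h1
      have h3 : 4 / δ * g x = 4 * g x / δ := by ring
      rw [h3, sub_pos, lt_div_iff₀ hδ] at this
      linarith
    linarith [(abs_le.1 (hg x)).2]
  have hclosed : IsClosed {x | δ / 4 ≤ infDist x W'ᶜ} :=
    isClosed_le continuous_const (continuous_infDist_pt _)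
  have hsub : {x | δ / 4 ≤ infDist x W'ᶜ} ⊆ W' := by
    intro x hx
    by_contra h
    have : infDist x W'ᶜ = 0 := infDist_zero_of_mem h
    rw [mem_ofPred_eq, this] at hx
    linarith
  have hts : tsupport (fun x => Real.smoothTransition (a x)) ⊆ {x | δ / 4 ≤ infDist x W'ᶜ} :=
    closure_minimal hpos hclosed
  refine ⟨fun x => Real.smoothTransition (a x), hsC.comp haC,
    hW'.of_isClosed_subset (isClosed_tsupport _) ((hts.trans hsub).trans subset_closure),
    hts.trans hsub, fun x => Real.smoothTransition.nonneg _,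
    fun x => Real.smoothTransition.le_one _, fun x hx => ?_, fun x => ?_⟩
  · refine Real.smoothTransition.one_of_one_le ?_
    have h1 : δ ≤ infDist x W'ᶜ := (le_infDist hne).2 fun y hy => hdist x hx y hy
    have h2 : 3 / 4 * δ ≤ g x := by linarith [(abs_le.1 (hg x)).1]
    have h3 : 4 / δ * (3 / 4 * δ) ≤ 4 / δ * g x := by gcongr
    have h4 : 4 / δ * (3 / 4 * δ) = 3 := by field_simp
    show 1 ≤ 4 / δ * g x - 2
    linarith
  · have h1 : HasFDerivAt a ((4 / δ) • fderiv ℝ g x) x :=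
      (((hgC.differentiable (by norm_num) x).hasFDerivAt).const_mul (4 / δ)).sub_const 2
    have h2 := ((hsC.differentiable (by norm_num) (a x)).hasDerivAt).comp_hasFDerivAt x h1
    have h3 : HasFDerivAt (fun x => Real.smoothTransition (a x)) _ x := h2
    rw [h3.fderiv, norm_smul, norm_smul, Real.norm_eq_abs,
      Real.norm_of_nonneg (by positivity : 0 ≤ 4 / δ)]
    calc |deriv Real.smoothTransition (a x)| * (4 / δ * ‖fderiv ℝ g x‖) ≤ K * (4 / δ * 1) := by
          gcongr
          · exact hK _
          · exact hgd x
      _ = 4 * K / δ := by ring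

end Cutoff

/-! ### Comparison of the regularity scales -/

section Scales

variable {N : ℕ} {S : Set (Eucl N)} {νS : Eucl N → Eucl N}

lemma IsGraphAtScale.mono {k l : ℕ} (hkl : k ≤ l) {x ω : Eucl N} {r : ℝ}
    (h : IsGraphAtScale l S x ω r) : IsGraphAtScale k S x ω r := by
  obtain ⟨D, u, hD, hDr, hu, hS, hsum⟩ := h
  refine ⟨D, u, hD, hDr, hu.of_le (by exact_mod_cast hkl), hS, le_trans ?_ hsum⟩
  exact Finset.sum_le_sum_of_subset (Finset.range_mono (by omega))

lemma regScaleAt_anti {k l : ℕ} (hkl : k ≤ l) (x : Eucl N) : regScaleAt l S x ≤ regScaleAt k S x :=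
  iSup₂_le fun r hr => iSup_le fun ⟨ω, hω, h⟩ =>
    le_iSup₂_of_le r hr (le_iSup_of_le ⟨ω, hω, h.mono hkl⟩ le_rfl)

lemma reflScale_le_regScale (c₀ : ℝ) : reflScale c₀ S νS ≤ regScale 2 S := by
  refine iInf₂_mono fun x _ => iSup₂_le fun r hr => ?_
  obtain ⟨-, ρ, u, Ψ, hrρ, hρ, -⟩ := hr
  exact (ENNReal.ofReal_le_ofReal hrρ).trans (hρ.trans (regScaleAt_anti (by norm_num) x))

end Scales

/-! ### Bound of the total variation -/

namespace Varifold

variable {n N : ℕ} {U W : Set (Eucl N)} {X : Eucl N → Eucl N} {V : Varifold n N U}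

lemma firstVar_zero : V.firstVar (fun _ => 0) = 0 := by
  rw [firstVar]
  refine (integral_congr_ae (Eventually.of_forall fun p => ?_)).trans (integral_zero _ _)
  refine divPlane_eq_zero_of_notMem fun h => ?_
  have : tsupport (fun _ : Eucl N => (0 : Eucl N)) = ∅ := tsupport_eq_empty_iff.2 rfl
  rw [this] at h
  exact h

lemma totalVar_empty : V.totalVar ∅ = 0 := by
  refine le_antisymm (iSup₂_le fun Y hY => iSup_le fun _ => ?_) zero_le
  have : Y = fun _ => 0 := tsupport_eq_empty_iff.1 (subset_empty_iff.1 hY.2.2)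
  rw [this, firstVar_zero]
  simp

lemma abs_firstVar_le_totalVar (hWU : W ⊆ U) (hW : V.totalVar W ≠ ∞) (hX : IsC1c W X) {b : ℝ}
    (hb : 0 < b) (hXb : ∀ x, ‖X x‖ ≤ b) : |V.firstVar X| ≤ (V.totalVar W).toReal * b := by
  have key : ∀ c : ℝ, |c| = b⁻¹ → c * V.firstVar X ≤ (V.totalVar W).toReal := by
    intro c hc
    rw [← V.firstVar_const_smul c (hX.mono hWU)]
    refine (ENNReal.ofReal_le_iff_le_toReal hW).1 ?_
    refine le_iSup₂_of_le _ (hX.const_smul c) (le_iSup_of_le (fun x => ?_) le_rfl)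
    rw [norm_smul, Real.norm_eq_abs, hc, inv_mul_le_iff₀ hb, mul_one]
    exact hXb x
  have h1 := key b⁻¹ (abs_of_pos (inv_pos.2 hb))
  have h2 := key (-b⁻¹) (by rw [abs_neg, abs_of_pos (inv_pos.2 hb)])
  have h3 : b * b⁻¹ = 1 := mul_inv_cancel₀ hb.ne'
  have h4 : V.firstVar X = b * (b⁻¹ * V.firstVar X) := by rw [← mul_assoc, h3, one_mul]
  rw [abs_le]
  constructor <;> rw [h4] <;> nlinarith

lemma locallyFiniteFirstVar_of_totalVar_ne_top
    (h : ∀ W : Set (Eucl N), IsOpen W → IsCompact (closure W) → closure W ⊆ U →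
      V.totalVar W ≠ ∞) : V.LocallyFiniteFirstVar := by
  intro W hWo hWc hWU
  refine ⟨(V.totalVar W).toReal, fun X b hX hXb => ?_⟩
  rcases lt_trichotomy b 0 with hb | rfl | hb
  · exact absurd ((norm_nonneg _).trans (hXb 0)) (not_le.2 hb)
  · have : X = fun _ => 0 := funext fun x => norm_le_zero_iff.1 (hXb x)
    rw [this, firstVar_zero]; simp
  · exact abs_firstVar_le_totalVar (subset_closure.trans hWU) (h W hWo hWc hWU) hX hb hXb

end Varifold

/-! ### Distance to the frontier of a neighbourhood -/

section SetDist

variable {N : ℕ} {W W' : Set (Eucl N)}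

lemma setDist_frontier_pos (hWo : IsOpen W') (hWW' : closure W ⊆ W')
    (hW' : IsCompact (closure W')) : 0 < setDist W (frontier W') := by
  have hWc : IsCompact (closure W) :=
    hW'.of_isClosed_subset isClosed_closure (hWW'.trans subset_closure)
  have hdisj : Disjoint (closure W) (frontier W') :=
    (disjoint_frontier_iff_isOpen.2 hWo).symm.mono_left hWW'
  obtain ⟨r, hr, hlt⟩ := exists_pos_forall_lt_edist hWc isClosed_frontier hdisj
  refine lt_of_lt_of_le (ENNReal.coe_pos.2 hr) (le_iInf₂ fun w hw => le_infEDist.2 fun y hy => ?_)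
  exact (hlt w (subset_closure hw) y hy).le

/-- The segment from `w` to `x` is connected, so it meets the frontier of `W'`. This lets the
distance to the frontier serve as distance to the complement in the cutoff. -/
lemma setDist_frontier_le (hWo : IsOpen W') (hWW' : W ⊆ W') {w x : Eucl N} (hw : w ∈ W) (hx : x ∉ W') :
    setDist W (frontier W') ≤ edist w x := by
  obtain ⟨q, hq, hqf⟩ : (segment ℝ w x ∩ frontier W').Nonempty := by
    by_contra hempty
    have hmiss : ∀ q ∈ segment ℝ w x, q ∈ closure W' → q ∈ W' := fun q hq hqc => by
      by_contra hqW
      exact hempty ⟨q, hq, hqc, fun h => hqW (interior_subset h)⟩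
    obtain ⟨q, -, hq1, hq2⟩ := (convex_segment w x).isPreconnected W' (closure W')ᶜ hWo
      isClosed_closure.isOpen_compl
      (fun q hq => (em (q ∈ closure W')).imp (hmiss q hq) id)
      ⟨w, left_mem_segment ℝ w x, hWW' hw⟩
      ⟨x, right_mem_segment ℝ w x, fun h => hx (hmiss x (right_mem_segment ℝ w x) h)⟩
    exact hq2 (subset_closure hq1)
  have h1 : dist w q ≤ dist w x := by
    have := dist_add_dist_of_mem_segment hq
    linarith [dist_nonneg (x := q) (y := x)]
  calc setDist W (frontier W') ≤ infEDist w (frontier W') := iInf₂_le w hw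
    _ ≤ edist w q := infEDist_le_edist_of_mem hqf
    _ ≤ edist w x := by rw [edist_dist, edist_dist]; exact ENNReal.ofReal_le_ofReal h1

end SetDist

theorem exists_totalVar_bound (n : ℕ) : ∃ c : ℝ≥0, ∀ (N : ℕ) (S : Set (Eucl N))
    (νS : Eucl N → Eucl N) (U : Set (Eucl N)) (V : Varifold n N U), n < N →
    IsOrientedHypersurface S νS → 0 < regScale 2 S → V.IsIntegral →
    ∀ H : Eucl N → Eucl N, V.IsFreeBdryCurvature S νS H →
    ∀ W W' : Set (Eucl N), IsOpen W' → closure W ⊆ W' →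
      IsCompact (closure W') → closure W' ⊆ U →
      V.totalVar W ≤ c * (∫⁻ x in W', ‖tangentialPart S νS H x‖ₑ ∂V.mass)
        + c * ((regScale 2 S)⁻¹ + (setDist W (frontier W'))⁻¹) * V.mass W' := by
  obtain ⟨κ, K, hκ, hκ0, hκn, hκ1, hκs, hκd⟩ := exists_lineCutoff
  obtain ⟨K₁, hK₁⟩ := exists_cutoff_constant
  -- With `ρ = r / 4` the cutoff estimate has coefficient `(8K + 12n) / r + 2K₁ / D` for the mass
  -- and `4` for the curvature.
  refine ⟨4 + 8 * K + 12 * n + 2 * K₁, ?_⟩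
  intro N S νS U V hnN hS hreg hV H hH W W' hWo hWW' hW'c hW'U
  set c : ℝ≥0 := 4 + 8 * K + 12 * n + 2 * K₁ with hc
  rcases W.eq_empty_or_nonempty with rfl | ⟨w₀, hw₀⟩
  · rw [Varifold.totalVar_empty]; exact zero_le
  have hWW : W ⊆ W' := subset_closure.trans hWW'
  have hne : W'ᶜ.Nonempty := by
    rw [nonempty_compl]
    rintro rfl
    have : Nonempty (Fin N) := ⟨⟨0, by omega⟩⟩
    have : NoncompactSpace (Eucl N) := NormedSpace.noncompactSpace ℝ (Eucl N)
    rw [closure_univ] at hW'c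
    exact noncompact_univ (Eucl N) hW'c
  obtain ⟨x₀, hx₀⟩ := hne
  set D := setDist W (frontier W') with hD
  have hD0 : 0 < D := setDist_frontier_pos hWo hWW' hW'c
  have hDtop : D ≠ ∞ := ne_top_of_le_ne_top (edist_ne_top _ _) (setDist_frontier_le hWo hWW hw₀ hx₀)
  have hδ : 0 < D.toReal := ENNReal.toReal_pos hD0.ne' hDtop
  obtain ⟨φ, hφ, hφc, hφW, hφ0, hφ1, hφ1W, hφM⟩ := hK₁ N W W' D.toReal hδ hW'c ⟨x₀, hx₀⟩
    (fun w hw x hx => by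
      rw [dist_edist]
      exact ENNReal.toReal_mono (edist_ne_top _ _) (setDist_frontier_le hWo hWW hw hx))
  have hμ : V.mass W' ≠ ∞ := ((measure_mono subset_closure).trans_lt
    (V.mass_lt_top hW'c hW'U)).ne
  have hI : ENNReal.ofReal (∫ x in W', ‖tangentialPart S νS H x‖ ∂V.mass) =
      ∫⁻ x in W', ‖tangentialPart S νS H x‖ₑ ∂V.mass :=
    ofReal_integral_norm_eq_lintegral_enorm (hH.integrableOn hW'c hW'U)
  have hI0 : 0 ≤ ∫ x in W', ‖tangentialPart S νS H x‖ ∂V.mass :=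
    integral_nonneg fun _ => norm_nonneg _
  have hscale : ∀ a : ℝ≥0∞, 0 < a → a < regScale 2 S → V.totalVar W ≤
      c * (∫⁻ x in W', ‖tangentialPart S νS H x‖ₑ ∂V.mass) + c * (a⁻¹ + D⁻¹) * V.mass W' := by
    intro a ha haR
    have hatop : a ≠ ∞ := haR.ne_top
    have hr : 0 < a.toReal := ENNReal.toReal_pos ha.ne' hatop
    obtain ⟨T, d, ν, hT⟩ := exists_isExtendedTube hS hr (by rwa [ENNReal.ofReal_toReal hatop])
    refine iSup₂_le fun Y hY => iSup_le fun hY1 => ?_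
    have hest := hH.abs_firstVar_le_of_cutoff hV hS.1 hT hWo hW'c hW'U hκ hκ0 hκn hκ1 hκs hκd
      hφ hφc hφW hφ0 hφ1 hφM (hY.mono hWW) (fun x => by
        by_cases hx : x ∈ W
        · rw [hφ1W x hx]; exact hY1 x
        · rw [hY.eq_zero hx, norm_zero]; exact hφ0 x)
    have hreal : V.firstVar Y ≤ c * (∫ x in W', ‖tangentialPart S νS H x‖ ∂V.mass) +
        c * (a.toReal⁻¹ + D.toReal⁻¹) * V.mass.real W' := by
      refine (le_abs_self _).trans (hest.trans (add_le_add ?_ ?_))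
      · refine mul_le_mul_of_nonneg_right ?_ hI0
        rw [hc]; push_cast
        have h1 : (0 : ℝ) ≤ K := K.2
        have h2 : (0 : ℝ) ≤ K₁ := K₁.2
        have h3 : (0 : ℝ) ≤ n := Nat.cast_nonneg n
        linarith
      · refine mul_le_mul_of_nonneg_right ?_ measureReal_nonneg
        have h1 : (0 : ℝ) ≤ K := K.2
        have h2 : (0 : ℝ) ≤ K₁ := K₁.2
        have h3 : (0 : ℝ) ≤ n := Nat.cast_nonneg n
        have e : 2 * (K / (a.toReal / 4) + K₁ / D.toReal + n / (a.toReal / 4)) +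
            n / (a.toReal / 4) = (8 * K + 12 * n) * a.toReal⁻¹ + 2 * K₁ * D.toReal⁻¹ := by
          field_simp; ring
        rw [e, mul_add]
        have h4 : (8 * K + 12 * n : ℝ) ≤ c := by rw [hc]; push_cast; linarith
        have h5 : (2 * K₁ : ℝ) ≤ c := by rw [hc]; push_cast; linarith
        have h6 := inv_nonneg.2 hr.le
        have h7 := inv_nonneg.2 hδ.le
        gcongr
    refine (ENNReal.ofReal_le_ofReal hreal).trans (le_of_eq ?_)
    rw [ENNReal.ofReal_add (by positivity) (by positivity), ENNReal.ofReal_mul (NNReal.coe_nonneg c),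
      ENNReal.ofReal_mul (by positivity), ENNReal.ofReal_mul (NNReal.coe_nonneg c), hI,
      ENNReal.ofReal_add (by positivity) (by positivity), ENNReal.ofReal_inv_of_pos hr,
      ENNReal.ofReal_inv_of_pos hδ, ENNReal.ofReal_toReal hatop, ENNReal.ofReal_toReal hDtop,
      ofReal_measureReal hμ]
    simp only [ENNReal.ofReal_coe_nnreal]
  -- Tubes exist only for radii strictly below the scale, which may be infinite or unattained; the
  -- bound passes to the limit.
  have hbot : (𝓝[<] regScale 2 S).NeBot := nhdsLT_neBot_of_exists_lt ⟨0, hreg⟩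
  have hlim : Tendsto (fun a : ℝ≥0∞ => c * (∫⁻ x in W', ‖tangentialPart S νS H x‖ₑ ∂V.mass) +
      c * (a⁻¹ + D⁻¹) * V.mass W') (𝓝[<] regScale 2 S)
      (𝓝 (c * (∫⁻ x in W', ‖tangentialPart S νS H x‖ₑ ∂V.mass) +
        c * ((regScale 2 S)⁻¹ + D⁻¹) * V.mass W')) := by
    have h1 : Tendsto (fun a : ℝ≥0∞ => a⁻¹ + D⁻¹) (𝓝[<] regScale 2 S)
        (𝓝 ((regScale 2 S)⁻¹ + D⁻¹)) :=
      ((continuous_inv.tendsto _).mono_left nhdsWithin_le_nhds).add_const _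
    exact (ENNReal.Tendsto.mul_const (ENNReal.Tendsto.const_mul h1 (Or.inr ENNReal.coe_ne_top))
      (Or.inr hμ)).const_add _
  refine ge_of_tendsto hlim ?_
  filter_upwards [Ioo_mem_nhdsLT hreg] with a ha using hscale a ha.1 ha.2

lemma Varifold.HasFreeBdry.locallyFiniteFirstVar {n N : ℕ} {S U : Set (Eucl N)}
    {νS : Eucl N → Eucl N} {V : Varifold n N U} (h : V.HasFreeBdry S νS) (hnN : n < N)
    (hS : IsOrientedHypersurface S νS) (hreg : 0 < regScale 2 S) (hU : IsOpen U)
    (hV : V.IsIntegral) : V.LocallyFiniteFirstVar := by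
  obtain ⟨H, hH⟩ := h
  obtain ⟨c, hc⟩ := exists_totalVar_bound n
  refine V.locallyFiniteFirstVar_of_totalVar_ne_top fun W hWo hWc hWU => ?_
  obtain ⟨W', hW'o, hWW', hW'U, hW'c⟩ :=
    exists_open_between_and_isCompact_closure hWc hU hWU
  have hμ : V.mass W' ≠ ∞ := ((measure_mono subset_closure).trans_lt
    (V.mass_lt_top hW'c hW'U)).ne
  refine ne_top_of_le_ne_top ?_ (hc N S νS U V hnN hS hreg hV H hH W W' hW'o hWW' hW'c hW'U)
  refine ENNReal.add_ne_top.2 ⟨ENNReal.mul_ne_top ENNReal.coe_ne_top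
    (hH.integrableOn hW'c hW'U).2.ne, ENNReal.mul_ne_top (ENNReal.mul_ne_top ENNReal.coe_ne_top
      (ENNReal.add_ne_top.2 ⟨ENNReal.inv_ne_top.2 hreg.ne', ENNReal.inv_ne_top.2
        (setDist_frontier_pos hW'o hWW' hW'c).ne'⟩)) hμ⟩

/-! ### Riesz representation of locally bounded functionals on test functions -/

section WeakLimit

open CompactlySupported

variable {X : Type*} [TopologicalSpace X] [T2Space X] [LocallyCompactSpace X] [MeasurableSpace X]
  [BorelSpace X]

/-- Weak compactness for weighted sums of Dirac masses, along an ultrafilter. -/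
lemma exists_measure_tendsto_tsum (w : ℕ → X → ℝ≥0∞)
    (hw : ∀ K : Set X, IsCompact K → ∃ C : ℝ≥0, ∀ᶠ k in atTop, ∑' x, K.indicator (w k) x ≤ C) :
    ∃ m : Measure X, IsFiniteMeasureOnCompacts m ∧ ∀ f : C_c(X, ℝ≥0),
      Tendsto (fun k => ∑' x, (f x : ℝ≥0∞) * w k x) (hyperfilter ℕ) (𝓝 (∫⁻ x, f x ∂m)) := by
  have hlim : ∀ f : C_c(X, ℝ≥0), ∃ l : ℝ≥0,
      Tendsto (fun k => ∑' x, (f x : ℝ≥0∞) * w k x) (hyperfilter ℕ) (𝓝 l) := by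
    intro f
    -- Along an ultrafilter every sequence in the compact space `ℝ≥0∞` converges, which replaces a
    -- diagonal choice of subsequences and makes linearity of the limit automatic.
    obtain ⟨l, hl⟩ : ∃ l : ℝ≥0∞, Tendsto (fun k => ∑' x, (f x : ℝ≥0∞) * w k x) (hyperfilter ℕ)
        (𝓝 l) := ⟨_, Ultrafilter.le_nhds_lim
          ((hyperfilter ℕ).map fun k => ∑' x, (f x : ℝ≥0∞) * w k x)⟩
    obtain ⟨C, hC⟩ := hw (tsupport f) f.hasCompactSupport
    obtain ⟨B, hB⟩ := f.hasCompactSupport.isCompact.exists_bound_of_continuousOn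
      (f := fun x => (f x : ℝ)) (NNReal.continuous_coe.comp f.continuous).continuousOn
    have hle : l ≤ B.toNNReal * C := by
      refine le_of_tendsto hl ?_
      filter_upwards [Nat.hyperfilter_le_atTop hC] with k hk
      calc ∑' x, (f x : ℝ≥0∞) * w k x
          ≤ ∑' x, (B.toNNReal : ℝ≥0∞) * (tsupport f).indicator (w k) x := by
            refine ENNReal.tsum_le_tsum fun x => ?_
            by_cases hx : x ∈ tsupport f
            · rw [indicator_of_mem hx]
              gcongr
              have := hB x hx
              rw [Real.norm_of_nonneg (NNReal.coe_nonneg _)] at this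
              exact NNReal.le_toNNReal_of_coe_le this
            · rw [image_eq_zero_of_notMem_tsupport hx]; simp
        _ = B.toNNReal * ∑' x, (tsupport f).indicator (w k) x := ENNReal.tsum_mul_left
        _ ≤ B.toNNReal * C := by gcongr
    lift l to ℝ≥0 using ne_top_of_le_ne_top (by finiteness) hle
    exact ⟨l, hl⟩
  choose l hl using hlim
  let Λ : C_c(X, ℝ≥0) →ₗ[ℝ≥0] ℝ≥0 :=
    { toFun := l
      map_add' := fun f g => by
        refine ENNReal.coe_injective (tendsto_nhds_unique (hl (f + g)) ?_)
        rw [ENNReal.coe_add]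
        refine ((hl f).add (hl g)).congr fun k => ?_
        rw [← ENNReal.tsum_add]
        exact tsum_congr fun x => by
          rw [CompactlySupportedContinuousMap.add_apply, ENNReal.coe_add, add_mul]
      map_smul' := fun c f => by
        refine ENNReal.coe_injective (tendsto_nhds_unique (hl (c • f)) ?_)
        rw [RingHom.id_apply, smul_eq_mul, ENNReal.coe_mul]
        refine (ENNReal.Tendsto.const_mul (hl f) (Or.inr ENNReal.coe_ne_top)).congr fun k => ?_
        rw [← ENNReal.tsum_mul_left]
        exact tsum_congr fun x => by
          rw [CompactlySupportedContinuousMap.smul_apply, smul_eq_mul, ENNReal.coe_mul, mul_assoc] }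
  refine ⟨NNRealRMK.rieszMeasure Λ, inferInstance, fun f => ?_⟩
  rw [NNRealRMK.lintegral_rieszMeasure]
  exact hl f

end WeakLimit

/-- `f ∈ C¹_c(U)`. -/
def IsTest {N : ℕ} (U : Set (Eucl N)) (f : Eucl N → ℝ) : Prop :=
  ContDiff ℝ 1 f ∧ HasCompactSupport f ∧ tsupport f ⊆ U

namespace IsTest

variable {N : ℕ} {U : Set (Eucl N)} {f g : Eucl N → ℝ}

lemma add (hf : IsTest U f) (hg : IsTest U g) : IsTest U (fun x => f x + g x) :=
  ⟨hf.1.add hg.1, hf.2.1.add hg.2.1,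
    (tsupport_add f g).trans (union_subset hf.2.2 hg.2.2)⟩

lemma const_mul (c : ℝ) (hf : IsTest U f) : IsTest U (fun x => c * f x) :=
  ⟨contDiff_const.mul hf.1, hf.2.1.mul_left,
    (tsupport_mul_subset_right (f := fun _ => c)).trans hf.2.2⟩

lemma isC1c_smul (hf : IsTest U f) (e : Eucl N) : IsC1c U (fun x => f x • e) :=
  ⟨hf.1.smul contDiff_const, hf.2.1.smul_right,
    (tsupport_smul_subset_left f fun _ => e).trans hf.2.2⟩

lemma zero : IsTest U (fun _ => 0) :=
  ⟨contDiff_const, HasCompactSupport.zero, by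
    have : tsupport (fun _ : Eucl N => (0 : ℝ)) = ∅ := tsupport_eq_empty_iff.2 rfl
    rw [this]; exact empty_subset _⟩

end IsTest

lemma exists_isTest_eq_one {N : ℕ} {U K : Set (Eucl N)} (hU : IsOpen U) (hK : IsCompact K)
    (hKU : K ⊆ U) : ∃ χ : Eucl N → ℝ, IsTest U χ ∧ (∀ x ∈ K, χ x = 1) ∧ ∀ x, χ x ∈ Icc (0 : ℝ) 1 := by
  obtain ⟨W, hWo, hKW, hWU, hWc⟩ := exists_open_between_and_isCompact_closure hK hU hKU
  obtain ⟨χ, h0, h1, h01⟩ := exists_contMDiffMap_zero_one_of_isClosed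
    (modelWithCornersSelf ℝ (Eucl N)) (n := 1) hWo.isClosed_compl hK.isClosed
    (disjoint_left.2 fun x hx hxK => hx (hKW hxK))
  have hsub : tsupport χ ⊆ closure W := closure_mono fun x hx => by
    by_contra hxW
    exact hx (h0 hxW)
  exact ⟨χ, ⟨χ.contMDiff.contDiff, hWc.of_isClosed_subset isClosed_closure hsub, hsub.trans hWU⟩,
    h1, h01⟩

/-- Each function is indexed by the centre of its ball, so `∑ f(x) χ_x` is close to `f` and a
functional can be replaced by point masses `L(χ_x)` at the centres. -/
lemma exists_fine_partition (N k : ℕ) : ∃ χ : Eucl N → Eucl N → ℝ,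
    (∀ x, ContDiff ℝ 1 (χ x)) ∧ (∀ x y, 0 ≤ χ x y) ∧
    (∀ x, tsupport (χ x) ⊆ ball x (1 / ((k : ℝ) + 1))) ∧
    (∀ (F : Finset (Eucl N)) (y : Eucl N), ∑ x ∈ F, χ x y ≤ 1) ∧
    (∀ K, IsCompact K → ∃ F : Finset (Eucl N), (∀ y ∈ K, ∑ x ∈ F, χ x y = 1) ∧
      ∀ x, ∀ y ∈ K, χ x y ≠ 0 → x ∈ F) := by
  obtain ⟨χ, hχ⟩ := SmoothPartitionOfUnity.exists_isSubordinate
    (modelWithCornersSelf ℝ (Eucl N)) (isClosed_univ (X := Eucl N))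
    (fun x => ball x (1 / ((k : ℝ) + 1))) (fun x => isOpen_ball)
    (fun x _ => mem_iUnion.2 ⟨x, mem_ball_self Nat.one_div_pos_of_nat⟩)
  refine ⟨fun x => χ x, fun x => (χ x).contMDiff.contDiff.of_le (by simp), fun x y => χ.nonneg x y,
    hχ, fun F y => ?_, fun K hK => ?_⟩
  · calc ∑ x ∈ F, χ x y ≤ ∑ x ∈ F ∪ χ.finsupport y, χ x y :=
        Finset.sum_le_sum_of_subset_of_nonneg Finset.subset_union_left fun x _ _ => χ.nonneg x y
      _ = 1 := χ.sum_finsupport' y (mem_univ y) Finset.subset_union_right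
  · have hfin := χ.locallyFinite.finite_nonempty_inter_compact hK
    have hmem : ∀ x, ∀ y ∈ K, χ x y ≠ 0 → x ∈ hfin.toFinset := fun x y hy hxy =>
      hfin.mem_toFinset.2 ⟨y, hxy, hy⟩
    refine ⟨hfin.toFinset, fun y hy => χ.sum_finsupport' y (mem_univ y) fun x hx => ?_, hmem⟩
    exact hmem x y hy ((χ.mem_finsupport y).1 hx)

section Riesz

variable {N : ℕ} {U : Set (Eucl N)}

/-- A linear functional on `C¹_c(U)` that is bounded on each compact set. -/
structure IsLocallyBoundedFunctional (U : Set (Eucl N)) (L : (Eucl N → ℝ) → ℝ) : Prop where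
  map_add : ∀ f g, IsTest U f → IsTest U g → L (fun x => f x + g x) = L f + L g
  map_mul : ∀ c f, IsTest U f → L (fun x => c * f x) = c * L f
  bound : ∀ K, IsCompact K → K ⊆ U → ∃ C : ℝ≥0, ∀ f b, IsTest U f → tsupport f ⊆ K →
    (∀ x, |f x| ≤ b) → |L f| ≤ C * b

namespace IsLocallyBoundedFunctional

variable {L : (Eucl N → ℝ) → ℝ}

lemma sum (hL : IsLocallyBoundedFunctional U L) (a : Eucl N → ℝ) (χ : Eucl N → Eucl N → ℝ)
    (F : Finset (Eucl N)) (hχ : ∀ x ∈ F, IsTest U (χ x)) :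
    IsTest U (fun y => ∑ x ∈ F, a x * χ x y) ∧
      L (fun y => ∑ x ∈ F, a x * χ x y) = ∑ x ∈ F, a x * L (χ x) := by
  classical
  induction F using Finset.induction_on with
  | empty =>
    have h := hL.map_mul 0 _ IsTest.zero
    simp only [zero_mul] at h
    simpa using ⟨IsTest.zero, h⟩
  | insert x F hx ih =>
    obtain ⟨h1, h2⟩ := ih fun z hz => hχ z (Finset.mem_insert_of_mem hz)
    have h3 := hχ x (Finset.mem_insert_self x F)
    simp only [Finset.sum_insert hx]
    exact ⟨(h3.const_mul _).add h1, by rw [hL.map_add _ _ (h3.const_mul _) h1, hL.map_mul _ _ h3, h2]⟩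

lemma map_sub (hL : IsLocallyBoundedFunctional U L) {f g : Eucl N → ℝ} (hf : IsTest U f)
    (hg : IsTest U g) : IsTest U (fun x => f x - g x) ∧ L (fun x => f x - g x) = L f - L g := by
  have e : (fun x => f x - g x) = fun x => f x + (-1) * g x := by ext x; ring
  rw [e]
  exact ⟨hf.add (hg.const_mul _), by rw [hL.map_add _ _ hf (hg.const_mul _), hL.map_mul _ _ hg]; ring⟩

/-- The measures are weak limits of the positive and negative parts of the point masses `L(χ_x)`.
Working directly with partitions of unity avoids extending `L` from `C¹_c` to continuous functions.
-/
lemma exists_measures_of_nonneg (hL : IsLocallyBoundedFunctional U L) (hU : IsOpen U) :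
    ∃ lp lm : Measure U, IsFiniteMeasureOnCompacts lp ∧ IsFiniteMeasureOnCompacts lm ∧
      ∀ f, IsTest U f → (∀ x, 0 ≤ f x) →
        L f = (∫⁻ x : U, ENNReal.ofReal (f x) ∂lp).toReal -
          (∫⁻ x : U, ENNReal.ofReal (f x) ∂lm).toReal := by
  have : LocallyCompactSpace U := hU.locallyCompactSpace
  choose χ hχs hχ0 hχb hχ1 hχK using exists_fine_partition N
  have hnear : ∀ K : Set (Eucl N), IsCompact K → K ⊆ U → ∃ K' : Set (Eucl N), IsCompact K' ∧
      K' ⊆ U ∧ K ⊆ K' ∧ ∀ᶠ k : ℕ in atTop, ∀ x ∈ K, tsupport (χ k x) ⊆ K' := by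
    intro K hK hKU
    obtain ⟨δ, hδ, hδU⟩ := hK.exists_cthickening_subset_open hU hKU
    refine ⟨cthickening δ K, hK.cthickening, hδU, self_subset_cthickening K, ?_⟩
    filter_upwards [tendsto_one_div_add_atTop_nhds_zero_nat.eventually_lt_const hδ] with k hk x hx
    exact ((hχb k x).trans (ball_subset_ball hk.le)).trans (((ball_subset_thickening hx δ)).trans
      (thickening_subset_cthickening δ K))
  have htest : ∀ (K' : Set (Eucl N)) k x, IsCompact K' → K' ⊆ U → tsupport (χ k x) ⊆ K' →
      IsTest U (χ k x) := fun K' k x hK' hK'U h =>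
    ⟨hχs k x, hK'.of_isClosed_subset isClosed_closure h, h.trans hK'U⟩
  have hsupp : ∀ (K' : Set (Eucl N)) (k : ℕ) (a : Eucl N → ℝ) (F : Finset (Eucl N)), IsClosed K' →
      (∀ x ∈ F, tsupport (χ k x) ⊆ K') → ∀ y ∉ K', ∑ x ∈ F, a x * χ k x y = 0 :=
    fun K' k a F _ hF y hy => Finset.sum_eq_zero fun x hx => by
      rw [image_eq_zero_of_notMem_tsupport fun h => hy (hF x hx h), mul_zero]
  have hmass : ∀ K : Set (Eucl N), IsCompact K → K ⊆ U → ∃ C : ℝ≥0, ∀ᶠ k in atTop,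
      ∀ F : Finset (Eucl N), ↑F ⊆ K → ∑ x ∈ F, |L (χ k x)| ≤ C := by
    intro K hK hKU
    obtain ⟨K', hK', hK'U, hKK', hev⟩ := hnear K hK hKU
    obtain ⟨C, hC⟩ := hL.bound K' hK' hK'U
    refine ⟨C, hev.mono fun k hk F hF => ?_⟩
    -- Testing with signs as coefficients, a function bounded by `1`, bounds the total mass `∑
    -- |L(χ_x)|`.
    obtain ⟨h1, h2⟩ := hL.sum (fun x => SignType.sign (L (χ k x))) (χ k) F
      fun x hx => htest K' k x hK' hK'U (hk x (hF hx))
    have h3 := hC _ 1 h1 (closure_minimal (fun y hy => by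
      by_contra hyK
      exact hy (hsupp K' k _ F hK'.isClosed (fun x hx => hk x (hF hx)) y hyK)) hK'.isClosed)
      (fun y => (Finset.abs_sum_le_sum_abs _ _).trans ((Finset.sum_le_sum fun x _ => ?_).trans
        (hχ1 k F y)))
    · rw [h2] at h3
      simp only [sign_mul_self] at h3
      rw [mul_one] at h3
      exact (le_abs_self _).trans h3
    · rw [abs_mul, abs_of_nonneg (hχ0 k x y)]
      refine mul_le_of_le_one_left (hχ0 k x y) ?_
      rcases SignType.sign (L (χ k x)) with _ | _ | _ <;> simp
  have hweight : ∀ s : ℝ, |s| = 1 → ∀ K : Set U, IsCompact K → ∃ C : ℝ≥0, ∀ᶠ k in atTop,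
      ∑' x, K.indicator (fun x : U => ENNReal.ofReal (s * L (χ k x))) x ≤ C := by
    intro s hs K hK
    obtain ⟨C, hC⟩ := hmass _ (hK.image continuous_subtype_val) (by rintro _ ⟨x, -, rfl⟩; exact x.2)
    refine ⟨C, hC.mono fun k hk => ?_⟩
    classical
    rw [ENNReal.tsum_eq_iSup_sum]
    refine iSup_le fun F => ?_
    calc ∑ x ∈ F, K.indicator (fun x : U => ENNReal.ofReal (s * L (χ k x))) x
        ≤ ∑ x ∈ F with x ∈ K, ENNReal.ofReal |L (χ k x)| := by
          rw [Finset.sum_filter]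
          refine Finset.sum_le_sum fun x _ => ?_
          by_cases hx : x ∈ K
          · rw [indicator_of_mem hx, if_pos hx]
            refine ENNReal.ofReal_le_ofReal ((le_abs_self _).trans ?_)
            rw [abs_mul, hs, one_mul]
          · rw [indicator_of_notMem hx, if_neg hx]
      _ = ENNReal.ofReal (∑ x ∈ F with x ∈ K, |L (χ k x)|) :=
          (ENNReal.ofReal_sum_of_nonneg fun _ _ => abs_nonneg _).symm
      _ = ENNReal.ofReal (∑ x ∈ (F.filter (· ∈ K)).image Subtype.val, |L (χ k x)|) := by
          rw [Finset.sum_image fun x _ y _ h => Subtype.ext h]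
      _ ≤ C := by
          rw [← ENNReal.ofReal_coe_nnreal]
          refine ENNReal.ofReal_le_ofReal (hk _ ?_)
          intro y hy
          obtain ⟨x, hx, rfl⟩ := Finset.mem_image.1 hy
          exact ⟨x, (Finset.mem_filter.1 hx).2, rfl⟩
  obtain ⟨lp, hlp, hp⟩ := exists_measure_tendsto_tsum
    (fun k (x : U) => ENNReal.ofReal (1 * L (χ k x))) (hweight 1 (by simp))
  obtain ⟨lm, hlm, hm⟩ := exists_measure_tendsto_tsum
    (fun k (x : U) => ENNReal.ofReal (-1 * L (χ k x))) (hweight (-1) (by simp))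
  refine ⟨lp, lm, hlp, hlm, fun f hf hf0 => ?_⟩
  have hfc : HasCompactSupport fun x : U => (f x).toNNReal := by
    refine HasCompactSupport.intro (K := Subtype.val ⁻¹' tsupport f)
      (Topology.IsInducing.subtypeVal.isCompact_preimage' hf.2.1 ?_) fun x hx => ?_
    · simpa using hf.2.2
    · rw [image_eq_zero_of_notMem_tsupport hx, Real.toNNReal_zero]
  let φ : CompactlySupportedContinuousMap U ℝ≥0 :=
    ⟨⟨fun x => (f x).toNNReal, by have := hf.1.continuous; fun_prop⟩, hfc⟩
  have hφ : ∀ x : U, (φ x : ℝ≥0∞) = ENNReal.ofReal (f x) := fun x => rfl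
  have hpφ := hp φ
  have hmφ := hm φ
  simp only [hφ] at hpφ hmφ
  have hfin : ∀ l : Measure U, IsFiniteMeasureOnCompacts l →
      ∫⁻ x : U, ENNReal.ofReal (f x) ∂l ≠ ∞ := by
    intro l hl
    have : Integrable (fun x : U => ((φ x : ℝ≥0) : ℝ)) l :=
      (NNReal.continuous_coe.comp φ.continuous).integrable_of_hasCompactSupport
        (hfc.comp_left (g := ((↑) : ℝ≥0 → ℝ)) rfl)
    have h := this.lintegral_lt_top.ne
    simp only [ENNReal.ofReal_coe_nnreal, hφ] at h
    exact h
  have hdiff := ((ENNReal.tendsto_toReal (hfin lp hlp)).comp hpφ).sub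
    ((ENNReal.tendsto_toReal (hfin lm hlm)).comp hmφ)
  refine tendsto_nhds_unique ?_ hdiff
  obtain ⟨K', hK', hK'U, hKK', hev⟩ := hnear _ hf.2.1 hf.2.2
  obtain ⟨C, hC⟩ := hL.bound K' hK' hK'U
  have hf_unif : UniformContinuous f := hf.2.1.uniformContinuous_of_continuous hf.1.continuous
  refine Metric.tendsto_nhds.2 fun ε hε => ?_
  set η := ε / ((C : ℝ) + 1) with hη
  have hC0 : (0 : ℝ) ≤ C := C.2
  have hη0 : 0 < η := by positivity
  have hCη : C * η < ε := by
    rw [hη, mul_div_assoc', div_lt_iff₀ (by positivity)]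
    nlinarith
  obtain ⟨δ, hδ, hosc⟩ := Metric.uniformContinuous_iff.1 hf_unif η hη0
  refine Nat.hyperfilter_le_atTop ?_
  filter_upwards [hev, tendsto_one_div_add_atTop_nhds_zero_nat.eventually_lt_const hδ] with k hk hkδ
  obtain ⟨F₀, hF₀1, hF₀⟩ := hχK k K' hK'
  classical
  -- Only centres in the support of `f` matter, and for these `χ_x` is supported in `K'`, where `L`
  -- is bounded.
  set F := F₀.filter (· ∈ tsupport f) with hF
  have hFK : ∀ x ∈ F, tsupport (χ k x) ⊆ K' := fun x hx => hk x (Finset.mem_filter.1 hx).2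
  obtain ⟨h1, h2⟩ := hL.sum f (χ k) F fun x hx => htest K' k x hK' hK'U (hFK x hx)
  have hfF : ∀ y, ∑ x ∈ F, f x * χ k x y = ∑ x ∈ F₀, f x * χ k x y := fun y => by
    rw [hF, Finset.sum_filter_of_ne]
    intro x _ hx
    by_contra hxf
    exact hx (by rw [image_eq_zero_of_notMem_tsupport hxf, zero_mul])
  have hout : ∀ y ∉ K', f y - ∑ x ∈ F, f x * χ k x y = 0 := fun y hy => by
    rw [hsupp K' k f F hK'.isClosed hFK y hy,
      image_eq_zero_of_notMem_tsupport fun h => hy (hKK' h), sub_zero]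
  obtain ⟨h3, h4⟩ := hL.map_sub hf h1
  have h5 := hC _ η h3 (closure_minimal (fun y hy => by
    by_contra hyK
    exact hy (hout y hyK)) hK'.isClosed) (fun y => by
      by_cases hy : y ∈ K'
      · have e : f y - ∑ x ∈ F, f x * χ k x y = ∑ x ∈ F₀, (f y - f x) * χ k x y := by
          rw [hfF]
          simp only [sub_mul, Finset.sum_sub_distrib, ← Finset.mul_sum, hF₀1 y hy, mul_one]
        rw [e]
        calc |∑ x ∈ F₀, (f y - f x) * χ k x y| ≤ ∑ x ∈ F₀, |(f y - f x) * χ k x y| :=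
              Finset.abs_sum_le_sum_abs _ _
          _ ≤ ∑ x ∈ F₀, η * χ k x y := by
              refine Finset.sum_le_sum fun x _ => ?_
              rw [abs_mul, abs_of_nonneg (hχ0 k x y)]
              by_cases hxy : χ k x y = 0
              · simp [hxy]
              · have hyx : y ∈ ball x (1 / ((k : ℝ) + 1)) := hχb k x (subset_closure hxy)
                have := hosc ((mem_ball.1 hyx).trans hkδ)
                exact mul_le_mul_of_nonneg_right this.le (hχ0 k x y)
          _ = η := by rw [← Finset.mul_sum, hF₀1 y hy, mul_one]
      · rw [hout y hy, abs_zero]; exact hη0.le)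
  have hsum : ∀ s : ℝ, (∑' x : U, ENNReal.ofReal (f x) * ENNReal.ofReal (s * L (χ k x))).toReal =
      ∑ x ∈ F, f x * max (s * L (χ k x)) 0 := by
    intro s
    rw [tsum_subtype U fun x => ENNReal.ofReal (f x) * ENNReal.ofReal (s * L (χ k x)),
      tsum_eq_sum (s := F), ENNReal.toReal_sum]
    · refine Finset.sum_congr rfl fun x hx => ?_
      rw [indicator_of_mem (hf.2.2 (Finset.mem_filter.1 hx).2), ENNReal.toReal_mul,
        ENNReal.toReal_ofReal (hf0 x), ENNReal.toReal_ofReal']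
    · intro x hx
      rw [indicator_of_mem (hf.2.2 (Finset.mem_filter.1 hx).2)]
      finiteness
    · intro x hx
      -- Outside `F` either `f(x) = 0`, or `χ_x` vanishes identically because its support would lie
      -- in `K'`.
      refine indicator_apply_eq_zero.2 fun _ => ?_
      by_cases hxf : x ∈ tsupport f
      · have hχx : χ k x = fun _ => 0 := by
          by_contra hne
          obtain ⟨y, hy⟩ := Function.ne_iff.1 hne
          exact hx (Finset.mem_filter.2
            ⟨hF₀ x y (hk x hxf (subset_closure hy)) hy, hxf⟩)
        have h0 := hL.map_mul 0 _ IsTest.zero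
        simp only [zero_mul] at h0
        rw [hχx, h0]; simp
      · rw [image_eq_zero_of_notMem_tsupport hxf]; simp
  have hfinal : ∑ x ∈ F, f x * max (1 * L (χ k x)) 0 - ∑ x ∈ F, f x * max (-1 * L (χ k x)) 0 =
      ∑ x ∈ F, f x * L (χ k x) := by
    rw [← Finset.sum_sub_distrib]
    refine Finset.sum_congr rfl fun x _ => ?_
    rw [← mul_sub, one_mul, neg_one_mul, max_zero_sub_eq_self]
  rw [dist_comm, Real.dist_eq]
  refine lt_of_le_of_lt ?_ hCη
  simp only [Function.comp_apply]
  rw [hsum, hsum, hfinal, ← h2, ← h4]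
  exact h5

/-- The positive part of a `C¹` function need not be `C¹`; a test function is written instead as the
difference of the nonnegative test functions `f + Bχ` and `Bχ`. -/
lemma exists_measures (hL : IsLocallyBoundedFunctional U L) (hU : IsOpen U) :
    ∃ lp lm : Measure (Eucl N), lp Uᶜ = 0 ∧ lm Uᶜ = 0 ∧
      (∀ K, IsCompact K → K ⊆ U → lp K < ∞ ∧ lm K < ∞) ∧
      ∀ f, IsTest U f → L f = ∫ x, f x ∂lp - ∫ x, f x ∂lm := by
  obtain ⟨lp, lm, hlp, hlm, h⟩ := hL.exists_measures_of_nonneg hU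
  have hval : Measurable (Subtype.val : U → Eucl N) := measurable_subtype_coe
  have hzero : ∀ l : Measure U, l.map Subtype.val Uᶜ = 0 := fun l => by
    rw [Measure.map_apply hval hU.measurableSet.compl]
    convert measure_empty (μ := l)
    ext x; simp
  have hfin : ∀ l : Measure U, IsFiniteMeasureOnCompacts l → ∀ K, IsCompact K → K ⊆ U →
      l.map Subtype.val K < ∞ := fun l _ K hK hKU => by
    rw [Measure.map_apply hval hK.measurableSet]
    refine IsCompact.measure_lt_top (Topology.IsInducing.subtypeVal.isCompact_preimage_iff ?_ |>.2 hK)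
    simpa using hKU
  have hint : ∀ l : Measure U, IsFiniteMeasureOnCompacts l → ∀ f, IsTest U f →
      Integrable f (l.map Subtype.val) := by
    intro l hl f hf
    obtain ⟨B, hB⟩ := hf.2.1.exists_bound_of_continuous hf.1.continuous
    refine IntegrableOn.integrable_of_forall_notMem_eq_zero (s := tsupport f)
      (Measure.integrableOn_of_bounded (hfin l hl _ hf.2.1 hf.2.2).ne
        hf.1.continuous.aestronglyMeasurable (M := B) (Eventually.of_forall hB))
      fun x hx => image_eq_zero_of_notMem_tsupport hx
  have hpos : ∀ f, IsTest U f → (∀ x, 0 ≤ f x) →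
      L f = ∫ x, f x ∂(lp.map Subtype.val) - ∫ x, f x ∂(lm.map Subtype.val) := by
    intro f hf hf0
    have hm : Measurable fun x => ENNReal.ofReal (f x) :=
      ENNReal.measurable_ofReal.comp hf.1.continuous.measurable
    rw [h f hf hf0, integral_eq_lintegral_of_nonneg_ae (Eventually.of_forall hf0)
      hf.1.continuous.aestronglyMeasurable, integral_eq_lintegral_of_nonneg_ae
      (Eventually.of_forall hf0) hf.1.continuous.aestronglyMeasurable,
      lintegral_map hm hval, lintegral_map hm hval]
  refine ⟨lp.map Subtype.val, lm.map Subtype.val, hzero _, hzero _,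
    fun K hK hKU => ⟨hfin lp hlp K hK hKU, hfin lm hlm K hK hKU⟩, fun f hf => ?_⟩
  obtain ⟨χ, hχ, hχ1, hχ01⟩ := exists_isTest_eq_one hU hf.2.1 hf.2.2
  obtain ⟨B, hB⟩ := hf.2.1.exists_bound_of_continuous hf.1.continuous
  have hB0 : 0 ≤ B := (norm_nonneg _).trans (hB 0)
  have hBχ := hχ.const_mul B
  have h1 := hpos _ hBχ fun x => mul_nonneg hB0 (hχ01 x).1
  have h2 := hpos _ (hf.add hBχ) fun x => by
    by_cases hx : x ∈ tsupport f
    · rw [hχ1 x hx, mul_one]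
      have := (abs_le.1 (hB x)).1
      linarith
    · rw [image_eq_zero_of_notMem_tsupport hx, zero_add]
      exact mul_nonneg hB0 (hχ01 x).1
  rw [hL.map_add _ _ hf hBχ, integral_add (hint lp hlp f hf) (hint lp hlp _ hBχ),
    integral_add (hint lm hlm f hf) (hint lm hlm _ hBχ)] at h2
  linarith

end IsLocallyBoundedFunctional

end Riesz

/-! ### Existence of the generalized mean curvature, boundary measure and conormal -/

/-- `μ` is a Radon measure on the open set `U`, extended by zero. -/
structure IsRadonOn {N : ℕ} (U : Set (Eucl N)) (μ : Measure (Eucl N)) : Prop where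
  carried : μ Uᶜ = 0
  lt_top : ∀ K, IsCompact K → K ⊆ U → μ K < ∞

namespace IsRadonOn

variable {N : ℕ} {U : Set (Eucl N)} {μ μ' : Measure (Eucl N)}

lemma add (h : IsRadonOn U μ) (h' : IsRadonOn U μ') : IsRadonOn U (μ + μ') where
  carried := by rw [Measure.add_apply, h.1, h'.1, add_zero]
  lt_top K hK hKU := by
    rw [Measure.add_apply]; exact ENNReal.add_lt_top.2 ⟨h.2 K hK hKU, h'.2 K hK hKU⟩

lemma sum {ι : Type*} (s : Finset ι) {m : ι → Measure (Eucl N)} (h : ∀ i ∈ s, IsRadonOn U (m i)) :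
    IsRadonOn U (∑ i ∈ s, m i) where
  carried := by
    rw [Measure.finsetSum_apply]; exact Finset.sum_eq_zero fun i hi => (h i hi).1
  lt_top K hK hKU := by
    rw [Measure.finsetSum_apply]; exact ENNReal.sum_lt_top.2 fun i hi => (h i hi).2 K hK hKU

lemma mono (h : IsRadonOn U μ) (hle : μ' ≤ μ) : IsRadonOn U μ' where
  carried := le_antisymm ((hle _).trans h.1.le) zero_le
  lt_top K hK hKU := (hle _).trans_lt (h.2 K hK hKU)

lemma sigmaFinite (hU : IsOpen U) (h : IsRadonOn U μ) : SigmaFinite μ := by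
  have : LocallyCompactSpace U := hU.locallyCompactSpace
  obtain ⟨K, hK, hKU⟩ := isSigmaCompact_iff_sigmaCompactSpace.2 (inferInstance : SigmaCompactSpace U)
  refine Measure.sigmaFinite_of_countable (S := insert Uᶜ (range K)) ((countable_range K).insert _)
    ?_ ?_
  · rintro s (rfl | ⟨k, rfl⟩)
    · rw [h.1]; exact ENNReal.zero_lt_top
    · exact h.2 _ (hK k) (hKU ▸ subset_iUnion K k)
  · rw [sUnion_insert, sUnion_range, hKU, compl_union_self]

lemma integrable (h : IsRadonOn U μ) {F : Type*} [NormedAddCommGroup F] {f : Eucl N → F}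
    (hf : Continuous f) (hfc : HasCompactSupport f) (hfU : tsupport f ⊆ U) : Integrable f μ := by
  obtain ⟨B, hB⟩ := hfc.exists_bound_of_continuous hf
  exact IntegrableOn.integrable_of_forall_notMem_eq_zero (s := tsupport f)
    (Measure.integrableOn_of_bounded (h.2 _ hfc hfU).ne
      (hf.stronglyMeasurable_of_hasCompactSupport hfc).aestronglyMeasurable (M := B)
      (Eventually.of_forall hB))
    fun x hx => image_eq_zero_of_notMem_tsupport hx

lemma integrable_inner {k X : Eucl N → Eucl N}
    (hk : LocallyIntegrableOn k U μ) (hX : IsC1c U X) : Integrable (fun x => ⟪k x, X x⟫) μ := by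
  obtain ⟨B, hB⟩ := hX.2.1.exists_bound_of_continuous hX.1.continuous
  have hk' : IntegrableOn k (tsupport X) μ := hk.integrableOn_compact_subset hX.2.2 hX.2.1
  refine IntegrableOn.integrable_of_forall_notMem_eq_zero (s := tsupport X) ?_
    fun x hx => by rw [image_eq_zero_of_notMem_tsupport hx, inner_zero_right]
  refine Integrable.mono' (hk'.norm.mul_const B)
    (hk'.1.inner hX.1.continuous.aestronglyMeasurable) (Eventually.of_forall fun x => ?_)
  exact (norm_inner_le_norm _ _).trans (mul_le_mul_of_nonneg_left (hB x) (norm_nonneg _))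

end IsRadonOn

/-- Truncating the Radon–Nikodym derivative at `1` changes it only on a null set and makes the
bounds hold everywhere. -/
lemma exists_density_of_le {α : Type*} [MeasurableSpace α] {m l : Measure α} [SigmaFinite m]
    [SigmaFinite l] (h : m ≤ l) : ∃ p : α → ℝ, Measurable p ∧ (∀ x, p x ∈ Icc (0 : ℝ) 1) ∧
      ∀ f : α → ℝ, ∫ x, f x ∂m = ∫ x, p x * f x ∂l := by
  refine ⟨fun x => min (m.rnDeriv l x).toReal 1,
    (m.measurable_rnDeriv l).ennreal_toReal.min measurable_const,
    fun x => ⟨le_min ENNReal.toReal_nonneg zero_le_one, min_le_right _ _⟩, fun f => ?_⟩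
  rw [← integral_rnDeriv_smul h.absolutelyContinuous]
  refine integral_congr_ae ?_
  filter_upwards [Measure.rnDeriv_le_one_of_le h] with x hx
  have : (m.rnDeriv l x).toReal ≤ 1 := ENNReal.toReal_le_of_le_ofReal zero_le_one (by simpa using hx)
  rw [min_eq_left this, smul_eq_mul]

namespace Varifold

variable {n N : ℕ} {U : Set (Eucl N)} {V : Varifold n N U}

lemma isRadonOn_mass (hU : IsOpen U) : IsRadonOn U V.mass :=
  ⟨V.mass_compl hU, fun _ hK hKU => V.mass_lt_top hK hKU⟩

lemma LocallyFiniteFirstVar.isLocallyBoundedFunctional (h : V.LocallyFiniteFirstVar)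
    (hU : IsOpen U) {e : Eucl N} (he : ‖e‖ = 1) :
    IsLocallyBoundedFunctional U fun f => V.firstVar fun x => f x • e where
  map_add f g hf hg := by
    rw [← V.firstVar_add (hf.isC1c_smul e) (hg.isC1c_smul e)]; simp only [add_smul]
  map_mul c f hf := by
    rw [← V.firstVar_const_smul c (hf.isC1c_smul e)]; simp only [mul_smul]
  bound K hK hKU := by
    obtain ⟨W, hWo, hKW, hWU, hWc⟩ := exists_open_between_and_isCompact_closure hK hU hKU
    obtain ⟨C, hC⟩ := h W hWo hWc hWU
    refine ⟨C.toNNReal, fun f b hf hfK hfb => (hC _ b ?_ fun x => ?_).trans ?_⟩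
    · exact IsTest.isC1c_smul ⟨hf.1, hf.2.1, hfK.trans hKW⟩ e
    · rw [norm_smul, he, mul_one]; exact hfb x
    · exact mul_le_mul_of_nonneg_right (Real.le_coe_toNNReal C) ((abs_nonneg _).trans (hfb 0))

lemma firstVar_finset_sum {ι : Type*} (s : Finset ι) {X : ι → Eucl N → Eucl N}
    (hX : ∀ i ∈ s, IsC1c U (X i)) : IsC1c U (fun x => ∑ i ∈ s, X i x) ∧
      V.firstVar (fun x => ∑ i ∈ s, X i x) = ∑ i ∈ s, V.firstVar (X i) := by
  classical
  induction s using Finset.induction_on with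
  | empty => simpa using ⟨by simpa using (IsTest.zero (U := U)).isC1c_smul (0 : Eucl N), firstVar_zero⟩
  | insert i s hi ih =>
    obtain ⟨h1, h2⟩ := ih fun j hj => hX j (Finset.mem_insert_of_mem hj)
    have h3 := hX i (Finset.mem_insert_self i s)
    simp only [Finset.sum_insert hi]
    exact ⟨h3.add h1, by rw [V.firstVar_add h3 h1, h2]⟩

/-- Riesz representation of the first variation. -/
lemma LocallyFiniteFirstVar.exists_representation (h : V.LocallyFiniteFirstVar) (hU : IsOpen U) :
    ∃ (l : Measure (Eucl N)) (k : Eucl N → Eucl N) (B : ℝ≥0), IsRadonOn U l ∧ Measurable k ∧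
      (∀ x, ‖k x‖ ≤ B) ∧ ∀ X, IsC1c U X → V.firstVar X = ∫ x, ⟪X x, k x⟫ ∂l := by
  let e : Fin N → Eucl N := fun i => EuclideanSpace.single i 1
  have he : ∀ i, ‖e i‖ = 1 := fun i => by simp [e]
  choose lp lm hp hm hfin hrep using fun i => (h.isLocallyBoundedFunctional hU (he i)).exists_measures hU
  have hlp : ∀ i, IsRadonOn U (lp i) := fun i => ⟨hp i, fun K hK hKU => (hfin i K hK hKU).1⟩
  have hlm : ∀ i, IsRadonOn U (lm i) := fun i => ⟨hm i, fun K hK hKU => (hfin i K hK hKU).2⟩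
  -- A common dominating measure, so that all components have bounded densities with respect to it.
  let l : Measure (Eucl N) := ∑ i, (lp i + lm i)
  have hl : IsRadonOn U l := IsRadonOn.sum _ fun i _ => (hlp i).add (hlm i)
  have hle : ∀ i, lp i + lm i ≤ l := fun i =>
    Finset.single_le_sum (f := fun i => lp i + lm i) (fun _ _ => Measure.zero_le _)
      (Finset.mem_univ i)
  have := hl.sigmaFinite hU
  have := fun i => (hlp i).sigmaFinite hU
  have := fun i => (hlm i).sigmaFinite hU
  choose p hpm hp01 hpi using fun i =>
    exists_density_of_le (m := lp i) (l := l) ((Measure.le_add_right le_rfl).trans (hle i))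
  choose q hqm hq01 hqi using fun i =>
    exists_density_of_le (m := lm i) (l := l) ((Measure.le_add_left le_rfl).trans (hle i))
  refine ⟨l, fun x => ∑ i, (p i x - q i x) • e i, N, hl, ?_, fun x => ?_, fun X hX => ?_⟩
  · exact Finset.measurable_sum _ fun i _ => ((hpm i).sub (hqm i)).smul_const _
  · refine (norm_sum_le _ _).trans ((Finset.sum_le_sum (g := fun _ => (1 : ℝ)) fun i _ => ?_).trans
      (by simp))
    rw [norm_smul, he, mul_one, Real.norm_eq_abs, abs_le]
    constructor <;> linarith [(hp01 i x).1, (hp01 i x).2, (hq01 i x).1, (hq01 i x).2]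
  · have hXi : ∀ i, IsTest U fun x => X x i := fun i =>
      ⟨by have := hX.1; fun_prop, hX.2.1.comp_left (g := fun v : Eucl N => v i) rfl,
        (closure_mono (Function.support_comp_subset (g := fun v : Eucl N => v i) rfl X)).trans
          hX.2.2⟩
    have hXe : X = fun x => ∑ i, X x i • e i := by
      ext x j
      simp [e, Pi.single_apply]
    have hint : ∀ i (r : Eucl N → ℝ), Measurable r → (∀ x, r x ∈ Icc (0 : ℝ) 1) →
        Integrable (fun x => r x * X x i) l := fun i r hr hr01 =>
      (hl.integrable (hXi i).1.continuous (hXi i).2.1 (hXi i).2.2).bdd_mul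
        hr.aestronglyMeasurable (c := 1) (Eventually.of_forall fun x => by
          rw [Real.norm_eq_abs, abs_of_nonneg (hr01 x).1]; exact (hr01 x).2)
    calc V.firstVar X = ∑ i, V.firstVar (fun x => X x i • e i) := by
          conv_lhs => rw [hXe]
          exact (V.firstVar_finset_sum _ fun i _ => (hXi i).isC1c_smul (e i)).2
      _ = ∑ i, ∫ x, (p i x * X x i - q i x * X x i) ∂l := by
          refine Finset.sum_congr rfl fun i _ => ?_
          rw [hrep i _ (hXi i), hpi, hqi, integral_sub (hint i _ (hpm i) (hp01 i))
            (hint i _ (hqm i) (hq01 i))]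
      _ = ∫ x, ∑ i, (p i x * X x i - q i x * X x i) ∂l :=
          (integral_finsetSum _ fun i _ => (hint i _ (hpm i) (hp01 i)).sub
            (hint i _ (hqm i) (hq01 i))).symm
      _ = ∫ x, ⟪X x, ∑ i, (p i x - q i x) • e i⟫ ∂l := by
          congr 1
          ext x
          rw [inner_sum]
          refine Finset.sum_congr rfl fun i _ => ?_
          rw [inner_smul_right, EuclideanSpace.inner_single_right]
          simp; ring

theorem LocallyFiniteFirstVar.exists_isDecomposition (h : V.LocallyFiniteFirstVar)
    (hU : IsOpen U) : ∃ H σ ν, V.IsDecomposition H σ ν := by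
  obtain ⟨l, k, B, hl, hk, hkB, hrep⟩ := h.exists_representation hU
  have hμ : IsRadonOn U V.mass := V.isRadonOn_mass hU
  have := hl.sigmaFinite hU
  have := hμ.sigmaFinite hU
  set s := l.singularPart V.mass with hs
  set g := l.rnDeriv V.mass with hg
  have hgm : Measurable g := l.measurable_rnDeriv V.mass
  have hsl : s ≤ l := l.singularPart_le V.mass
  have hgl : V.mass.withDensity g ≤ l := l.withDensity_rnDeriv_le V.mass
  have hkm : Measurable fun x => ‖k x‖ₑ := hk.enorm
  have hσs : s.withDensity (fun x => ‖k x‖ₑ) ≪ s := withDensity_absolutelyContinuous _ _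
  have hgfin : ∀ᵐ x ∂V.mass, g x < ∞ := l.rnDeriv_lt_top V.mass
  -- From `l = s + g μ_V`: the absolutely continuous part of `k l` is `-H μ_V`. On the singular part
  -- `k` is split into length and direction; the weight `|k|` discards the zeros of `k`, so the
  -- direction is a unit vector almost everywhere.
  refine ⟨fun x => -((g x).toReal • k x), s.withDensity fun x => ‖k x‖ₑ, fun x => ‖k x‖⁻¹ • k x,
    ?_, ?_, ?_, ?_, ?_, ?_, ?_⟩
  · refine (locallyIntegrableOn_iff hU.isLocallyClosed).2 fun K hKU hK => ?_
    refine Integrable.neg ?_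
    have h1 : IntegrableOn (fun x => (g x).toReal) K V.mass :=
      integrable_toReal_of_lintegral_ne_top hgm.aemeasurable
        ((Measure.setLIntegral_rnDeriv_le K).trans_lt (hl.2 K hK hKU)).ne
    exact h1.smul_bdd B hk.aestronglyMeasurable (Eventually.of_forall hkB)
  · exact hσs ((hl.mono hsl).1)
  · intro K hK hKU
    rw [withDensity_apply _ hK.measurableSet]
    calc ∫⁻ x in K, ‖k x‖ₑ ∂s ≤ ∫⁻ _ in K, B ∂s := lintegral_mono fun x => by
          exact ENNReal.coe_le_coe.2 (NNReal.coe_le_coe.1 (hkB x))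
      _ = B * s K := setLIntegral_const _ _
      _ < ∞ := ENNReal.mul_lt_top ENNReal.coe_lt_top ((hl.mono hsl).2 K hK hKU)
  · exact (l.mutuallySingular_singularPart V.mass).mono_ac hσs .rfl
  · exact hk.norm.inv.smul hk
  · refine (ae_withDensity_iff hkm).2 (Eventually.of_forall fun x hx => ?_)
    rw [norm_smul, norm_inv, norm_norm, inv_mul_cancel₀ (by simpa using hx)]
  · intro X hX
    have hbdd : ∀ m : Measure (Eucl N), IsRadonOn U m → Integrable (fun x => ⟪X x, k x⟫) m := by
      intro m hm
      refine ((hm.integrable hX.1.continuous hX.2.1 hX.2.2).norm.mul_const (B : ℝ)).mono'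
        (hX.1.continuous.aestronglyMeasurable.inner hk.aestronglyMeasurable)
        (Eventually.of_forall fun x => ?_)
      exact (norm_inner_le_norm _ _).trans (mul_le_mul_of_nonneg_left (hkB x) (norm_nonneg _))
    rw [hrep X hX]
    conv_lhs => rw [l.haveLebesgueDecomposition_add V.mass]
    rw [integral_add_measure (hbdd _ (hl.mono hsl)) (hbdd _ (hl.mono hgl)), add_comm,
      integral_withDensity_eq_integral_toReal_smul hgm hgfin,
      integral_withDensity_eq_integral_toReal_smul hkm
        (Eventually.of_forall fun x => enorm_lt_top), ← integral_neg]
    congr 1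
    · congr 1
      ext x
      rw [inner_neg_left, neg_neg, inner_smul_left, real_inner_comm]
      simp
    · congr 1
      ext x
      rw [inner_smul_right, toReal_enorm, smul_eq_mul]
      by_cases hx : k x = 0
      · simp [hx]
      · rw [← mul_assoc, mul_inv_cancel₀ (norm_ne_zero_iff.2 hx), one_mul]

lemma LocallyFiniteFirstVar.isDecomposition (h : V.LocallyFiniteFirstVar) (hU : IsOpen U) :
    V.IsDecomposition V.decomposition.1 V.bdryMeasure V.conormal := by
  obtain ⟨H, σ, ν, hd⟩ := h.exists_isDecomposition hU
  exact Classical.epsilon_spec (p := fun t : (Eucl N → Eucl N) × Measure (Eucl N) ×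
    (Eucl N → Eucl N) => V.IsDecomposition t.1 t.2.1 t.2.2) ⟨(H, σ, ν), hd⟩

end Varifold

/-! ### One-sided fundamental lemma of the calculus of variations -/

section FundamentalLemma

variable {N : ℕ} {O K : Set (Eucl N)} {σ μ τ : Measure (Eucl N)} {a b f : Eucl N → ℝ}

/-- Test functions equal to `1` on `K` and supported in shrinking neighbourhoods converge to the
indicator of `K` with an integrable majorant. -/
lemma setIntegral_nonneg_of_integral_isTest_nonneg (hO : IsOpen O)
    (hf : LocallyIntegrableOn f O τ)
    (h : ∀ φ, IsTest O φ → (∀ x, 0 ≤ φ x) → 0 ≤ ∫ x, φ x * f x ∂τ) (hK : IsCompact K)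
    (hKO : K ⊆ O) : 0 ≤ ∫ x in K, f x ∂τ := by
  obtain ⟨W, hWo, hKW, hWO, hWc⟩ := exists_open_between_and_isCompact_closure hK hO hKO
  have hpos : ∀ j : ℕ, 0 < 1 / ((j : ℝ) + 1) := fun j => Nat.one_div_pos_of_nat
  choose φ hφ hφ1 hφ01 using fun j : ℕ => exists_isTest_eq_one
    (hWo.inter (isOpen_thickening (δ := 1 / ((j : ℝ) + 1)) (E := K))) hK
    (subset_inter hKW (self_subset_thickening (hpos j) K))
  have hint : Integrable ((closure W).indicator f) τ :=
    (hf.integrableOn_compact_subset hWO hWc).integrable_indicator isClosed_closure.measurableSet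
  have hφW : ∀ j x, x ∉ closure W → φ j x = 0 := fun j x hx =>
    image_eq_zero_of_notMem_tsupport fun hx' => hx (subset_closure ((hφ j).2.2 hx').1)
  have hφeq : ∀ j x, φ j x * f x = φ j x * (closure W).indicator f x := fun j x => by
    by_cases hx : x ∈ closure W
    · rw [indicator_of_mem hx]
    · rw [hφW j x hx, zero_mul, zero_mul]
  have hlim : Tendsto (fun j => ∫ x, φ j x * (closure W).indicator f x ∂τ) atTop
      (𝓝 (∫ x, K.indicator f x ∂τ)) := by
    refine tendsto_integral_of_dominated_convergence (fun x => ‖(closure W).indicator f x‖)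
      (fun j => (hφ j).1.continuous.aestronglyMeasurable.mul hint.1) hint.norm
      (fun j => Eventually.of_forall fun x => ?_) (Eventually.of_forall fun x => ?_)
    · rw [norm_mul, Real.norm_of_nonneg (hφ01 j x).1]
      exact mul_le_of_le_one_left (norm_nonneg _) (hφ01 j x).2
    · by_cases hx : x ∈ K
      · simp only [hφ1 _ x hx, one_mul]
        rw [indicator_of_mem hx, indicator_of_mem (subset_closure (hKW hx))]
        exact tendsto_const_nhds
      · rw [indicator_of_notMem hx]
        refine tendsto_const_nhds.congr' ?_
        have hxc : x ∉ closure K := by rwa [hK.isClosed.closure_eq]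
        filter_upwards [tendsto_one_div_add_atTop_nhds_zero_nat.eventually
          (eventually_notMem_thickening_of_infEDist_pos hxc)] with j hj
        rw [image_eq_zero_of_notMem_tsupport fun hx' => hj ((hφ j).2.2 hx').2, zero_mul]
  rw [integral_indicator hK.measurableSet] at hlim
  refine ge_of_tendsto' hlim fun j => ?_
  simp only [← hφeq]
  exact h (φ j) ⟨(hφ j).1, (hφ j).2.1, (hφ j).2.2.trans (inter_subset_left.trans
    (subset_closure.trans hWO))⟩ fun x => (hφ01 j x).1

/-- If `f` were negative on a set of positive measure, inner regularity would give a compact set of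
positive measure on which `f < 0`, with negative integral. -/
lemma ae_nonneg_of_integral_isTest_nonneg (hO : IsOpen O)
    (hτ : ∀ K, IsCompact K → K ⊆ O → τ K < ∞) (hf : LocallyIntegrableOn f O τ)
    (h : ∀ φ, IsTest O φ → (∀ x, 0 ≤ φ x) → 0 ≤ ∫ x, φ x * f x ∂τ) :
    ∀ᵐ x ∂τ, x ∈ O → 0 ≤ f x := by
  have : LocallyCompactSpace O := hO.locallyCompactSpace
  obtain ⟨K, hK, hKO⟩ := isSigmaCompact_iff_sigmaCompactSpace.2 (inferInstance : SigmaCompactSpace O)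
  rw [← ae_restrict_iff' hO.measurableSet, ← hKO]
  refine (ae_restrict_iUnion_iff _ _).2 fun j => ?_
  have hKj : K j ⊆ O := hKO ▸ subset_iUnion K j
  have hfin : IsFiniteMeasure (τ.restrict (K j)) := ⟨by
    rw [Measure.restrict_apply_univ]; exact hτ _ (hK j) hKj⟩
  have hfj : IntegrableOn f (K j) τ := hf.integrableOn_compact_subset hKj (hK j)
  obtain ⟨g, hg, hfg⟩ := hfj.1
  have hgj : Integrable g (τ.restrict (K j)) := Integrable.congr hfj hfg
  suffices hnull : (τ.restrict (K j)) {x | g x < 0} = 0 by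
    filter_upwards [hfg, measure_eq_zero_iff_ae_notMem.1 hnull] with x hx hx'
    rw [hx]; exact not_lt.1 hx'
  by_contra hne
  have hgm : MeasurableSet {x | g x < 0} := hg.measurable measurableSet_Iio
  obtain ⟨C, hCg, hC, hCpos⟩ := hgm.exists_lt_isCompact (pos_iff_ne_zero.2 hne)
  have h1 : 0 ≤ ∫ x in C ∩ K j, f x ∂τ := setIntegral_nonneg_of_integral_isTest_nonneg hO hf h
    (hC.inter (hK j)) (inter_subset_right.trans hKj)
  rw [← Measure.restrict_restrict hC.measurableSet, setIntegral_congr_ae hC.measurableSet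
    (hfg.mono fun x hx _ => hx)] at h1
  have h2 : 0 < ∫ x in C, -g x ∂(τ.restrict (K j)) := by
    have hneg : IntegrableOn (fun x => -g x) C (τ.restrict (K j)) := hgj.neg.integrableOn
    rw [setIntegral_pos_iff_support_of_nonneg_ae _ hneg]
    · refine hCpos.trans_le (measure_mono fun x hx => ⟨?_, hx⟩)
      exact neg_ne_zero.2 (hCg hx).ne
    · exact ae_restrict_of_forall_mem hC.measurableSet fun x hx => neg_nonneg.2 (hCg hx).le
  rw [integral_neg] at h2
  linarith

/-- Tested against nonnegative functions, a measure dominates a mutually singular signed measure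
only if it is nonnegative. -/
lemma ae_nonneg_of_mutuallySingular (hO : IsOpen O) (hσμ : σ.MutuallySingular μ)
    (hσ : ∀ K, IsCompact K → K ⊆ O → σ K < ∞) (hμ : ∀ K, IsCompact K → K ⊆ O → μ K < ∞)
    (ha : LocallyIntegrableOn a O σ) (hb : LocallyIntegrableOn b O μ)
    (h : ∀ φ, IsTest O φ → (∀ x, 0 ≤ φ x) → ∫ x, φ x * b x ∂μ ≤ ∫ x, φ x * a x ∂σ) :
    ∀ᵐ x ∂σ, x ∈ O → 0 ≤ a x := by
  classical
  obtain ⟨s, hs, hσs, hμs⟩ := hσμ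
  -- Mutual singularity allows one function to be `a` for `σ` and `-b` for `μ`, so the hypothesis
  -- says that `f (σ + μ)` is nonnegative.
  set f : Eucl N → ℝ := s.piecewise (fun x => -b x) a with hf
  have hfσ : f =ᵐ[σ] a := by
    filter_upwards [measure_eq_zero_iff_ae_notMem.1 hσs] with x hx
    exact piecewise_eq_of_notMem _ _ _ hx
  have hfμ : f =ᵐ[μ] fun x => -b x := by
    filter_upwards [measure_eq_zero_iff_ae_notMem.1 hμs] with x hx
    exact piecewise_eq_of_mem _ _ _ (not_not.1 hx)
  have hcpt : ∀ K, IsCompact K → K ⊆ O → IntegrableOn f K σ ∧ IntegrableOn f K μ := by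
    intro K hK hKO
    exact ⟨(ha.integrableOn_compact_subset hKO hK).congr (ae_restrict_of_ae hfσ.symm),
      (hb.integrableOn_compact_subset hKO hK).neg.congr (ae_restrict_of_ae hfμ.symm)⟩
  have hfloc : LocallyIntegrableOn f O (σ + μ) :=
    (locallyIntegrableOn_iff hO.isLocallyClosed).2 fun K hKO hK =>
      (hcpt K hK hKO).1.add_measure (hcpt K hK hKO).2
  have hprod : ∀ (m : Measure (Eucl N)) (φ : Eucl N → ℝ), IsTest O φ →
      IntegrableOn f (tsupport φ) m → Integrable (fun x => φ x * f x) m := by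
    intro m φ hφ hm
    obtain ⟨B, hB⟩ := hφ.2.1.exists_bound_of_continuous hφ.1.continuous
    have h1 : IntegrableOn (fun x => φ x * f x) (tsupport φ) m :=
      Integrable.bdd_mul hm hφ.1.continuous.aestronglyMeasurable (c := B) (Eventually.of_forall hB)
    exact h1.integrable_of_forall_notMem_eq_zero fun x hx => by
      rw [image_eq_zero_of_notMem_tsupport hx, zero_mul]
  have hae := ae_nonneg_of_integral_isTest_nonneg hO (τ := σ + μ) (f := f)
    (fun K hK hKO => by
      rw [Measure.add_apply]; exact ENNReal.add_lt_top.2 ⟨hσ K hK hKO, hμ K hK hKO⟩) hfloc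
    fun φ hφ hφ0 => by
      have hi := hcpt _ hφ.2.1 hφ.2.2
      rw [integral_add_measure (hprod σ φ hφ hi.1) (hprod μ φ hφ hi.2),
        integral_congr_ae (hfσ.mono fun x hx => by rw [hx] : _ =ᵐ[σ] fun x => φ x * a x),
        integral_congr_ae (hfμ.mono fun x hx => by simp only [hx, mul_neg] :
          _ =ᵐ[μ] fun x => -(φ x * b x)), integral_neg]
      linarith [h φ hφ hφ0]
  rw [ae_add_measure_iff] at hae
  filter_upwards [hae.1, hfσ] with x hx hx' hxO
  rw [← hx']; exact hx hxO

end FundamentalLemma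

/-! ### The conormal of a varifold with free boundary -/

namespace Varifold

variable {n N : ℕ} {U S O T : Set (Eucl N)} {νS ν H k : Eucl N → Eucl N} {σ μ : Measure (Eucl N)}
  {V : Varifold n N U} {Y : Eucl N → Eucl N}

lemma _root_.IsTest.isC1c_smul_of_contDiffOn {φ : Eucl N → ℝ} (hφ : IsTest O φ) (hO : IsOpen O)
    (hOU : O ⊆ U) (hY : ContDiffOn ℝ 1 Y O) : IsC1c U fun x => φ x • Y x := by
  have hsub : tsupport (fun x => φ x • Y x) ⊆ tsupport φ := tsupport_smul_subset_left φ Y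
  refine ⟨contDiff_iff_contDiffAt.2 fun x => ?_, hφ.2.1.of_isClosed_subset isClosed_closure hsub,
    hsub.trans (hφ.2.2.trans hOU)⟩
  by_cases hx : x ∈ tsupport φ
  · exact hφ.1.contDiffAt.smul (hY.contDiffAt (hO.mem_nhds (hφ.2.2 hx)))
  · exact (contDiffAt_const (c := 0)).congr_of_eventuallyEq
      (notMem_tsupport_iff_eventuallyEq.1 fun h => hx (hsub h))

lemma _root_.MeasureTheory.LocallyIntegrableOn.inner_bounded (hO : IsOpen O)
    (hk : LocallyIntegrableOn k O μ) (hY : Measurable Y) {B : ℝ} (hYB : ∀ x, ‖Y x‖ ≤ B) :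
    LocallyIntegrableOn (fun x => ⟪Y x, k x⟫) O μ := by
  refine (locallyIntegrableOn_iff hO.isLocallyClosed).2 fun K hKO hK => ?_
  have h := hk.integrableOn_compact_subset hKO hK
  refine (h.norm.const_mul B).mono' (hY.aestronglyMeasurable.inner h.1)
    (Eventually.of_forall fun x => ?_)
  exact (norm_inner_le_norm _ _).trans (mul_le_mul_of_nonneg_right (hYB x) (norm_nonneg _))

lemma IsDecomposition.locallyIntegrableOn_conormal (hd : V.IsDecomposition H σ ν)
    (hU : IsOpen U) : LocallyIntegrableOn ν U σ := by
  refine (locallyIntegrableOn_iff hU.isLocallyClosed).2 fun K hKU hK => ?_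
  exact Measure.integrableOn_of_bounded (hd.locallyFinite K hK hKU).ne
    hd.measurable.aestronglyMeasurable (M := 1) (ae_restrict_of_ae (hd.unit.mono fun x hx => hx.le))

/-- The fields `φY` are admissible, and the two formulas for `δV(φY)` make `(Y · ν) σ` equal to a
density times `μ_V` on `O`. By singularity it must vanish; nonnegativity suffices, since it also
applies to `-Y`. -/
lemma IsDecomposition.inner_nonneg_of_isFreeBdryCurvature (hd : V.IsDecomposition k σ ν)
    (hH : V.IsFreeBdryCurvature S νS H) (hU : IsOpen U) (hO : IsOpen O) (hOU : O ⊆ U)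
    (hY : ContDiffOn ℝ 1 Y O) (hYm : Measurable Y) {B : ℝ} (hYB : ∀ x, ‖Y x‖ ≤ B)
    (hYS : ∀ x ∈ S, x ∈ O → ⟪Y x, νS x⟫ = 0) : ∀ᵐ x ∂σ, x ∈ O → 0 ≤ ⟪Y x, ν x⟫ := by
  have hμ := V.isRadonOn_mass hU
  refine ae_nonneg_of_mutuallySingular hO hd.singular
    (fun K hK hKO => hd.locallyFinite K hK (hKO.trans hOU))
    (fun K hK hKO => hμ.lt_top K hK (hKO.trans hOU))
    (((hd.locallyIntegrableOn_conormal hU).mono_set hOU).inner_bounded hO hYm hYB)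
    (((hd.locallyIntegrable.sub hH.1).mono_set hOU).inner_bounded hO hYm hYB)
    fun φ hφ _ => le_of_eq ?_
  have hX := hφ.isC1c_smul_of_contDiffOn hO hOU hY
  have h1 := hd.eq _ hX
  have h2 := hH.2 _ hX fun x hx => by
    by_cases hxO : x ∈ O
    · rw [real_inner_smul_left, hYS x hx hxO, mul_zero]
    · rw [image_eq_zero_of_notMem_tsupport fun h => hxO (hφ.2.2 h), zero_smul, inner_zero_left]
  have h3 := integral_sub (IsRadonOn.integrable_inner hd.locallyIntegrable hX)
    (IsRadonOn.integrable_inner hH.1 hX)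
  have e1 : ∫ x, φ x * ⟪Y x, (k - tangentialPart S νS H) x⟫ ∂V.mass =
      ∫ x, (⟪k x, φ x • Y x⟫ - ⟪tangentialPart S νS H x, φ x • Y x⟫) ∂V.mass := by
    congr 1; ext x
    rw [Pi.sub_apply, inner_sub_right, inner_smul_right, inner_smul_right, real_inner_comm (k x),
      real_inner_comm (tangentialPart S νS H x), mul_sub]
  have e2 : ∫ x, φ x * ⟪Y x, ν x⟫ ∂σ = ∫ x, ⟪φ x • Y x, ν x⟫ ∂σ := by
    congr 1; ext x; rw [real_inner_smul_left]
  rw [e1, e2, h3]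
  linarith

lemma IsDecomposition.inner_eq_zero_of_isFreeBdryCurvature (hd : V.IsDecomposition k σ ν)
    (hH : V.IsFreeBdryCurvature S νS H) (hU : IsOpen U) (hO : IsOpen O) (hOU : O ⊆ U)
    (hY : ContDiffOn ℝ 1 Y O) (hYm : Measurable Y) {B : ℝ} (hYB : ∀ x, ‖Y x‖ ≤ B)
    (hYS : ∀ x ∈ S, x ∈ O → ⟪Y x, νS x⟫ = 0) : ∀ᵐ x ∂σ, x ∈ O → ⟪Y x, ν x⟫ = 0 := by
  have h1 := hd.inner_nonneg_of_isFreeBdryCurvature hH hU hO hOU hY hYm hYB hYS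
  have h2 := hd.inner_nonneg_of_isFreeBdryCurvature hH hU hO hOU hY.neg hYm.neg (B := B)
    (fun x => by rw [norm_neg]; exact hYB x)
    (fun x hx hxO => by rw [inner_neg_left, hYS x hx hxO, neg_zero])
  filter_upwards [h1, h2] with x hx1 hx2 hxO
  have := hx2 hxO
  rw [inner_neg_left] at this
  linarith [hx1 hxO]

lemma _root_.eq_zero_of_inner_single_eq_zero {v : Eucl N}
    (h : ∀ i : Fin N, ⟪EuclideanSpace.single i (1 : ℝ), v⟫ = 0) : v = 0 := by
  ext i
  have := h i
  rwa [EuclideanSpace.inner_single_left, map_one, one_mul] at this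

/-- The boundary measure is carried by the barrier. -/
lemma IsDecomposition.measure_compl_eq_zero (hd : V.IsDecomposition k σ ν)
    (hH : V.IsFreeBdryCurvature S νS H) (hU : IsOpen U) (hS : IsClosed S) : σ Sᶜ = 0 := by
  -- Off `S` constant fields are admissible, so the conormal would be zero there, against `|ν| = 1`.
  have h : ∀ i : Fin N, ∀ᵐ x ∂σ, x ∈ U ∩ Sᶜ → ⟪EuclideanSpace.single i (1 : ℝ), ν x⟫ = 0 :=
    fun i => hd.inner_eq_zero_of_isFreeBdryCurvature hH hU (hU.inter hS.isOpen_compl)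
      inter_subset_left contDiffOn_const measurable_const (fun _ => le_rfl)
      fun x hx hxO => absurd hx hxO.2
  have hU0 := measure_eq_zero_iff_ae_notMem.1 hd.carried
  refine measure_eq_zero_iff_ae_notMem.2 ?_
  filter_upwards [ae_all_iff.2 h, hd.unit, hU0] with x hx hx1 hxU hxS
  rw [eq_zero_of_inner_single_eq_zero fun i => hx i ⟨not_not.1 hxU, hxS⟩, norm_zero] at hx1
  exact zero_ne_one hx1

/-- The conormal is normal to the barrier. -/
lemma IsDecomposition.conormal_eq_or_eq_neg {N₀ : Eucl N → Eucl N} {d : Eucl N → ℝ} {ρ : ℝ}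
    (hd : V.IsDecomposition k σ ν) (hH : V.IsFreeBdryCurvature S νS H) (hU : IsOpen U)
    (hS : IsClosed S) (hT : IsExtendedTube S νS ρ T d N₀) :
    ∀ᵐ x ∂σ, ν x = νS x ∨ ν x = -νS x := by
  -- The projections of the coordinate vectors orthogonal to `N₀` are `C¹` in the tube and span the
  -- tangent space along `S`.
  have h : ∀ i : Fin N, ∀ᵐ x ∂σ, x ∈ T ∩ U → ⟪EuclideanSpace.single i (1 : ℝ) -
      ⟪N₀ x, EuclideanSpace.single i (1 : ℝ)⟫ • N₀ x, ν x⟫ = 0 := fun i => by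
    have hN : ContDiffOn ℝ 1 N₀ (T ∩ U) := hT.contDiffOn.mono inter_subset_left
    have hm := hT.measurable_normal
    have hm' : Measurable fun x => ⟪N₀ x, EuclideanSpace.single i (1 : ℝ)⟫ • N₀ x :=
      (hm.inner (𝕜 := ℝ) measurable_const).smul hm
    refine hd.inner_eq_zero_of_isFreeBdryCurvature hH hU (hT.isOpen.inter hU) inter_subset_right
      (contDiffOn_const.sub ((hN.inner ℝ contDiffOn_const).smul hN))
      (measurable_const.sub hm') (B := 2) (fun x => ?_)
      fun x hx hxO => ?_
    · have h1 := hT.norm_normal_le x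
      have h2 : ‖EuclideanSpace.single i (1 : ℝ)‖ = 1 := by simp
      refine (norm_sub_le _ _).trans ?_
      rw [norm_smul, h2]
      have h3 := norm_inner_le_norm (𝕜 := ℝ) (N₀ x) (EuclideanSpace.single i (1 : ℝ))
      rw [h2, mul_one] at h3
      nlinarith [norm_nonneg (N₀ x), norm_nonneg ⟪N₀ x, EuclideanSpace.single i (1 : ℝ)⟫]
    · rw [← hT.eq_normal x hx, inner_sub_left, real_inner_smul_left, real_inner_self_eq_norm_sq,
        hT.norm_normal x (hT.subset hx), real_inner_comm]
      ring
  have hU0 := measure_eq_zero_iff_ae_notMem.1 hd.carried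
  have hS0 := measure_eq_zero_iff_ae_notMem.1 (hd.measure_compl_eq_zero hH hU hS)
  filter_upwards [ae_all_iff.2 h, hd.unit, hU0, hS0] with x hx hx1 hxU hxS
  have hxS' : x ∈ S := not_not.1 hxS
  have hxT := hT.subset hxS'
  have hν : ν x - ⟪N₀ x, ν x⟫ • N₀ x = 0 := eq_zero_of_inner_single_eq_zero fun i => by
    have := hx i ⟨hxT, not_not.1 hxU⟩
    rw [inner_sub_left, real_inner_smul_left] at this
    rw [inner_sub_right, inner_smul_right, real_inner_comm (N₀ x)]
    linarith
  rw [sub_eq_zero] at hν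
  have habs : |⟪N₀ x, ν x⟫| = 1 := by
    have := congrArg norm hν
    rw [norm_smul, hT.norm_normal x hxT, hx1, mul_one] at this
    exact this.symm
  rw [hT.eq_normal x hxS'] at hν habs
  rcases eq_or_eq_neg_of_abs_eq habs with h1 | h1 <;> rw [h1] at hν
  · left; rw [hν, one_smul]
  · right; rw [hν, neg_one_smul]

/-- A varifold whose boundary measure is carried by the barrier and whose conormal is normal to it
has free boundary. -/
lemma IsDecomposition.hasFreeBdry {N₀ : Eucl N → Eucl N} {d : Eucl N → ℝ} {ρ : ℝ}
    (hd : V.IsDecomposition k σ ν) (hU : IsOpen U) (hS : IsClosed S)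
    (hT : IsExtendedTube S νS ρ T d N₀) (hσ : σ Sᶜ = 0)
    (hν : ∀ᵐ x ∂σ, ν x = νS x ∨ ν x = -νS x) : V.HasFreeBdry S νS := by
  have hnormal : normalPart S νS k = S.indicator fun x => ⟪k x, N₀ x⟫ • N₀ x :=
    indicator_congr fun x hx => by rw [hT.eq_normal x hx]
  -- The generalized mean curvature itself serves as `H`: removing its normal part on `S` does not
  -- change the pairing with tangential fields.
  refine ⟨k, ?_, fun X hX hXS => ?_⟩
  · refine hd.locallyIntegrable.sub ((locallyIntegrableOn_iff hU.isLocallyClosed).2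
      fun K hKU hK => ?_)
    have h := hd.locallyIntegrable.integrableOn_compact_subset hKU hK
    rw [hnormal]
    have hm := hT.measurable_normal.aestronglyMeasurable (μ := V.mass.restrict K)
    have hm' : AEStronglyMeasurable (fun x => ⟪k x, N₀ x⟫ • N₀ x) (V.mass.restrict K) :=
      (h.1.inner (𝕜 := ℝ) hm).smul hm
    refine Integrable.mono' h.norm (hm'.indicator hS.measurableSet) (Eventually.of_forall fun x =>
      (norm_indicator_le_norm_self _ x).trans ?_)
    have h1 := hT.norm_normal_le x
    have h2 := norm_inner_le_norm (𝕜 := ℝ) (k x) (N₀ x)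
    rw [norm_smul]
    calc ‖⟪k x, N₀ x⟫‖ * ‖N₀ x‖ ≤ (‖k x‖ * 1) * 1 := by gcongr; exact h2.trans (by gcongr)
      _ = ‖k x‖ := by ring
  · have h0 : ∫ x, ⟪X x, ν x⟫ ∂σ = 0 := by
      refine integral_eq_zero_of_ae ?_
      filter_upwards [measure_eq_zero_iff_ae_notMem.1 hσ, hν] with x hx hxν
      have := hXS x (not_not.1 hx)
      rcases hxν with h | h <;> rw [h]
      · exact this
      · rw [inner_neg_right, this, neg_zero]; rfl
    rw [hd.eq X hX, h0, add_zero]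
    congr 2
    ext x
    by_cases hx : x ∈ S
    · rw [tangentialPart, normalPart, indicator_of_mem hx, inner_sub_left, real_inner_smul_left,
        real_inner_comm (X x) (νS x), hXS x hx, mul_zero, sub_zero]
    · rw [tangentialPart, normalPart, indicator_of_notMem hx, sub_zero]

end Varifold

/-! ### The one-sided case -/

variable {n N : ℕ} {U S T Ω : Set (Eucl N)} {νS ν H N₀ : Eucl N → Eucl N} {d : Eucl N → ℝ}
  {ρ : ℝ} {σ : Measure (Eucl N)} {V : Varifold n N U}

/-- A normal segment on the positive side starts outside the closure of `Ω` and, having `d > 0`,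
never meets `∂Ω = S` again; by connectedness it stays outside. -/
lemma IsTube.dist_nonpos_of_mem_closure (hT : IsTube S νS ρ T d N₀) (hΩ : IsOpen Ω)
    (hS : frontier Ω = S) (hout : ∀ x ∈ S, ∀ᶠ t in 𝓝[>] (0 : ℝ), x + t • νS x ∉ closure Ω)
    {p : Eucl N} (hp : p ∈ T) (hpΩ : p ∈ closure Ω) : d p ≤ 0 := by
  by_contra! hpos
  obtain ⟨a, ha, hpa, hfib⟩ := hT.fiber p hp
  obtain ⟨t, htΩ, ht⟩ := ((hout a ha).and (Ioo_mem_nhdsGT hpos)).exists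
  have hmiss : ∀ s ∈ Icc t (d p), a + s • νS a ∈ closure Ω → a + s • νS a ∈ Ω := fun s hs hsc => by
    have hs0 : 0 < s := ht.1.trans_le hs.1
    obtain ⟨h1, h2⟩ := hfib s (by rw [abs_of_pos hs0, abs_of_pos hpos]; exact hs.2)
    by_contra hsΩ
    have hsS : a + s • νS a ∈ S := hS ▸ ⟨hsc, fun h => hsΩ (interior_subset h)⟩
    exact hs0.ne' (h2.symm.trans ((hT.mem_iff _ h1).1 hsS))
  have hc : IsPreconnected ((fun s : ℝ => a + s • νS a) '' Icc t (d p)) :=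
    isPreconnected_Icc.image _ (by fun_prop)
  obtain ⟨q, -, hq1, hq2⟩ := hc Ω (closure Ω)ᶜ hΩ isClosed_closure.isOpen_compl
    (by
      rintro _ ⟨s, hs, rfl⟩
      exact (em _).imp (hmiss s hs) id)
    ⟨p, ⟨d p, right_mem_Icc.2 ht.2.le, hpa.symm⟩, by
      have := hmiss (d p) (right_mem_Icc.2 ht.2.le)
      rw [← hpa] at this
      exact this hpΩ⟩
    ⟨_, ⟨t, left_mem_Icc.2 ht.2.le, rfl⟩, htΩ⟩
  exact hq2 (subset_closure hq1)

lemma tendsto_integral_softZero_mul {α : Type*} [MeasurableSpace α] {m : Measure α} {g : α → ℝ}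
    (hg : Integrable g m) {t : α → ℝ} (ht : Measurable t) {e : ℕ → ℝ} (he : ∀ k, 0 < e k)
    (he0 : Tendsto e atTop (𝓝 0)) : Tendsto (fun k => ∫ x, softZero (e k) (t x) * g x ∂m) atTop
      (𝓝 (∫ x, (if t x = 0 then 1 else 0) * g x ∂m)) := by
  refine tendsto_integral_of_dominated_convergence (fun x => ‖g x‖)
    (fun k => (((contDiff_softZero (he k)).continuous.measurable.comp ht).aestronglyMeasurable).mul
      hg.1) hg.norm (fun k => Eventually.of_forall fun x => ?_) (Eventually.of_forall fun x => ?_)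
  · rw [norm_mul, Real.norm_of_nonneg (softZero_nonneg _)]
    exact mul_le_of_le_one_left (norm_nonneg _) (softZero_le_one (he k) _)
  · exact (tendsto_softZero (t x) he he0).mul_const _

namespace Varifold

/-- Tests with `softZero ε d • φN₀` and lets `ε → 0`, so that only integrals over `S` remain. Two
facts bound the first variation from below: the profile term is nonnegative where `d ≤ 0`, and on
`S` the divergence of `φN₀` is at least `-(n / ρ) φ` because the planes are tangent. -/
lemma IsDecomposition.integral_normal_le_of_dist_nonpos (hd : V.IsDecomposition H σ ν)
    (hV : V.IsIntegral) (hU : IsOpen U) (hS : IsClosed S) (hT : IsExtendedTube S νS ρ T d N₀)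
    (hside : ∀ᵐ p ∂V.toMeasure, p.1 ∈ T → d p.1 ≤ 0) {φ : Eucl N → ℝ} (hφ : IsTest (T ∩ U) φ)
    (hφ0 : ∀ x, 0 ≤ φ x) :
    (∫ x, (if d x = 0 then 1 else 0) * ⟪H x, φ x • N₀ x⟫ ∂V.mass) -
        n / ρ * ∫ x, (if d x = 0 then 1 else 0) * φ x ∂V.mass ≤
      ∫ x, (if d x = 0 then 1 else 0) * ⟪φ x • N₀ x, ν x⟫ ∂σ := by
  have hK : IsCompact (tsupport φ) := hφ.2.1
  have hKT : tsupport φ ⊆ T := hφ.2.2.trans inter_subset_left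
  have hKU : tsupport φ ⊆ U := hφ.2.2.trans inter_subset_right
  have hφ' : ∀ p ∈ T, p ∉ tsupport φ → φ p = 0 := fun p _ hp => image_eq_zero_of_notMem_tsupport hp
  have hφT : ContDiffOn ℝ 1 φ T := hφ.1.contDiffOn
  have hX : IsC1c U fun p => φ p • N₀ p := hT.isC1c_normalField hφT hK hKT hφ' hKU
  have he : ∀ k : ℕ, 0 < 1 / ((k : ℝ) + 1) := fun k => Nat.one_div_pos_of_nat
  have he0 := tendsto_one_div_add_atTop_nhds_zero_nat (𝕜 := ℝ)
  have hμ : IsRadonOn U V.mass := V.isRadonOn_mass hU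
  have hG := V.integrable_divPlane hX
  have hk : ∀ k : ℕ, ∫ p, softZero (1 / ((k : ℝ) + 1)) (d p.1) *
        divPlane p.2 (fun p => φ p • N₀ p) p.1 ∂V.toMeasure ≤
      -(∫ x, softZero (1 / ((k : ℝ) + 1)) (d x) * ⟪H x, φ x • N₀ x⟫ ∂V.mass) +
        ∫ x, softZero (1 / ((k : ℝ) + 1)) (d x) * ⟪φ x • N₀ x, ν x⟫ ∂σ := by
    intro k
    set ε : ℝ := 1 / ((k : ℝ) + 1)
    have hη : ContDiffOn ℝ 1 (fun p => softZero ε (d p) * φ p) T :=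
      (hT.contDiffOn_comp_dist (contDiff_softZero (he k))).mul hφT
    have hη0 : ∀ p ∈ T, p ∉ tsupport φ → softZero ε (d p) * φ p = 0 := fun p hp hpK => by
      rw [hφ' p hp hpK, mul_zero]
    have hXk : IsC1c U fun p => (softZero ε (d p) * φ p) • N₀ p :=
      hT.isC1c_normalField hη hK hKT hη0 hKU
    have h1 := hd.eq _ hXk
    have e1 : ∀ x, ⟪H x, (softZero ε (d x) * φ x) • N₀ x⟫ =
        softZero ε (d x) * ⟪H x, φ x • N₀ x⟫ := fun x => by
      rw [mul_smul, real_inner_smul_right]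
    have e2 : ∀ x, ⟪(softZero ε (d x) * φ x) • N₀ x, ν x⟫ =
        softZero ε (d x) * ⟪φ x • N₀ x, ν x⟫ := fun x => by
      rw [mul_smul, real_inner_smul_left]
    simp only [e1, e2] at h1
    rw [← h1, firstVar]
    refine integral_mono_ae (hG.bdd_mul ((((contDiff_softZero (he k)).continuous.measurable.comp
      (hT.measurable_dist.comp measurable_fst))).aestronglyMeasurable) (c := 1)
      (Eventually.of_forall fun p => ?_)) (V.integrable_divPlane hXk) ?_
    · rw [Real.norm_of_nonneg (softZero_nonneg _)]
      exact softZero_le_one (he k) _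
    · filter_upwards [hside] with p hp
      by_cases hpK : p.1 ∈ tsupport φ
      · have hpT := hKT hpK
        rw [hT.divPlane_comp_dist_smul (contDiff_softZero (he k)) hφT hpT]
        -- `softZero` increases on the negative half-line, so its term, which is not controlled in
        -- size, can be dropped.
        refine le_add_of_nonneg_left (mul_nonneg (mul_nonneg ?_ (hφ0 _)) (sq_nonneg _))
        rw [deriv_softZero (he k)]
        have := hp hpT
        have : 0 ≤ -2 * ε ^ 2 * d p.1 := by nlinarith [sq_nonneg ε]
        positivity
      · rw [hT.divPlane_normalField_of_notMem hK.isClosed hφ' hpK,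
          hT.divPlane_normalField_of_notMem hK.isClosed hη0 hpK, mul_zero]
  have hgH : Integrable (fun x => ⟪H x, φ x • N₀ x⟫) V.mass :=
    IsRadonOn.integrable_inner hd.locallyIntegrable hX
  have hgν : Integrable (fun x => ⟪φ x • N₀ x, ν x⟫) σ :=
    (IsRadonOn.integrable_inner (hd.locallyIntegrableOn_conormal hU) hX).congr
      (Eventually.of_forall fun x => real_inner_comm _ _)
  have hlim := le_of_tendsto_of_tendsto'
    (tendsto_integral_softZero_mul hG (hT.measurable_dist.comp measurable_fst) he he0)
    ((tendsto_integral_softZero_mul hgH hT.measurable_dist he he0).neg.add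
      (tendsto_integral_softZero_mul hgν hT.measurable_dist he he0)) hk
  have hχm : Measurable fun x => (if d x = 0 then 1 else 0 : ℝ) :=
    Measurable.ite (hT.measurable_dist (measurableSet_singleton 0)) measurable_const measurable_const
  have hχ1 : ∀ x, ‖(if d x = 0 then 1 else 0 : ℝ)‖ ≤ 1 := fun x => by split_ifs <;> simp
  have hφint : Integrable (fun x => (if d x = 0 then 1 else 0 : ℝ) * φ x) V.mass :=
    (hμ.integrable hφ.1.continuous hφ.2.1 hKU).bdd_mul hχm.aestronglyMeasurable
      (Eventually.of_forall hχ1)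
  have hlow : -(n / ρ * ∫ x, (if d x = 0 then 1 else 0) * φ x ∂V.mass) ≤
      ∫ p, (if d p.1 = 0 then 1 else 0) * divPlane p.2 (fun p => φ p • N₀ p) p.1 ∂V.toMeasure := by
    rw [← V.integral_fst hφint.1, ← integral_const_mul, ← integral_neg]
    refine integral_mono_ae ((V.integrable_fst hφint).const_mul _).neg
      (hG.bdd_mul (hχm.comp measurable_fst).aestronglyMeasurable
        (Eventually.of_forall fun p => hχ1 p.1)) ?_
    filter_upwards [hV.ae_proj_normal_eq_zero hS hT] with p hp
    by_cases hpd : d p.1 = 0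
    · have hpS := (hT.mem_hypersurface_iff _).2 hpd
      have hpT := hT.subset hpS
      simp only [if_pos hpd, one_mul]
      rw [hT.divPlane_normalField hφT hpT, hp hpS, map_zero, zero_add]
      have h1 := (abs_le.1 (hT.abs_planeTrace_normal_le hpT p.2)).1
      nlinarith [hφ0 p.1]
    · simp [if_neg hpd]
  have := hlow.trans hlim
  linarith

/-- If the varifold lies on one side of the barrier, the conormal points to the other side. -/
lemma IsDecomposition.conormal_eq_of_dist_nonpos (hd : V.IsDecomposition H σ ν)
    (hV : V.IsIntegral) (hU : IsOpen U) (hS : IsClosed S) (hT : IsExtendedTube S νS ρ T d N₀)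
    (hside : ∀ᵐ p ∂V.toMeasure, p.1 ∈ T → d p.1 ≤ 0) (hσ : σ Sᶜ = 0)
    (hν : ∀ᵐ x ∂σ, ν x = νS x ∨ ν x = -νS x) : ∀ᵐ x ∂σ, ν x = νS x := by
  have hμ : IsRadonOn U V.mass := V.isRadonOn_mass hU
  have hO : IsOpen (T ∩ U) := hT.isOpen.inter hU
  have hχm : Measurable fun x => (if d x = 0 then 1 else 0 : ℝ) :=
    Measurable.ite (hT.measurable_dist (measurableSet_singleton 0)) measurable_const measurable_const
  have hχ1 : ∀ x, ‖(if d x = 0 then 1 else 0 : ℝ)‖ ≤ 1 := fun x => by split_ifs <;> simp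
  have hYm : Measurable fun x => (if d x = 0 then 1 else 0 : ℝ) • N₀ x :=
    hχm.smul hT.measurable_normal
  have hY1 : ∀ x, ‖(if d x = 0 then 1 else 0 : ℝ) • N₀ x‖ ≤ 1 := fun x => by
    rw [norm_smul]
    exact mul_le_one₀ (hχ1 x) (norm_nonneg _) (hT.norm_normal_le x)
  have ha : LocallyIntegrableOn (fun x => ⟪(if d x = 0 then 1 else 0 : ℝ) • N₀ x, ν x⟫) (T ∩ U) σ :=
    ((hd.locallyIntegrableOn_conormal hU).mono_set inter_subset_right).inner_bounded hO hYm hY1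
  have hb₁ : LocallyIntegrableOn (fun x => ⟪(if d x = 0 then 1 else 0 : ℝ) • N₀ x, H x⟫) (T ∩ U)
      V.mass := (hd.locallyIntegrable.mono_set inter_subset_right).inner_bounded hO hYm hY1
  have hb₂ : LocallyIntegrableOn (fun x => n / ρ * (if d x = 0 then 1 else 0 : ℝ)) (T ∩ U)
      V.mass := by
    refine (locallyIntegrableOn_iff hO.isLocallyClosed).2 fun K hKO hK => ?_
    exact (Measure.integrableOn_of_bounded (hμ.lt_top K hK (hKO.trans inter_subset_right)).ne
      hχm.aestronglyMeasurable (M := 1) (Eventually.of_forall hχ1)).const_mul _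
  -- The curvature and `n / ρ` terms are densities against `μ_V`, hence invisible to the singular
  -- measure `σ`; this leaves `N₀ · ν ≥ 0` on `S`.
  have key := ae_nonneg_of_mutuallySingular hO hd.singular
    (fun K hK hKO => hd.locallyFinite K hK (hKO.trans inter_subset_right))
    (fun K hK hKO => hμ.lt_top K hK (hKO.trans inter_subset_right)) ha (hb₁.sub hb₂)
    fun φ hφ hφ0 => by
      have h := hd.integral_normal_le_of_dist_nonpos hV hU hS hT hside hφ hφ0
      have hφT : ContDiffOn ℝ 1 φ T := hφ.1.contDiffOn
      have hX : IsC1c U fun p => φ p • N₀ p := hT.isC1c_normalField hφT hφ.2.1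
        (hφ.2.2.trans inter_subset_left) (fun p _ hp => image_eq_zero_of_notMem_tsupport hp)
        (hφ.2.2.trans inter_subset_right)
      have h1 : Integrable (fun x => (if d x = 0 then 1 else 0 : ℝ) * ⟪H x, φ x • N₀ x⟫) V.mass :=
        (IsRadonOn.integrable_inner hd.locallyIntegrable hX).bdd_mul hχm.aestronglyMeasurable
          (Eventually.of_forall hχ1)
      have h2 : Integrable (fun x => (if d x = 0 then 1 else 0 : ℝ) * φ x) V.mass :=
        (hμ.integrable hφ.1.continuous hφ.2.1 (hφ.2.2.trans inter_subset_right)).bdd_mul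
          hχm.aestronglyMeasurable (Eventually.of_forall hχ1)
      rw [← integral_const_mul, ← integral_sub h1 (h2.const_mul _)] at h
      refine (le_of_eq ?_).trans (h.trans (le_of_eq ?_))
      · congr 1; ext x
        rw [Pi.sub_apply, real_inner_smul_left, real_inner_smul_right, real_inner_comm (H x)]
        ring
      · congr 1; ext x
        rw [real_inner_smul_left, real_inner_smul_left]
        ring
  have hU0 := measure_eq_zero_iff_ae_notMem.1 hd.carried
  have hS0 := measure_eq_zero_iff_ae_notMem.1 hσ
  filter_upwards [key, hU0, hS0, hν] with x hx hxU hxS hxν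
  have hxS' : x ∈ S := not_not.1 hxS
  have hxT := hT.subset hxS'
  refine hxν.resolve_right fun hneg => ?_
  have h1 := hx ⟨hxT, not_not.1 hxU⟩
  rw [if_pos ((hT.mem_hypersurface_iff x).1 hxS'), one_smul, hneg, hT.eq_normal x hxS',
    inner_neg_right, real_inner_self_eq_norm_sq, ← hT.eq_normal x hxS', hT.norm_normal x hxT] at h1
  norm_num at h1

end Varifold

end

/-! ### The main theorem -/

theorem mainTheorem9 (n : ℕ) :
    ∃ c : ℝ≥0, ∀ (N : ℕ) (S : Set (Eucl N)) (νS : Eucl N → Eucl N) (U : Set (Eucl N))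
      (V : Varifold n N U), n < N → IsOrientedHypersurface S νS → 0 < regScale 2 S →
      IsOpen U → V.IsIntegral →
      -- free boundary implies locally finite first variation, with a bound
      (V.HasFreeBdry S νS → V.LocallyFiniteFirstVar) ∧
      (∀ H : Eucl N → Eucl N, V.IsFreeBdryCurvature S νS H →
        ∀ W W' : Set (Eucl N), IsOpen W → IsOpen W' → closure W ⊆ W' →
          IsCompact (closure W') → closure W' ⊆ U →
          (V.totalVar W ≤ c * (∫⁻ x in W', ‖tangentialPart S νS H x‖ₑ ∂V.mass)
            + c * ((regScale 2 S)⁻¹ + (setDist W (frontier W'))⁻¹) * V.mass W') ∧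
          (∀ c₀ : ℝ, V.totalVar W ≤ c * (∫⁻ x in W', ‖tangentialPart S νS H x‖ₑ ∂V.mass)
            + c * ((reflScale c₀ S νS)⁻¹ + (setDist W (frontier W'))⁻¹) * V.mass W')) ∧
      -- characterization through the generalized boundary measure and conormal
      (V.HasFreeBdry S νS ↔
        V.LocallyFiniteFirstVar ∧ V.bdryMeasure Sᶜ = 0 ∧
          ∀ᵐ x ∂V.bdryMeasure, V.conormal x = νS x ∨ V.conormal x = -νS x) ∧
      -- the one-sided case
      (∀ Ω : Set (Eucl N), IsOpen Ω → frontier Ω = S →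
        (∀ x ∈ S, ∀ᶠ t in 𝓝[>] (0 : ℝ), x + t • νS x ∉ closure Ω) →
        V.mass (closure Ω)ᶜ = 0 →
        (V.HasFreeBdry S νS ↔
          V.LocallyFiniteFirstVar ∧ V.bdryMeasure Sᶜ = 0 ∧
            ∀ᵐ x ∂V.bdryMeasure, V.conormal x = νS x)) := by
  obtain ⟨c, hc⟩ := exists_totalVar_bound n
  refine ⟨c, fun N S νS U V hnN hS hreg hU hV => ?_⟩
  obtain ⟨a, ha0, ha⟩ := exists_between hreg
  have hatop : a ≠ ∞ := ha.ne_top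
  -- For the characterizations any tube will do; its width enters no conclusion.
  obtain ⟨T, d, N₀, hT⟩ := exists_isExtendedTube hS (ENNReal.toReal_pos ha0.ne' hatop)
    (by rwa [ENNReal.ofReal_toReal hatop])
  have hforward : V.HasFreeBdry S νS → V.LocallyFiniteFirstVar ∧ V.bdryMeasure Sᶜ = 0 ∧
      ∀ᵐ x ∂V.bdryMeasure, V.conormal x = νS x ∨ V.conormal x = -νS x := fun h => by
    have hfin := h.locallyFiniteFirstVar hnN hS hreg hU hV
    have hd := hfin.isDecomposition hU
    obtain ⟨H, hH⟩ := h
    exact ⟨hfin, hd.measure_compl_eq_zero hH hU hS.1, hd.conormal_eq_or_eq_neg hH hU hS.1 hT⟩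
  have hbackward : V.LocallyFiniteFirstVar → V.bdryMeasure Sᶜ = 0 →
      (∀ᵐ x ∂V.bdryMeasure, V.conormal x = νS x ∨ V.conormal x = -νS x) →
      V.HasFreeBdry S νS := fun hfin hσ hν =>
    (hfin.isDecomposition hU).hasFreeBdry hU hS.1 hT hσ hν
  refine ⟨fun h => (hforward h).1, fun H hH W W' _ hW' hWW' hW'c hW'U => ?_,
    ⟨hforward, fun h => hbackward h.1 h.2.1 h.2.2⟩, fun Ω hΩ hΩS hout hmass => ⟨fun h => ?_,
      fun h => hbackward h.1 h.2.1 (h.2.2.mono fun x hx => Or.inl hx)⟩⟩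
  · have hbound := hc N S νS U V hnN hS hreg hV H hH W W' hW' hWW' hW'c hW'U
    refine ⟨hbound, fun c₀ => hbound.trans ?_⟩
    have := reflScale_le_regScale (S := S) (νS := νS) c₀
    gcongr
  · obtain ⟨hfin, hσ, hν⟩ := hforward h
    refine ⟨hfin, hσ, (hfin.isDecomposition hU).conormal_eq_of_dist_nonpos hV hU hS.1 hT ?_ hσ hν⟩
    rw [V.mass_apply isClosed_closure.measurableSet.compl] at hmass
    filter_upwards [measure_eq_zero_iff_ae_notMem.1 hmass] with p hp hpT
    refine hT.toIsTube.dist_nonpos_of_mem_closure hΩ hΩS hout hpT ?_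
    by_contra hpΩ
    exact hp ⟨hpΩ, mem_univ _⟩
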